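/- **Setting.** Let $\mathbb G=\langle \mathbf G\rangle$ be a cyclic group of prime order $N$, written additively (for example the order-$N$ subgroup of the points of FourQ), with elements encoded injectively as bit strings on which addition is computed by a circuit. Let $\mathcal E$ (with decryption $\mathcal D$) be a symmetric encryption scheme and $\mathtt{MAC}$ a deterministic message authentication code, all computed by circuits on strings of fixed lengths; let $2<v<k$ be integers and $ID$ an identity. The functions $H$ (values in $\mathbb Z_N$) and $\mathtt{KDF}$ (values $(k_{enc},k_{MAC})$) are independent random oracles. The *size* of an instance is the total size of these data (bit lengths, $k$, circuit sizes). **The scheme DBPV-SC-ECIES.** *Kg*: draw $d,b\in\mathbb Z_N^*$ uniformly, $\mathbf D=d\mathbf G$, $\mathbf U=b\mathbf G$, $x=H(ID\|\mathbf U)\,b+d$; draw $r'_i\in\mathbb Z_N^*$ uniformly and put $\mathbf R'_i=r'_i\mathbf G$, $\mathbf S'_i=r'_i\,(H(ID\|\mathbf U)\mathbf U+\mathbf D)$ for $0\le i<k$; the table is $\Gamma=\{r'_i,\mathbf R'_i,\mathbf S'_i\}_{i<k}$ and the private key is $x$. *Enc*$(m)$: draw a uniform $v$-element set $J\subset\{0,\dots,k-1\}$,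 put $\mathbf R=\sum_{i\in J}\mathbf R'_i$, $\mathbf S=\sum_{i\in J}\mathbf S'_i$, $(k_{enc},k_{MAC})=\mathtt{KDF}(\mathbf S)$, $c=\mathcal E_{k_{enc}}(m)$, $\tau=\mathtt{MAC}_{k_{MAC}}(c)$ and output $(c,\tau,\mathbf R)$. *Dec*: recompute the keys from $x\mathbf R$, return "invalid" if the tag is wrong, and $\mathcal D_{k_{enc}}(c)$ otherwise. **Security notions.** Adversaries are probabilistic Boolean circuits (non-uniform algorithms), with gates that draw uniformly from $\{0,\dots,m\}$ and with oracle gates; the size counts all bits produced. In the IND-CPA experiment keys are generated, the adversary gets the public key $(ID,\mathbf U,\mathbf D)$, chooses $m_0,m_1$ of the common message length, gets $\mathrm{Enc}(m_\beta)$ for a uniform bit $\beta$, and outputs $\beta'$; in both phases it has oracle access to $\mathrm{Enc}(\cdot)$ (with the same table), $H$ and $\mathtt{KDF}$. The scheme is *$(t,\varepsilon)$-IND-CPA secure* if $\Pr[\beta=\beta']\le\frac12+\varepsilon$ for all adversaries of size at most $t$. Two conventions are considered, and everything below holds for each of them: $\Gamma$ is known only to the encrypting party, or $\Gamma$ is part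 of the public key. CDH is *$(t,\varepsilon)$-hard* if every circuit of size at most $t$ computes $ab\,\mathbf G$ from $(a\mathbf G,b\mathbf G)$, with $a,b\in\mathbb Z_N$ uniform, with probability at most $\varepsilon$. $\mathcal E$ is *$(t,\varepsilon)$-indistinguishable* if every adversary of size at most $t$ that chooses two messages and sees the encryption of one of them under a fresh uniform key guesses which one with probability at most $\frac12+\varepsilon$ (this is implied by IND-CPA security of $\mathcal E$). The output of the BPV generator is *$(t,\varepsilon)$-random* if every circuit of size at most $t$ distinguishes with advantage at most $\varepsilon$ between an oracle that returns fresh sums $\sum_{i\in J}r'_i\mathbf G$ ($J$ a uniform $v$-subset, the $r'_i\in\mathbb Z_N^*$ uniform and fixed) and an oracle that returns uniform points; the distinguisher is given $\{r'_i,\,r'_i\mathbf G\}_{i<k}$ if $\Gamma$ is public, and nothing otherwise. A family of instances indexed by $\kappa$ has one of these properties *asymptotically* if for every polynomial $p$ there is a negligible $\varepsilon$ such that the instance at $\kappa$ is $(p(\kappa),\varepsilon(\kappa))$-secure for every $\kappa$. **Theorem.** 1. There is an absolute constant $c\in\mathbb N$ such that for every instance of size $s$, all $t$ and $\varepsilon_1,\varepsilon_2,\varepsilon_3$,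 with $T=(c(t+s))^c$: if CDH is $(T,\varepsilon_1)$-hard, $\mathcal E$ is $(T,\varepsilon_2)$-indistinguishable, and the BPV output is $(T,\varepsilon_3)$-random, then the scheme is $\bigl(t,\;c\,(t+s)\,(\varepsilon_1+\varepsilon_2+\varepsilon_3+1/N)\bigr)$-IND-CPA secure. 2. For every instance and every $t$, the BPV output is $\Bigl(t,\;t\sqrt{N/\binom kv+1/(N-1)}\Bigr)$-random, without any assumption. 3. Consequently, for every family of instances of polynomially bounded size for which CDH is asymptotically hard and $\mathcal E$ is asymptotically indistinguishable, and whose parameters $(v,k)$ are such that $N/\binom kv$ is negligible or the BPV output is asymptotically random, the scheme is asymptotically IND-CPA secure. -/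

import Mathlib

/-! ### Probabilistic oracle circuits

The computational model: straight-line Boolean programs with gates for constants, NAND, uniform
sampling and oracle calls. All data are bit strings, and the size counts every bit produced. -/

/-- Bit strings of length `n`. -/
abbrev Bits (n : ℕ) : Type := Fin n → Bool

/-- A list of oracles, with the lengths of their inputs and of their answers. -/
structure OracleInterface where
  Op : Type
  inLen : Op → ℕ
  outLen : Op → ℕ

/-- No oracles. -/
abbrev OracleInterface.none : OracleInterface where
  Op := Empty
  inLen := fun _ => 0
  outLen := fun _ => 0

/-- A probabilistic Boolean circuit with oracle gates for `I`, with `o` output wires, in a context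
of `n` wires that already carry a value. Each gate makes new wires available to the gates after it.
The gate `sample m` draws a number uniformly from `{0, …, m}` and puts out its binary digits. -/
inductive Circuit (I : OracleInterface) (o : ℕ) : ℕ → Type where
  | out {n : ℕ} (w : Fin o → Fin n) : Circuit I o n
  | const {n : ℕ} (b : Bool) (rest : Circuit I o (n + 1)) : Circuit I o n
  | nand {n : ℕ} (i j : Fin n) (rest : Circuit I o (n + 1)) : Circuit I o n
  | sample {n : ℕ} (m : ℕ) (rest : Circuit I o (n + Nat.size m)) : Circuit I o n
  | query {n : ℕ} (q : I.Op) (w : Fin (I.inLen q) → Fin n)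
      (rest : Circuit I o (n + I.outLen q)) : Circuit I o n

/-- The size (cost) of a circuit. -/
def Circuit.size {I : OracleInterface} {o : ℕ} : {n : ℕ} → Circuit I o n → ℕ
  | _, .out _ => o + 1
  | _, .const _ rest => rest.size + 1
  | _, .nand _ _ rest => rest.size + 1
  | _, .sample m rest => rest.size + (Nat.size m + 1)
  | _, .query q _ rest => rest.size + (I.inLen q + I.outLen q + 1)

/-- The `n` low binary digits of a natural number, least significant first. -/
def natBits (n a : ℕ) : Bits n := fun i => a.testBit i

/-- The output distribution of a circuit, given (memoryless, possibly randomized) oracles. -/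
noncomputable def Circuit.run {I : OracleInterface} {o : ℕ}
    (O : (q : I.Op) → Bits (I.inLen q) → PMF (Bits (I.outLen q))) :
    {n : ℕ} → Circuit I o n → Bits n → PMF (Bits o)
  | _, .out w, e => PMF.pure (fun i => e (w i))
  | _, .const b rest, e => rest.run O (Fin.append e (fun _ : Fin 1 => b))
  | _, .nand i j rest, e => rest.run O (Fin.append e (fun _ : Fin 1 => !(e i && e j)))
  | _, .sample m rest, e =>
      (PMF.uniformOfFintype (Fin (m + 1))).bind fun a =>
        rest.run O (Fin.append e (natBits (Nat.size m) a))
  | _, .query q w rest, e =>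
      (O q (fun i => e (w i))).bind fun y => rest.run O (Fin.append e y)

/-- Circuits without oracles, with `a` input bits and `b` output bits. -/
abbrev Alg (a b : ℕ) : Type := Circuit OracleInterface.none b a

/-- The output distribution of a circuit without oracles. -/
noncomputable def Alg.eval {a b : ℕ} (A : Alg a b) (e : Bits a) : PMF (Bits b) :=
  Circuit.run (I := OracleInterface.none) (fun q => Empty.elim q) A e

/-! ### The building blocks of the scheme -/

/-- Everything that is fixed before key generation: a group of prime order `N` with generator `g`
(such as the order-`N` subgroup of the points of FourQ), whose elements are written as bit strings
and added by a circuit; the identity of the receiver; the parameters `(v, k)` of the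
precomputation; a symmetric encryption scheme and a deterministic message authentication code. -/
structure ECIESInstance where
  G : Type
  [group : AddCommGroup G]
  [fintype : Fintype G]
  N : ℕ
  [prime : Fact N.Prime]
  card_eq : Fintype.card G = N
  g : G
  g_ne_zero : g ≠ 0
  pointLen : ℕ
  encode : G → Bits pointLen
  encode_injective : Function.Injective encode
  addAlg : Alg (pointLen + pointLen) pointLen
  addAlg_spec : ∀ a b : G,
    addAlg.eval (Fin.append (encode a) (encode b)) = PMF.pure (encode (a + b))
  idLen : ℕ
  ID : Bits idLen
  k : ℕ
  v : ℕ
  two_lt_v : 2 < v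
  v_lt_k : v < k
  msgLen : ℕ
  ctLen : ℕ
  tagLen : ℕ
  encKeyLen : ℕ
  macKeyLen : ℕ
  symEnc : Alg (encKeyLen + msgLen) ctLen
  symDec : Alg (encKeyLen + ctLen) msgLen
  symDec_symEnc : ∀ (key : Bits encKeyLen) (m : Bits msgLen),
    ∀ c ∈ (symEnc.eval (Fin.append key m)).support,
      symDec.eval (Fin.append key c) = PMF.pure m
  mac : Alg (macKeyLen + ctLen) tagLen
  mac_deterministic : ∀ e, ∃ y, mac.eval e = PMF.pure y

namespace ECIESInstance

attribute [instance] ECIESInstance.group ECIESInstance.fintype ECIESInstance.prime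

/-- The total size of the description of an instance. -/
def size (P : ECIESInstance) : ℕ :=
  Nat.size P.N + P.pointLen + P.addAlg.size + P.idLen + P.k + P.msgLen + P.ctLen + P.tagLen +
    P.encKeyLen + P.macKeyLen + P.symEnc.size + P.symDec.size + P.mac.size

variable (P : ECIESInstance)

/-- Scalar multiplication of a point by a residue modulo `N`. -/
def smul (a : ZMod P.N) (X : P.G) : P.G := a.val • X

/-- Binary digits of a residue modulo `N`. -/
def scalarBits (a : ZMod P.N) : Bits (Nat.size P.N) := natBits (Nat.size P.N) a.val

/-- The hash function `H`, read on strings `ID ‖ U`. -/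
abbrev Hash : Type := Bits (P.idLen + P.pointLen) → ZMod P.N

/-- The key derivation function; its value is `(k_enc, k_MAC)`. -/
abbrev Kdf : Type := Bits P.pointLen → Bits P.encKeyLen × Bits P.macKeyLen

/-! ### Key generation, encryption, decryption -/

/-- The precomputation table `Γ = {r'_i, R'_i, S'_i}`. -/
structure Table where
  r : Fin P.k → (ZMod P.N)ˣ
  R : Fin P.k → P.G
  S : Fin P.k → P.G

/-- The output of key generation, together with the public key `D` of the key generation center. -/
structure Keys where
  Γ : P.Table
  x : ZMod P.N
  U : P.G
  D : P.G

/-- Key generation. -/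
noncomputable def kg (H : P.Hash) : PMF P.Keys :=
  (PMF.uniformOfFintype (ZMod P.N)ˣ).bind fun d =>
  (PMF.uniformOfFintype (ZMod P.N)ˣ).bind fun b =>
  (PMF.uniformOfFintype (Fin P.k → (ZMod P.N)ˣ)).bind fun r =>
    let D : P.G := P.smul d P.g
    let U : P.G := P.smul b P.g
    let h : ZMod P.N := H (Fin.append P.ID (P.encode U))
    PMF.pure
      { Γ :=
          { r := r
            R := fun i => P.smul (r i) P.g
            S := fun i => P.smul (r i) (P.smul h U + D) }
        x := h * b + d
        U := U
        D := D }

theorem subsets_nonempty :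
    (Finset.powersetCard P.v (Finset.univ : Finset (Fin P.k))).Nonempty :=
  Finset.powersetCard_nonempty.2 (by simpa using P.v_lt_k.le)

/-- A uniformly random `v`-element subset of the `k` table positions. -/
noncomputable def randomSubset : PMF (Finset (Fin P.k)) :=
  PMF.uniformOfFinset (Finset.powersetCard P.v Finset.univ) P.subsets_nonempty

/-- Ciphertexts `(c, d, R)`. -/
structure Ciphertext where
  c : Bits P.ctLen
  d : Bits P.tagLen
  R : P.G

/-- Encryption. -/
noncomputable def enc (kdf : P.Kdf) (Γ : P.Table) (m : Bits P.msgLen) : PMF P.Ciphertext :=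
  P.randomSubset.bind fun J =>
    let R : P.G := ∑ i ∈ J, Γ.R i
    let S : P.G := ∑ i ∈ J, Γ.S i
    let keys := kdf (P.encode S)
    (P.symEnc.eval (Fin.append keys.1 m)).bind fun c =>
    (P.mac.eval (Fin.append keys.2 c)).bind fun d =>
      PMF.pure ⟨c, d, R⟩

/-- Decryption with the private key `x`; the value `none` means "invalid". -/
noncomputable def dec (kdf : P.Kdf) (x : ZMod P.N) (C : P.Ciphertext) :
    PMF (Option (Bits P.msgLen)) :=
  let keys := kdf (P.encode (P.smul x C.R))
  (P.mac.eval (Fin.append keys.2 C.c)).bind fun d' =>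
    if C.d = d' then (P.symDec.eval (Fin.append keys.1 C.c)).map some else PMF.pure none

/-! ### The chosen-plaintext experiment -/

/-- The oracles of the adversary: encryption, and the random oracles `H` and `KDF`. -/
inductive CPAOp where
  | enc
  | hash
  | kdf

/-- Length of the bit string that describes a ciphertext. -/
abbrev cipherLen : ℕ := P.ctLen + P.tagLen + P.pointLen

/-- Input and output lengths of the oracles of the adversary. -/
abbrev cpaInterface : OracleInterface where
  Op := CPAOp
  inLen := fun
    | .enc => P.msgLen
    | .hash => P.idLen + P.pointLen
    | .kdf => P.pointLen
  outLen := fun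
    | .enc => P.cipherLen
    | .hash => Nat.size P.N
    | .kdf => P.encKeyLen + P.macKeyLen

/-- A ciphertext as a bit string. -/
def cipherBits (C : P.Ciphertext) : Bits P.cipherLen :=
  Fin.append (Fin.append C.c C.d) (P.encode C.R)

/-- The oracles of the adversary. -/
noncomputable def cpaOracles (H : P.Hash) (kdf : P.Kdf) (Γ : P.Table) :
    (q : P.cpaInterface.Op) → Bits (P.cpaInterface.inLen q) → PMF (Bits (P.cpaInterface.outLen q))
  | .enc, m => (P.enc kdf Γ m).map P.cipherBits
  | .hash, e => PMF.pure (P.scalarBits (H e))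
  | .kdf, e => PMF.pure (Fin.append (kdf e).1 (kdf e).2)

/-- Length of one table row. -/
abbrev rowLen : ℕ := Nat.size P.N + P.pointLen + P.pointLen

/-- What the adversary sees of the table: everything if the table is public, otherwise nothing
(a string of zeros). -/
def tableBits (pub : Bool) (Γ : P.Table) : Bits (P.k * P.rowLen) := fun j =>
  pub && Fin.append (Fin.append (P.scalarBits (Γ.r j.divNat)) (P.encode (Γ.R j.divNat)))
    (P.encode (Γ.S j.divNat)) j.modNat

/-- Length of the public key. -/
abbrev pkLen : ℕ := P.idLen + P.pointLen + P.pointLen + P.k * P.rowLen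

/-- The public key `(ID, U, D)`, followed by the table if the table is public. -/
def pkBits (pub : Bool) (K : P.Keys) : Bits P.pkLen :=
  Fin.append (Fin.append (Fin.append P.ID (P.encode K.U)) (P.encode K.D)) (P.tableBits pub K.Γ)

/-- A two-stage adversary: `choose` reads the public key and puts out `m₀`, `m₁` and a state;
`guess` reads the public key, the state and the challenge ciphertext and puts out a bit. -/
structure CPAAdversary where
  stLen : ℕ
  choose : Circuit P.cpaInterface (P.msgLen + P.msgLen + stLen) P.pkLen
  guess : Circuit P.cpaInterface 1 (P.pkLen + stLen + P.cipherLen)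

/-- The size of an adversary. -/
def CPAAdversary.size {P : ECIESInstance} (A : P.CPAAdversary) : ℕ :=
  A.choose.size + A.guess.size

/-- The IND-CPA experiment; its value says whether the adversary wins. -/
noncomputable def cpaExperiment (pub : Bool) (A : P.CPAAdversary) : PMF Bool :=
  (PMF.uniformOfFintype P.Hash).bind fun H =>
  (PMF.uniformOfFintype P.Kdf).bind fun kdf =>
  (P.kg H).bind fun K =>
    let O := P.cpaOracles H kdf K.Γ
    let pk := P.pkBits pub K
    (A.choose.run O pk).bind fun y =>
      let m₀ : Bits P.msgLen := fun i => y (Fin.castAdd A.stLen (Fin.castAdd P.msgLen i))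
      let m₁ : Bits P.msgLen := fun i => y (Fin.castAdd A.stLen (Fin.natAdd P.msgLen i))
      let st : Bits A.stLen := fun i => y (Fin.natAdd (P.msgLen + P.msgLen) i)
      (PMF.uniformOfFintype Bool).bind fun b =>
      (P.enc kdf K.Γ (if b then m₁ else m₀)).bind fun C =>
      (A.guess.run O (Fin.append (Fin.append pk st) (P.cipherBits C))).bind fun b' =>
        PMF.pure (b' 0 == b)

/-- `(t, ε)`-IND-CPA security of the public-key scheme. -/
def INDCPA (pub : Bool) (t : ℕ) (ε : ℝ) : Prop :=
  ∀ A : P.CPAAdversary, A.size ≤ t → (P.cpaExperiment pub A true).toReal ≤ 1 / 2 + ε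

/-! ### The problems that security rests on -/

/-- The computational Diffie–Hellman experiment in `G`. -/
noncomputable def cdhExperiment (B : Alg (P.pointLen + P.pointLen) P.pointLen) : PMF Bool :=
  (PMF.uniformOfFintype (ZMod P.N)).bind fun a =>
  (PMF.uniformOfFintype (ZMod P.N)).bind fun b =>
  (B.eval (Fin.append (P.encode (P.smul a P.g)) (P.encode (P.smul b P.g)))).bind fun Z =>
    PMF.pure (decide (Z = P.encode (P.smul (a * b) P.g)))

/-- `(t, ε)`-hardness of the computational Diffie–Hellman problem. -/
def CDHHard (t : ℕ) (ε : ℝ) : Prop :=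
  ∀ B : Alg (P.pointLen + P.pointLen) P.pointLen, B.size ≤ t →
    (P.cdhExperiment B true).toReal ≤ ε

/-- An adversary against the symmetric encryption scheme, which sees one ciphertext. -/
structure SymAdversary where
  stLen : ℕ
  choose : Alg 0 (P.msgLen + P.msgLen + stLen)
  guess : Alg (stLen + P.ctLen) 1

/-- The size of an adversary. -/
def SymAdversary.size {P : ECIESInstance} (A : P.SymAdversary) : ℕ :=
  A.choose.size + A.guess.size

/-- Indistinguishability of encryptions under a fresh random key. -/
noncomputable def symExperiment (A : P.SymAdversary) : PMF Bool :=
  (PMF.uniformOfFintype (Bits P.encKeyLen)).bind fun key =>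
  (A.choose.eval Fin.elim0).bind fun y =>
    let m₀ : Bits P.msgLen := fun i => y (Fin.castAdd A.stLen (Fin.castAdd P.msgLen i))
    let m₁ : Bits P.msgLen := fun i => y (Fin.castAdd A.stLen (Fin.natAdd P.msgLen i))
    let st : Bits A.stLen := fun i => y (Fin.natAdd (P.msgLen + P.msgLen) i)
    (PMF.uniformOfFintype Bool).bind fun b =>
    (P.symEnc.eval (Fin.append key (if b then m₁ else m₀))).bind fun c =>
    (A.guess.eval (Fin.append st c)).bind fun b' =>
      PMF.pure (b' 0 == b)

/-- `(t, ε)`-indistinguishability of one encryption by the symmetric scheme. This is what remains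
of its IND-CPA security for adversaries that make no call to the encryption oracle. -/
def SymIND (t : ℕ) (ε : ℝ) : Prop :=
  ∀ A : P.SymAdversary, A.size ≤ t → (P.symExperiment A true).toReal ≤ 1 / 2 + ε

/-- The single oracle of a distinguisher for the BPV generator: it returns a point. -/
abbrev bpvInterface : OracleInterface where
  Op := Unit
  inLen := fun _ => 0
  outLen := fun _ => P.pointLen

/-- What the distinguisher sees of the BPV table `{r'_i, R'_i}`: everything or nothing. -/
def bpvTableBits (pub : Bool) (r : Fin P.k → (ZMod P.N)ˣ) :
    Bits (P.k * (Nat.size P.N + P.pointLen)) := fun j =>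
  pub && Fin.append (P.scalarBits (r j.divNat)) (P.encode (P.smul (r j.divNat) P.g)) j.modNat

/-- Distinguishers for the BPV generator. -/
abbrev BPVDistinguisher : Type :=
  Circuit P.bpvInterface 1 (P.k * (Nat.size P.N + P.pointLen))

/-- The points `R` put out by the online phase of the BPV generator. -/
noncomputable def bpvOutput (r : Fin P.k → (ZMod P.N)ˣ) : PMF P.G :=
  P.randomSubset.map fun J => ∑ i ∈ J, P.smul (r i) P.g

/-- The distinguisher calls the BPV generator (`real`), or an oracle for uniform points. -/
noncomputable def bpvExperiment (pub real : Bool) (A : P.BPVDistinguisher) : PMF Bool :=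
  (PMF.uniformOfFintype (Fin P.k → (ZMod P.N)ˣ)).bind fun r =>
  (A.run (I := P.bpvInterface)
    (fun _ _ => (if real then P.bpvOutput r else PMF.uniformOfFintype P.G).map P.encode)
    (P.bpvTableBits pub r)).map fun y => y 0

/-- `(t, ε)`-pseudorandomness of the output of the BPV generator. -/
def BPVRandom (pub : Bool) (t : ℕ) (ε : ℝ) : Prop :=
  ∀ A : P.BPVDistinguisher, A.size ≤ t →
    |(P.bpvExperiment pub true A true).toReal - (P.bpvExperiment pub false A true).toReal| ≤ ε

end ECIESInstance

/-! ### Asymptotic security -/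

/-- Negligible functions of the security parameter. -/
def Negligible (ε : ℕ → ℝ) : Prop :=
  Asymptotics.SuperpolynomialDecay Filter.atTop (fun κ : ℕ => (κ : ℝ)) ε

/-- Asymptotic security against polynomial-size adversaries, from a family, indexed by the security
parameter, of `(t, ε)`-security notions. -/
def AsymptoticallySecure (Sec : ℕ → ℕ → ℝ → Prop) : Prop :=
  ∀ p : Polynomial ℕ, ∃ ε : ℕ → ℝ, Negligible ε ∧ ∀ κ : ℕ, Sec κ (p.eval κ) (ε κ)

/-! Concrete security is a chain of games. Put `x = H(ID‖U) b + d`. Since `hU + D = xG` with `h =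
H(ID‖U)`, every encryption uses a pair `(R, xR)` whose first component comes from the BPV generator.

First, a distinguisher that chose `d`, `b`, `h` itself knows `x` and completes any point `R` to `(R,
xR)`. So all points, in the oracle answers and in the challenge, can be made uniform at cost `ε₃`
(`phasesValue_bpv_le`). A public table is no obstacle, because its third column is `x` times its
second. Next, resample `KDF` at the challenge value `xR`. The challenge is then encrypted under a
fresh pair of keys, and the adversary can notice this only if an oracle evaluates `KDF` at `xR`
(`phasesValue_ideal_le`). An encryption query does so with probability `1/N`, unless `x = 0`. A
direct `KDF` query that does so has computed `xR` from `xG` and `R`, which is a Diffie–Hellman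
solution (`expect_freshValue_cdh_le`). The critical query is not guessed: the error is a sum over
all query positions, each with its own truncated adversary. What remains is one symmetric encryption
under a fresh key, with a MAC key that the reduction may choose (`expect_freshValue_guessed_le`).
The requirement that `d` be nonzero accounts for the factors 2 and 3 in the final bound
(`expect_units_le`, `expect_hitBound_le`).

The reductions have to be actual circuits without random oracles, and two devices provide this.
Random functions are sampled lazily in tables of fixed capacity; `Simulates` compares the joint law
of the answer and the hidden functions, so that it composes query by query. `Computes` allows a
mixture of circuits with an arbitrary mixing distribution: hardness bounds every member of the
mixture, hence also the average, so sampling from any input-independent distribution needs no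
sampling circuit.

The statistical bound is a collision argument. For a random table, two independent subset sums
coincide with probability at most `1/binom(k,v) + 1/(N-1)`; by Cauchy–Schwarz the output is then
close to uniform, on average over the table and conditionally on it, which covers both conventions.
One such distance is paid per query.

The asymptotic statement combines these two bounds. The terms `1/N` need no assumption of their own,
because CDH hardness already forces `1/N ≤ ε₁`. -/

section

open scoped ENNReal

/-! ### Expectations and one-sided closeness of distributions -/

namespace PMF

universe u v w

variable {α : Type u} {β : Type v} {γ : Type w}

/-- The expectation of a nonnegative function. -/
noncomputable def expect (p : PMF α) (f : α → ℝ≥0∞) : ℝ≥0∞ := ∑' a, p a * f a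

@[simp]
theorem expect_pure (a : α) (f : α → ℝ≥0∞) : (pure a).expect f = f a := by
  rw [expect, tsum_eq_single a]
  · simp
  · intro b hb
    simp [pure_apply, hb]

@[simp]
theorem expect_bind (p : PMF α) (g : α → PMF β) (f : β → ℝ≥0∞) :
    (p.bind g).expect f = p.expect fun a => (g a).expect f := by
  simp only [expect, bind_apply, ← ENNReal.tsum_mul_left, ← ENNReal.tsum_mul_right]
  rw [ENNReal.tsum_comm]
  simp only [mul_assoc]

@[simp]
theorem expect_map (p : PMF α) (g : α → β) (f : β → ℝ≥0∞) :
    (p.map g).expect f = p.expect fun a => f (g a) := by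
  rw [← bind_pure_comp, expect_bind]
  simp

theorem expect_mono (p : PMF α) {f g : α → ℝ≥0∞} (h : ∀ a, f a ≤ g a) :
    p.expect f ≤ p.expect g :=
  ENNReal.tsum_le_tsum fun a => by gcongr; exact h a

theorem expect_add (p : PMF α) (f g : α → ℝ≥0∞) :
    (p.expect fun a => f a + g a) = p.expect f + p.expect g := by
  simp only [expect, mul_add, ENNReal.tsum_add]

theorem expect_mul_left (p : PMF α) (c : ℝ≥0∞) (f : α → ℝ≥0∞) :
    (p.expect fun a => c * f a) = c * p.expect f := by
  simp only [expect, ← ENNReal.tsum_mul_left]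
  exact tsum_congr fun a => by ring

@[simp]
theorem expect_const (p : PMF α) (c : ℝ≥0∞) : (p.expect fun _ => c) = c := by
  simp [expect, ENNReal.tsum_mul_right]

theorem expect_le_const (p : PMF α) {f : α → ℝ≥0∞} {c : ℝ≥0∞} (h : ∀ a, f a ≤ c) :
    p.expect f ≤ c := by
  simpa using p.expect_mono h

theorem expect_comm (p : PMF α) (q : PMF β) (f : α → β → ℝ≥0∞) :
    (p.expect fun a => q.expect fun b => f a b) = q.expect fun b => p.expect fun a => f a b := by
  simp only [expect, ← ENNReal.tsum_mul_left]
  rw [ENNReal.tsum_comm]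
  exact tsum_congr fun b => tsum_congr fun a => by ring

theorem expect_list_sum {ι : Type*} (p : PMF α) (l : List ι) (f : ι → α → ℝ≥0∞) :
    (p.expect fun a => (l.map fun i => f i a).sum) = (l.map fun i => p.expect (f i)).sum := by
  induction l with
  | nil => simp
  | cons i l ih => simp only [List.map_cons, List.sum_cons, expect_add, ih]

theorem apply_eq_expect [DecidableEq α] (p : PMF α) (a : α) :
    p a = p.expect fun b => if b = a then 1 else 0 := by
  rw [expect, tsum_eq_single a]
  · simp
  · intro b hb
    simp [hb]

theorem bind_apply_eq_expect (p : PMF α) (g : α → PMF β) (b : β) :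
    (p.bind g) b = p.expect fun a => g a b := rfl

theorem ext_expect {p q : PMF α} (h : ∀ f, p.expect f = q.expect f) : p = q := by
  classical
  ext a
  rw [apply_eq_expect, apply_eq_expect q, h]

theorem expect_uniformOfFintype [Fintype α] [Nonempty α] (f : α → ℝ≥0∞) :
    (uniformOfFintype α).expect f = (Fintype.card α : ℝ≥0∞)⁻¹ * ∑ a, f a := by
  simp [expect, tsum_fintype, Finset.mul_sum]

theorem uniformOfFintype_map_equiv [Fintype α] [Nonempty α] [Fintype β] [Nonempty β] (e : α ≃ β) :
    (uniformOfFintype α).map e = uniformOfFintype β := by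
  refine ext_expect fun f => ?_
  rw [expect_map, expect_uniformOfFintype, expect_uniformOfFintype, Fintype.card_congr e,
    Equiv.sum_comp e f]

theorem expect_uniformOfFintype_prod [Fintype α] [Nonempty α] [Fintype β] [Nonempty β]
    (f : α × β → ℝ≥0∞) :
    (uniformOfFintype (α × β)).expect f =
      (uniformOfFintype α).expect fun a => (uniformOfFintype β).expect fun b => f (a, b) := by
  simp only [expect_uniformOfFintype, Fintype.card_prod, Fintype.sum_prod_type, Nat.cast_mul,
    ← Finset.mul_sum]
  rw [ENNReal.mul_inv (by simp) (by simp), mul_assoc]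

/-- A uniformly random function may be resampled at one point. -/
theorem expect_uniform_update [Fintype α] [DecidableEq α] [Fintype β] [Nonempty β]
    (x : α) (F : (α → β) → ℝ≥0∞) :
    (uniformOfFintype (α → β)).expect F =
      (uniformOfFintype β).expect fun y =>
        (uniformOfFintype (α → β)).expect fun f => F (Function.update f x y) := by
  -- A function is its value at `x` together with its restriction to the other points. On the right
  -- the value drawn with the function is overwritten, so it averages out.
  rw [← uniformOfFintype_map_equiv (Equiv.funSplitAt x β).symm, expect_map,
    expect_uniformOfFintype_prod]
  refine congrArg _ (funext fun y => ?_)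
  simp only [expect_map, expect_uniformOfFintype_prod]
  rw [← expect_const (uniformOfFintype β)
    ((uniformOfFintype ({ j // j ≠ x } → β)).expect fun g =>
      F ((Equiv.funSplitAt x β).symm (y, g)))]
  refine congrArg _ (funext fun y' => congrArg _ (funext fun g => congrArg _ (funext fun i => ?_)))
  by_cases h : i = x
  · subst h
    simp
  · simp [h]

/-- One-sided closeness of distributions: no test increases by more than `δ`. -/
def Close (p q : PMF α) (δ : ℝ≥0∞) : Prop :=
  ∀ f : α → ℝ≥0∞, (∀ a, f a ≤ 1) → p.expect f ≤ q.expect f + δ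

theorem Close.refl (p : PMF α) (δ : ℝ≥0∞) : p.Close p δ := fun _ _ => le_self_add

theorem Close.map {p q : PMF α} {δ : ℝ≥0∞} (h : p.Close q δ) (g : α → β) :
    (p.map g).Close (q.map g) δ := fun f hf => by
  rw [expect_map, expect_map]
  exact h _ fun a => hf _

theorem Close.one (p q : PMF α) {δ : ℝ≥0∞} (h : 1 ≤ δ) : p.Close q δ := fun _ hf =>
  (p.expect_le_const hf).trans (h.trans le_add_self)

/-- The errors of the second stage are averaged over `q`, not over `p`. Consequently the query costs
in `Circuit.close_run` are measured under the replacement oracles, which are the ones that the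
reductions can simulate. -/
theorem Close.bind {p q : PMF α} {g h : α → PMF β} {δ : ℝ≥0∞} {η : α → ℝ≥0∞}
    (hpq : p.Close q δ) (hgh : ∀ a, (g a).Close (h a) (η a)) :
    (p.bind g).Close (q.bind h) (δ + q.expect η) := fun f hf => by
  rw [expect_bind, expect_bind]
  calc (p.expect fun a => (g a).expect f) ≤ (q.expect fun a => (g a).expect f) + δ :=
        hpq _ fun a => expect_le_const _ hf
    _ ≤ (q.expect fun a => (h a).expect f + η a) + δ := by
        gcongr
        exact expect_mono _ fun a => hgh a f hf
    _ = _ := by rw [expect_add]; ring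

/-- If two continuations agree except on an event, the results are close. -/
theorem close_bind_of_eq_except (p : PMF α) (g h : α → PMF β) (η : α → ℝ≥0∞)
    (hgh : ∀ a, g a = h a ∨ 1 ≤ η a) : (p.bind g).Close (p.bind h) (p.expect η) := by
  have := Close.bind (δ := 0) (Close.refl p 0) (g := g) (h := h) (η := η) fun a => by
    rcases hgh a with h | h
    · rw [h]; exact Close.refl _ _
    · exact Close.one _ _ h
  rwa [zero_add] at this

end PMF

/-- Oracles for an interface. -/
abbrev OracleInterface.Oracles (I : OracleInterface) : Type :=
  (q : I.Op) → Bits (I.inLen q) → PMF (Bits (I.outLen q))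

/-! ### Composition of circuits, and the effect of replacing oracles -/

namespace Circuit

variable {I : OracleInterface} {o : ℕ}

/-- Extend a wiring by `k` new wires. -/
def liftWires {n m : ℕ} (w : Fin n → Fin m) (k : ℕ) : Fin (n + k) → Fin (m + k) :=
  Fin.append (Fin.castAdd k ∘ w) (Fin.natAdd m)

theorem append_comp_liftWires {α : Type*} {n m k : ℕ} (w : Fin n → Fin m) (e : Fin m → α)
    (y : Fin k → α) : Fin.append e y ∘ liftWires w k = Fin.append (e ∘ w) y := by
  funext i
  refine Fin.addCases (fun i => ?_) (fun i => ?_) i <;> simp [liftWires]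

/-- Rename the wires of the context. -/
def rename : {n m : ℕ} → (Fin n → Fin m) → Circuit I o n → Circuit I o m
  | _, _, w, .out v => .out (w ∘ v)
  | _, _, w, .const b rest => .const b (rest.rename (liftWires w 1))
  | _, _, w, .nand i j rest => .nand (w i) (w j) (rest.rename (liftWires w 1))
  | _, _, w, .sample m rest => .sample m (rest.rename (liftWires w _))
  | _, _, w, .query q v rest => .query q (w ∘ v) (rest.rename (liftWires w _))

@[simp]
theorem size_rename {n m : ℕ} (w : Fin n → Fin m) (C : Circuit I o n) :
    (C.rename w).size = C.size := by
  induction C generalizing m with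
  | out v => rfl
  | const b rest ih => simp [rename, size, ih]
  | nand i j rest ih => simp [rename, size, ih]
  | sample m rest ih => simp [rename, size, ih]
  | query q v rest ih => simp [rename, size, ih]

@[simp]
theorem run_rename (O : I.Oracles) {n m : ℕ} (w : Fin n → Fin m) (C : Circuit I o n) (e : Bits m) :
    (C.rename w).run O e = C.run O (e ∘ w) := by
  induction C generalizing m with
  | out v => rfl
  | const b rest ih => simp only [rename, run, ih, append_comp_liftWires]
  | nand i j rest ih => simp only [rename, run, ih, append_comp_liftWires, Function.comp_apply]
  | sample m rest ih => simp only [rename, run, ih, append_comp_liftWires]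
  | query q v rest ih => simp only [rename, run, ih, append_comp_liftWires, Function.comp_apply]

/-- Run `C` and then `D`, which reads some wires of the context and the output of `C`. -/
def andThen {o' n₀ : ℕ} :
    {n : ℕ} → Circuit I o n → (Fin n₀ → Fin n) → Circuit I o' (n₀ + o) → Circuit I o' n
  | _, .out v, w, D => D.rename (Fin.append w v)
  | _, .const b rest, w, D => .const b (rest.andThen (Fin.castAdd 1 ∘ w) D)
  | _, .nand i j rest, w, D => .nand i j (rest.andThen (Fin.castAdd 1 ∘ w) D)
  | _, .sample m rest, w, D => .sample m (rest.andThen (Fin.castAdd _ ∘ w) D)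
  | _, .query q v rest, w, D => .query q v (rest.andThen (Fin.castAdd _ ∘ w) D)

/-- The output gate of `C` disappears, as `D` is attached to the wires that it named. `Computes`
therefore counts the output gate separately, which makes its sizes additive. -/
theorem size_andThen {o' n₀ n : ℕ} (C : Circuit I o n) (w : Fin n₀ → Fin n)
    (D : Circuit I o' (n₀ + o)) : (C.andThen w D).size + (o + 1) = C.size + D.size := by
  induction C with
  | out v => simp [andThen, size, add_comm]
  | const b rest ih => simp only [andThen, size]; have := ih (Fin.castAdd 1 ∘ w); omega
  | nand i j rest ih => simp only [andThen, size]; have := ih (Fin.castAdd 1 ∘ w); omega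
  | sample m rest ih => simp only [andThen, size]; have := ih (Fin.castAdd _ ∘ w); omega
  | query q v rest ih => simp only [andThen, size]; have := ih (Fin.castAdd _ ∘ w); omega

theorem append_comp_castAdd_comp {α : Type*} {n n₀ k : ℕ} (e : Fin n → α) (y : Fin k → α)
    (w : Fin n₀ → Fin n) : Fin.append e y ∘ (Fin.castAdd k ∘ w) = e ∘ w := by
  funext i
  simp

theorem run_andThen (O : I.Oracles) {o' n₀ n : ℕ} (C : Circuit I o n) (w : Fin n₀ → Fin n)
    (D : Circuit I o' (n₀ + o)) (e : Bits n) :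
    (C.andThen w D).run O e = (C.run O e).bind fun y => D.run O (Fin.append (e ∘ w) y) := by
  induction C with
  | out v =>
    simp only [andThen, run, run_rename, PMF.pure_bind]
    congr 1
    funext i
    refine Fin.addCases (fun i => ?_) (fun i => ?_) i <;> simp
  | const b rest ih => simp only [andThen, run, ih, append_comp_castAdd_comp]
  | nand i j rest ih => simp only [andThen, run, ih, append_comp_castAdd_comp]
  | sample m rest ih => simp only [andThen, run, ih, append_comp_castAdd_comp, PMF.bind_bind]
  | query q v rest ih => simp only [andThen, run, ih, append_comp_castAdd_comp, PMF.bind_bind]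

/-- A circuit without oracles as a circuit with oracles. -/
def liftAlg : {n : ℕ} → Alg n o → Circuit I o n
  | _, .out v => .out v
  | _, .const b rest => .const b (liftAlg rest)
  | _, .nand i j rest => .nand i j (liftAlg rest)
  | _, .sample m rest => .sample m (liftAlg rest)
  | _, .query q _ _ => Empty.elim q

theorem size_liftAlg {n : ℕ} (C : Alg n o) : (liftAlg C : Circuit I o n).size = C.size := by
  induction C with
  | out v => rfl
  | const b rest ih => simp [liftAlg, size, ih]
  | nand i j rest ih => simp [liftAlg, size, ih]
  | sample m rest ih => simp [liftAlg, size, ih]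
  | query q v rest ih => exact Empty.elim q

theorem run_liftAlg (O : I.Oracles) {n : ℕ} (C : Alg n o) (e : Bits n) :
    (liftAlg C : Circuit I o n).run O e = C.eval e := by
  unfold Alg.eval
  induction C with
  | out v => rfl
  | const b rest ih => simp [liftAlg, run, ih]
  | nand i j rest ih => simp [liftAlg, run, ih]
  | sample m rest ih => simp [liftAlg, run, ih]
  | query q v rest ih => exact Empty.elim q

/-- The number of oracle queries. -/
def queries : {n : ℕ} → Circuit I o n → ℕ
  | _, .out _ => 0
  | _, .const _ rest => rest.queries
  | _, .nand _ _ rest => rest.queries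
  | _, .sample _ rest => rest.queries
  | _, .query _ _ rest => rest.queries + 1

theorem queries_lt_size {n : ℕ} (C : Circuit I o n) : C.queries + o < C.size := by
  induction C <;> simp only [queries, size] <;> omega

theorem outputs_lt_size {n : ℕ} (C : Circuit I o n) : o < C.size := by
  have := C.queries_lt_size
  omega

/-- The expected total cost of the queries of a circuit. -/
noncomputable def cost (O : I.Oracles) (κ : (q : I.Op) → Bits (I.inLen q) → ℝ≥0∞) :
    {n : ℕ} → Circuit I o n → Bits n → ℝ≥0∞
  | _, .out _, _ => 0
  | _, .const b rest, e => rest.cost O κ (Fin.append e (fun _ : Fin 1 => b))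
  | _, .nand i j rest, e => rest.cost O κ (Fin.append e (fun _ : Fin 1 => !(e i && e j)))
  | _, .sample m rest, e =>
      (PMF.uniformOfFintype (Fin (m + 1))).expect fun a =>
        rest.cost O κ (Fin.append e (natBits (Nat.size m) a))
  | _, .query q w rest, e =>
      κ q (fun i => e (w i)) +
        (O q (fun i => e (w i))).expect fun y => rest.cost O κ (Fin.append e y)

/-- Replacing the oracles changes the output by at most the expected cost of the queries. -/
theorem close_run {O O' : I.Oracles} {κ : (q : I.Op) → Bits (I.inLen q) → ℝ≥0∞}
    (h : ∀ q x, (O q x).Close (O' q x) (κ q x)) {n : ℕ} (C : Circuit I o n) (e : Bits n) :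
    (C.run O e).Close (C.run O' e) (C.cost O' κ e) := by
  induction C with
  | out v => exact PMF.Close.refl _ _
  | const b rest ih => exact ih _
  | nand i j rest ih => exact ih _
  | sample m rest ih =>
    have := PMF.Close.bind (PMF.Close.refl (PMF.uniformOfFintype (Fin (m + 1))) 0)
      (fun a => ih (Fin.append e (natBits (Nat.size m) a)))
    rwa [zero_add] at this
  | query q v rest ih => exact PMF.Close.bind (h _ _) fun y => ih _

theorem cost_const_le (O : I.Oracles) {κ : (q : I.Op) → Bits (I.inLen q) → ℝ≥0∞} {δ : ℝ≥0∞}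
    (h : ∀ q x, κ q x ≤ δ) {n : ℕ} (C : Circuit I o n) (e : Bits n) :
    C.cost O κ e ≤ C.queries * δ := by
  induction C with
  | out v => exact zero_le
  | const b rest ih => exact ih _
  | nand i j rest ih => exact ih _
  | sample m rest ih => exact PMF.expect_le_const _ fun a => ih _
  | query q v rest ih =>
    simp only [cost, queries, Nat.cast_add, Nat.cast_one, add_mul, one_mul]
    rw [add_comm]
    exact add_le_add (PMF.expect_le_const _ fun a => ih _) (h _ _)

end Circuit

/-! ### Circuits truncated at a query to the key derivation function -/

namespace ECIESInstance

variable {P : ECIESInstance}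

/-- For every query to the key derivation function, the circuit that stops at this query and puts
out its argument. -/
def kdfQueries {o : ℕ} :
    {n : ℕ} → Circuit P.cpaInterface o n → List (Circuit P.cpaInterface P.pointLen n)
  | _, .out _ => []
  | _, .const b rest => (kdfQueries rest).map (.const b)
  | _, .nand i j rest => (kdfQueries rest).map (.nand i j)
  | _, .sample m rest => (kdfQueries rest).map (.sample m)
  | _, .query CPAOp.enc w rest => (kdfQueries rest).map (.query CPAOp.enc w)
  | _, .query CPAOp.hash w rest => (kdfQueries rest).map (.query CPAOp.hash w)
  | _, .query CPAOp.kdf w rest => .out w :: (kdfQueries rest).map (.query CPAOp.kdf w)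

theorem length_kdfQueries_le {o n : ℕ} (C : Circuit P.cpaInterface o n) :
    (kdfQueries C).length ≤ C.queries := by
  induction C with
  | out v => exact le_rfl
  | const b rest ih => simpa [kdfQueries, Circuit.queries] using ih
  | nand i j rest ih => simpa [kdfQueries, Circuit.queries] using ih
  | sample m rest ih => simpa [kdfQueries, Circuit.queries] using ih
  | query q v rest ih => cases q <;> simp [kdfQueries, Circuit.queries] <;> omega

theorem queries_of_mem_kdfQueries {o n : ℕ} (C : Circuit P.cpaInterface o n) :
    ∀ C' ∈ kdfQueries C, C'.queries ≤ C.queries := by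
  induction C with
  | out v => simp [kdfQueries]
  | const b rest ih => simpa [kdfQueries, Circuit.queries] using ih
  | nand i j rest ih => simpa [kdfQueries, Circuit.queries] using ih
  | sample m rest ih => simpa [kdfQueries, Circuit.queries] using ih
  | query q v rest ih => cases q <;> simpa [kdfQueries, Circuit.queries] using ih

theorem size_of_mem_kdfQueries {o n : ℕ} (C : Circuit P.cpaInterface o n) :
    ∀ C' ∈ kdfQueries C, C'.size ≤ C.size + P.pointLen := by
  induction C with
  | out v => simp [kdfQueries]
  | const b rest ih =>
    simp only [kdfQueries, List.mem_map, forall_exists_index, and_imp, forall_apply_eq_imp_iff₂,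
      Circuit.size]
    intro C' hC'; have := ih C' hC'; omega
  | nand i j rest ih =>
    simp only [kdfQueries, List.mem_map, forall_exists_index, and_imp, forall_apply_eq_imp_iff₂,
      Circuit.size]
    intro C' hC'; have := ih C' hC'; omega
  | sample m rest ih =>
    simp only [kdfQueries, List.mem_map, forall_exists_index, and_imp, forall_apply_eq_imp_iff₂,
      Circuit.size]
    intro C' hC'; have := ih C' hC'; omega
  | query q v rest ih =>
    have key : ∀ C' ∈ (kdfQueries rest).map (Circuit.query (I := P.cpaInterface) q v),
        C'.size ≤ (Circuit.query q v rest).size + P.pointLen := by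
      simp only [List.mem_map, forall_exists_index, and_imp, forall_apply_eq_imp_iff₂,
        Circuit.size]
      intro C' hC'; have := ih C' hC'; omega
    cases q with
    | enc => exact key
    | hash => exact key
    | kdf =>
      simp only [kdfQueries, List.mem_cons, forall_eq_or_imp]
      exact ⟨by simp only [Circuit.size]; omega, key⟩

/-- Linearity of expectation over the query positions: a position carries `z` with exactly the
probability that the circuit stopped there puts out `z`. This replaces guessing the index of the
critical query. -/
theorem cost_le_kdfQueries (O : P.cpaInterface.Oracles)
    {κ : (q : P.cpaInterface.Op) → Bits (P.cpaInterface.inLen q) → ℝ≥0∞} {δ : ℝ≥0∞}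
    {z : Bits P.pointLen} (henc : ∀ x, κ CPAOp.enc x ≤ δ) (hhash : ∀ x, κ CPAOp.hash x = 0)
    (hkdf : ∀ x, κ CPAOp.kdf x ≤ if x = z then 1 else 0) {o n : ℕ} (C : Circuit P.cpaInterface o n)
    (e : Bits n) :
    C.cost O κ e ≤ C.queries * δ + ((kdfQueries C).map fun C' => C'.run O e z).sum := by
  classical
  induction C with
  | out v => exact zero_le
  | const b rest ih =>
    simp only [kdfQueries, List.map_map]
    exact ih _
  | nand i j rest ih =>
    simp only [kdfQueries, List.map_map]
    exact ih _
  | sample m rest ih =>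
    refine (PMF.expect_mono _ fun a => ih _).trans (le_of_eq ?_)
    rw [PMF.expect_add, PMF.expect_const, PMF.expect_list_sum]
    simp only [kdfQueries, List.map_map]
    rfl
  | query q v rest ih =>
    have key : ((O q fun i => e (v i)).expect fun y => rest.cost O κ (Fin.append e y)) ≤
        rest.queries * δ +
          (((kdfQueries rest).map (Circuit.query (I := P.cpaInterface) q v)).map
            fun C' => C'.run O e z).sum := by
      refine (PMF.expect_mono _ fun a => ih _).trans (le_of_eq ?_)
      rw [PMF.expect_add, PMF.expect_const, PMF.expect_list_sum]
      simp only [List.map_map]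
      rfl
    cases q with
    | enc =>
      simp only [Circuit.cost, Circuit.queries, kdfQueries, Nat.cast_add, Nat.cast_one, add_mul,
        one_mul]
      refine (add_le_add (henc _) key).trans (le_of_eq ?_)
      ring
    | hash =>
      simp only [Circuit.cost, Circuit.queries, kdfQueries, Nat.cast_add, Nat.cast_one, add_mul,
        one_mul, hhash, zero_add]
      refine key.trans ?_
      gcongr
      exact le_self_add
    | kdf =>
      simp only [Circuit.cost, Circuit.queries, kdfQueries, Nat.cast_add, Nat.cast_one, add_mul,
        one_mul, List.map_cons, List.sum_cons]
      have h1 := hkdf fun i => e (v i)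
      have h2 : (Circuit.run O (Circuit.out (I := P.cpaInterface) v) e) z =
          if (fun i => e (v i)) = z then 1 else 0 := by
        simp only [Circuit.run, PMF.pure_apply, eq_comm]
        congr
      rw [h2]
      refine (add_le_add h1 key).trans ?_
      rw [← add_assoc, add_comm (ite _ _ _), add_assoc]
      gcongr
      exact le_self_add

end ECIESInstance

/-! ### Data types with an encoding as bit strings -/

/-- A type with an encoding by bit strings of a fixed length. -/
class Coded (α : Type) where
  len : ℕ
  code : α → Bits len

namespace Coded

instance instBits (n : ℕ) : Coded (Bits n) := ⟨n, id⟩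

instance instBool : Coded Bool := ⟨1, fun b _ => b⟩

instance instUnit : Coded Unit := ⟨0, fun _ => Fin.elim0⟩

instance instProd (α β : Type) [Coded α] [Coded β] : Coded (α × β) :=
  ⟨len α + len β, fun p => Fin.append (code p.1) (code p.2)⟩

instance instOption (α : Type) [Coded α] : Coded (Option α) :=
  ⟨1 + len α, fun x => x.elim (fun _ => false) fun a => Fin.append (fun _ : Fin 1 => true) (code a)⟩

instance instPoint (P : ECIESInstance) : Coded P.G := ⟨P.pointLen, P.encode⟩

instance instScalar (P : ECIESInstance) : Coded (ZMod P.N) := ⟨Nat.size P.N, P.scalarBits⟩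

end Coded

/-- Tuples, encoded row by row. -/
def Vect (k : ℕ) (α : Type) : Type := Fin k → α

instance Coded.instVect (k : ℕ) (α : Type) [Coded α] : Coded (Vect k α) :=
  ⟨k * len α, fun f j => code (f j.divNat) j.modNat⟩

/-- Association lists, of which the first `T` entries are encoded. -/
def AssocTable (_T : ℕ) (X Y : Type) : Type := List (X × Y)

namespace AssocTable

variable {T : ℕ} {X Y : Type}

/-- The first `T` entries. -/
def entries (L : AssocTable T X Y) : Vect T (Option (X × Y)) :=
  fun i => (show List _ from L)[i.val]?

instance instCoded [Coded X] [Coded Y] : Coded (AssocTable T X Y) :=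
  ⟨Coded.len (Vect T (Option (X × Y))), fun L => Coded.code L.entries⟩

/-- Add an entry in front. -/
def push (L : AssocTable T X Y) (p : X × Y) : AssocTable T X Y := List.cons p L

/-- The number of entries. -/
def length (L : AssocTable T X Y) : ℕ := List.length L

theorem length_push (L : AssocTable T X Y) (p : X × Y) : (L.push p).length = L.length + 1 := rfl

end AssocTable

open Coded

/-! ### Rewiring -/

/-- Functions all of whose output bits are input bits or constants. -/
@[fun_prop]
def Wiring {α β : Type} [Coded α] [Coded β] (f : α → β) : Prop :=
  ∀ i : Fin (len β), ∃ w : Fin (len α) ⊕ Bool, ∀ a, code (f a) i = Sum.elim (code a) id w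

namespace Wiring

variable {α β γ : Type} [Coded α] [Coded β] [Coded γ]

@[fun_prop]
theorem id : Wiring (fun a : α => a) := fun i => ⟨.inl i, fun _ => rfl⟩

@[fun_prop]
theorem const (b : β) : Wiring (fun _ : α => b) := fun i => ⟨.inr (code b i), fun _ => rfl⟩

theorem bit {f : α → β} (hf : Wiring f) (w : Fin (len β) ⊕ Bool) :
    ∃ v : Fin (len α) ⊕ Bool,
      ∀ a, Sum.elim (code (f a)) _root_.id w = Sum.elim (code a) _root_.id v := by
  rcases w with i | b
  · exact hf i
  · exact ⟨.inr b, fun _ => rfl⟩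

@[fun_prop]
theorem comp {g : β → γ} {f : α → β} (hg : Wiring g) (hf : Wiring f) :
    Wiring (fun a => g (f a)) := fun i => by
  obtain ⟨w, hw⟩ := hg i
  obtain ⟨v, hv⟩ := hf.bit w
  exact ⟨v, fun a => (hw _).trans (hv a)⟩

@[fun_prop]
theorem append {m n : ℕ} {f : α → Bits m} {g : α → Bits n} (hf : Wiring f) (hg : Wiring g) :
    Wiring (fun a => (Fin.append (f a) (g a) : Bits (m + n))) := fun i => by
  refine Fin.addCases (m := m) (n := n) (fun i => ?_) (fun i => ?_) i
  · obtain ⟨w, hw⟩ := hf i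
    exact ⟨w, fun a => by rw [← hw]; exact Fin.append_left _ _ _⟩
  · obtain ⟨w, hw⟩ := hg i
    exact ⟨w, fun a => by rw [← hw]; exact Fin.append_right _ _ _⟩

@[fun_prop]
theorem code {f : α → β} (hf : Wiring f) : Wiring (fun a => code (f a)) := hf

@[fun_prop]
theorem prodMk {f : α → β} {g : α → γ} (hf : Wiring f) (hg : Wiring g) :
    Wiring (fun a => (f a, g a)) := append hf.code hg.code

@[fun_prop]
theorem fst : Wiring (fun p : α × β => p.1) := fun i =>
  ⟨.inl (Fin.castAdd _ i), fun p => (Fin.append_left (Coded.code p.1) (Coded.code p.2) i).symm⟩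

@[fun_prop]
theorem snd : Wiring (fun p : α × β => p.2) := fun i =>
  ⟨.inl (Fin.natAdd _ i), fun p => (Fin.append_right (Coded.code p.1) (Coded.code p.2) i).symm⟩

theorem select {m n : ℕ} {f : α → Bits n} (hf : Wiring f) (w : Fin m → Fin n) :
    Wiring (fun a => (fun i => f a (w i) : Bits m)) := fun i => hf (w i)

theorem getBit {n : ℕ} {f : α → Bits n} (hf : Wiring f) (i : Fin n) :
    Wiring (fun a => f a i) := fun _ => hf i

theorem replicate {n : ℕ} {f : α → Bool} (hf : Wiring f) :
    Wiring (fun a => (fun _ => f a : Bits n)) := fun _ => hf 0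

theorem vect {k : ℕ} {f : α → Vect k β} (hf : ∀ i, Wiring fun a => f a i) : Wiring f :=
  fun j => hf (Fin.divNat (show Fin (k * len β) from j)) (Fin.modNat (show Fin (k * len β) from j))

theorem mkPair_lt {k n : ℕ} (i : Fin k) (j : Fin n) : i.val * n + j.val < k * n := by
  have := Nat.mul_le_mul_right n i.2
  have := j.2
  rw [Nat.succ_mul] at *
  omega

theorem apply {k : ℕ} {f : α → Vect k β} (hf : Wiring f) (i : Fin k) :
    Wiring (fun a => f a i) := fun j => by
  obtain ⟨w, hw⟩ := hf ⟨i.val * len β + j.val, mkPair_lt i j⟩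
  refine ⟨w, fun a => (?_ : _ = _).trans (hw a)⟩
  have h0 : 0 < len β := j.pos
  have h1 : Fin.divNat (m := k) (n := len β) ⟨i.val * len β + j.val, mkPair_lt i j⟩ = i := by
    apply Fin.ext
    simp only [Fin.coe_divNat]
    rw [mul_comm, Nat.mul_add_div h0, Nat.div_eq_of_lt j.2, add_zero]
  have h2 : Fin.modNat (m := k) (n := len β) ⟨i.val * len β + j.val, mkPair_lt i j⟩ = j := by
    apply Fin.ext
    simp only [Fin.coe_modNat]
    rw [mul_comm, Nat.mul_add_mod, Nat.mod_eq_of_lt j.2]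
  change Coded.code (f a i) j =
    Coded.code (f a (Fin.divNat (m := k) (n := len β) ⟨_, mkPair_lt i j⟩))
    (Fin.modNat (m := k) (n := len β) ⟨_, mkPair_lt i j⟩)
  rw [h1, h2]

theorem some {f : α → β} (hf : Wiring f) : Wiring (fun a => Option.some (f a)) :=
  append (m := 1) (replicate (const true)) hf.code

theorem isSome {f : α → Option β} (hf : Wiring f) : Wiring (fun a => (f a).isSome) := fun _ => by
  obtain ⟨w, hw⟩ := hf (Fin.castAdd _ (0 : Fin 1))
  refine ⟨w, fun a => (?_ : _ = _).trans (hw a)⟩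
  change (f a).isSome = Coded.code (f a) (Fin.castAdd _ (0 : Fin 1))
  rcases f a with _ | b
  · rfl
  · exact (Fin.append_left (fun _ : Fin 1 => true) (Coded.code b) 0).symm

/-- The bits that encode the content of an `Option`. -/
def _root_.Coded.payload (x : Option β) : Bits (len β) := x.elim (fun _ => false) Coded.code

theorem payload {f : α → Option β} (hf : Wiring f) : Wiring (fun a => Coded.payload (f a)) :=
  fun i => by
  obtain ⟨w, hw⟩ := hf (Fin.natAdd 1 i)
  refine ⟨w, fun a => (?_ : _ = _).trans (hw a)⟩
  change Coded.payload (f a) i = Coded.code (f a) (Fin.natAdd 1 i)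
  rcases f a with _ | b
  · rfl
  · exact (Fin.append_right (fun _ : Fin 1 => true) (Coded.code b) i).symm

theorem entry {T : ℕ} {X Y : Type} [Coded X] [Coded Y] {f : α → AssocTable T X Y} (hf : Wiring f)
    (i : Fin T) : Wiring (fun a => (f a).entries i) :=
  apply (f := fun a => (f a).entries) hf i

-- Only the first `T` entries are encoded, so pushing shifts the code by one row and an overflowing
-- row is lost. Capacity matters for the meaning of lookups, not for the wiring.
@[fun_prop]
theorem push {T : ℕ} {X Y : Type} [Coded X] [Coded Y] {f : α → AssocTable T X Y} {g : α → X × Y}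
    (hf : Wiring f) (hg : Wiring g) : Wiring (fun a => (f a).push (g a)) := by
  suffices h : Wiring (fun a => ((f a).push (g a)).entries) from h
  refine vect fun ⟨i, hi⟩ => ?_
  rcases i with _ | i
  · exact some hg
  · exact hf.entry ⟨i, by omega⟩

end Wiring

/-! ### Functions computed by randomized circuits -/

section Computes

variable {I : OracleInterface} {Ω : Type} {α β γ : Type} [Coded α] [Coded β] [Coded γ]

/-- The randomized function `F`, which may depend on the oracles, is computed by a mixture of
circuits whose gates have total size at most `s`. -/
def Computes (orc : Ω → I.Oracles) (s : ℕ) (F : Ω → α → PMF β) : Prop :=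
  ∃ (ι : Type) (p : PMF ι) (C : ι → Circuit I (len β) (len α)),
    (∀ i, (C i).size ≤ s + (len β + 1)) ∧
      ∀ ω a, (p.bind fun i => (C i).run (orc ω) (code a)) = (F ω a).map code

/-- A deterministic function is computed by a mixture of circuits. -/
abbrev ComputesFun (orc : Ω → I.Oracles) (s : ℕ) (f : α → β) : Prop :=
  Computes orc s fun _ a => PMF.pure (f a)

/-- A circuit for a rewiring, followed by `D`. -/
def Circuit.rewire {o n m : ℕ} (w : Fin m → Fin n ⊕ Bool) (D : Circuit I o m) : Circuit I o n :=
  .const false (.const true (D.rename fun i =>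
    Sum.elim (fun j => Fin.castAdd 1 (Fin.castAdd 1 j))
      (fun b => if b then Fin.natAdd _ (0 : Fin 1) else Fin.castAdd 1 (Fin.natAdd _ (0 : Fin 1)))
      (w i)))

theorem Circuit.size_rewire {o n m : ℕ} (w : Fin m → Fin n ⊕ Bool) (D : Circuit I o m) :
    (D.rewire w).size = D.size + 2 := by
  simp [rewire, size]

theorem Circuit.run_rewire (O : I.Oracles) {o n m : ℕ} (w : Fin m → Fin n ⊕ Bool)
    (D : Circuit I o m) (e : Bits n) :
    (D.rewire w).run O e = D.run O (fun i => Sum.elim e id (w i)) := by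
  simp only [rewire, run, run_rename]
  congr 1
  funext i
  simp only [Function.comp_apply]
  rcases w i with j | b
  · simp
  · cases b <;> simp

namespace Computes

variable {orc : Ω → I.Oracles}

theorem mono {s s' : ℕ} {F : Ω → α → PMF β} (h : Computes orc s F) (hs : s ≤ s') :
    Computes orc s' F := by
  obtain ⟨ι, p, C, hC, hF⟩ := h
  exact ⟨ι, p, C, fun i => (hC i).trans (by omega), hF⟩

/-- Rewiring itself is free; the 2 pays for the two constant gates of `Circuit.rewire`. -/
theorem comp {s : ℕ} {F : Ω → β → PMF γ} (h : Computes orc s F) {f : α → β} (hf : Wiring f) :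
    Computes orc (s + 2) fun ω a => F ω (f a) := by
  obtain ⟨ι, p, C, hC, hF⟩ := h
  choose w hw using hf
  refine ⟨ι, p, fun i => (C i).rewire w, fun i => ?_, fun ω a => ?_⟩
  · rw [Circuit.size_rewire]
    have := hC i
    omega
  · simp only [Circuit.run_rewire, ← hw]
    exact hF ω (f a)

/-- Both mixture indices are drawn in advance and independently. This is legitimate because the
second mixture does not depend on the intermediate value, so its draw commutes with the run of the
first circuit. -/
theorem bind {s s' : ℕ} {F : Ω → α → PMF β} {G : Ω → α × β → PMF γ} (hF : Computes orc s F)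
    (hG : Computes orc s' G) :
    Computes orc (s + s') fun ω a => (F ω a).bind fun b => G ω (a, b) := by
  obtain ⟨ι, p, C, hC, hF⟩ := hF
  obtain ⟨κ, q, D, hD, hG⟩ := hG
  refine ⟨ι × κ, p.bind fun i => q.map (Prod.mk i), fun ij => (C ij.1).andThen id (D ij.2),
    fun ij => ?_, fun ω a => ?_⟩
  · change ((C ij.1).andThen id (D ij.2)).size ≤ _
    have := (C ij.1).size_andThen id (D ij.2)
    have := hC ij.1
    have := hD ij.2
    omega
  · simp only [PMF.bind_bind, PMF.bind_map, Function.comp_def, Circuit.run_andThen,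
      PMF.map_bind]
    have h1 : ∀ b, (q.bind fun j => (D j).run (orc ω) (Fin.append (code a) (code b))) =
        (G ω (a, b)).map code := fun b => hG ω (a, b)
    simp only [← h1]
    have h2 := congrArg (fun r => r.bind fun y => q.bind fun j =>
      (D j).run (orc ω) (Fin.append (code a) y)) (hF ω a)
    simp only [PMF.bind_bind, PMF.bind_map, Function.comp_def] at h2
    rw [← h2]
    refine congrArg _ (funext fun i => ?_)
    exact PMF.bind_comm _ _ _

theorem wiring {f : α → β} (hf : Wiring f) : ComputesFun orc 2 f := by
  choose w hw using hf
  refine ⟨Unit, PMF.pure (), fun _ => (Circuit.out id).rewire w, fun i => ?_, fun ω a => ?_⟩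
  · rw [Circuit.size_rewire]
    simp only [Circuit.size]
    omega
  · simp only [PMF.pure_bind, Circuit.run_rewire, Circuit.run, ← hw, PMF.pure_map]
    rfl

/-- Nonuniformity at work: advice from any distribution adds nothing to the size, since the size
bound is required of each member of a mixture separately. -/
theorem mix {ι : Type} (p : PMF ι) {s : ℕ} {F : ι → Ω → α → PMF β}
    (h : ∀ i, Computes orc s (F i)) : Computes orc s fun ω a => p.bind fun i => F i ω a := by
  choose κ q C hC hF using h
  refine ⟨Σ i, κ i, p.bind fun i => (q i).map (Sigma.mk i), fun ij => C ij.1 ij.2,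
    fun ij => hC _ _, fun ω a => ?_⟩
  simp only [PMF.bind_bind, PMF.bind_map, Function.comp_def, hF, PMF.map_bind]

theorem sample (p : PMF β) : Computes orc 2 fun _ (_ : α) => p := by
  have := mix (orc := orc) p fun b => wiring (α := α) (Wiring.const b)
  simpa only [PMF.bind_pure] using this

theorem bindFun {s s' : ℕ} {f : α → β} {G : Ω → α × β → PMF γ} (hf : ComputesFun orc s f)
    (hG : Computes orc s' G) : Computes orc (s + s') fun ω a => G ω (a, f a) := by
  simpa only [PMF.pure_bind] using bind hf hG

theorem mapWiring {s : ℕ} {F : Ω → α → PMF β} (hF : Computes orc s F) {g : α × β → γ}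
    (hg : Wiring g) : Computes orc (s + 2) fun ω a => (F ω a).map fun b => g (a, b) :=
  bind hF (wiring hg)

theorem alg {m n : ℕ} (A : Alg m n) : Computes orc A.size fun _ (e : Bits m) => A.eval e :=
  ⟨Unit, PMF.pure (), fun _ => Circuit.liftAlg A, fun _ => by
    rw [Circuit.size_liftAlg]; exact Nat.le_add_right _ _, fun ω a => by
    rw [PMF.pure_bind, Circuit.run_liftAlg]
    exact (PMF.map_id _).symm⟩

theorem query (q : I.Op) (hout : len β = I.outLen q) (hin : len α = I.inLen q) (F : Ω → α → PMF β)
    (h : ∀ ω a, orc ω q (code a ∘ Fin.cast hin.symm) =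
      (F ω a).map fun b => code b ∘ Fin.cast hout.symm) :
    Computes orc (I.inLen q + I.outLen q + 1) F := by
  refine ⟨Unit, PMF.pure (), fun _ => .query q (Fin.cast hin.symm)
    (.out fun i => Fin.natAdd _ (Fin.cast hout i)), fun _ => ?_, fun ω a => ?_⟩
  · simp only [Circuit.size]
    omega
  · simp only [PMF.pure_bind, Circuit.run]
    have := h ω a
    simp only [Function.comp_def] at this
    rw [this, PMF.bind_map, ← PMF.bind_pure_comp]
    refine congrArg _ (funext fun b => congrArg _ (funext fun i => ?_))
    exact (Fin.append_right _ _ _)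

end Computes

namespace ComputesFun

variable {orc : Ω → I.Oracles}

theorem nandGate : ComputesFun orc 1 fun p : Bool × Bool => !(p.1 && p.2) :=
  ⟨Unit, PMF.pure (), fun _ => .nand (Fin.castAdd 1 (0 : Fin 1)) (Fin.natAdd 1 (0 : Fin 1))
    (.out fun _ => Fin.natAdd _ (0 : Fin 1)), fun _ => by simp [Circuit.size, len], fun ω a => by
    simp only [PMF.pure_bind, Circuit.run, PMF.pure_map]
    refine congrArg _ (funext fun i => ?_)
    refine (Fin.append_right _ _ _).trans ?_
    exact congrArg₂ (fun x y => !(x && y)) (Fin.append_left _ _ _) (Fin.append_right _ _ _)⟩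

theorem prodMk {s s' : ℕ} {f : α → β} {g : α → γ} (hf : ComputesFun orc s f)
    (hg : ComputesFun orc s' g) : ComputesFun orc (s + s' + 4) fun a => (f a, g a) := by
  have h1 := Computes.bindFun (Computes.comp hg (f := fun p : α × β => p.1) (by fun_prop))
    (Computes.wiring (f := fun p : (α × β) × γ => (p.1.2, p.2)) (by fun_prop))
  exact (Computes.bindFun hf h1).mono (by omega)

theorem comp {s s' : ℕ} {f : α → β} {g : β → γ} (hg : ComputesFun orc s' g)
    (hf : ComputesFun orc s f) : ComputesFun orc (s + s' + 2) fun a => g (f a) :=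
  (Computes.bindFun hf (Computes.comp hg (f := fun p : α × β => p.2) (by fun_prop))).mono (by omega)

theorem nand {s s' : ℕ} {f g : α → Bool} (hf : ComputesFun orc s f) (hg : ComputesFun orc s' g) :
    ComputesFun orc (s + s' + 7) fun a => !(f a && g a) :=
  (comp nandGate (prodMk hf hg)).mono (by omega)

theorem not {s : ℕ} {f : α → Bool} (hf : ComputesFun orc s f) :
    ComputesFun orc (s + 9) fun a => !(f a) := by
  simpa using nand hf (Computes.wiring (Wiring.const true))

theorem and {s s' : ℕ} {f g : α → Bool} (hf : ComputesFun orc s f) (hg : ComputesFun orc s' g) :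
    ComputesFun orc (s + s' + 16) fun a => f a && g a := by
  simpa using (nand hf hg).not

theorem selectBit :
    ComputesFun orc 40 fun p : Bool × Bool × Bool => if p.1 then p.2.1 else p.2.2 := by
  have h1 : ComputesFun orc 2 fun p : Bool × Bool × Bool => p.1 :=
    Computes.wiring (by fun_prop)
  have h2 : ComputesFun orc 2 fun p : Bool × Bool × Bool => p.2.1 :=
    Computes.wiring (by fun_prop)
  have h3 : ComputesFun orc 2 fun p : Bool × Bool × Bool => p.2.2 :=
    Computes.wiring (by fun_prop)
  -- A multiplexer is `NAND(NAND(a, b), NAND(¬a, c))`.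
  have := (nand (nand h1 h2) (nand h1.not h3)).mono (s' := 40) (by omega)
  refine (congrArg (Computes orc 40) ?_).mp this
  funext ω ⟨a, b, c⟩
  cases a <;> cases b <;> cases c <;> rfl

theorem vect {s : ℕ} {k : ℕ} {f : α → Vect k β} (hf : ∀ i, ComputesFun orc s fun a => f a i) :
    ComputesFun orc (k * (s + 4) + 2) f := by
  induction k with
  | zero => exact (Computes.wiring (Wiring.vect fun i => i.elim0)).mono (by omega)
  | succ k ih =>
    have h1 := ih (f := fun a => (fun i => f a i.castSucc : Vect k β)) fun i => hf _
    let g : (α × Vect k β) × β → Vect (k + 1) β := fun p => Fin.snoc (α := fun _ => β) p.1.2 p.2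
    have h2 : Wiring g := by
      refine Wiring.vect fun i => ?_
      refine Fin.lastCases ?_ (fun i => ?_) i
      · have : (fun p => g p (Fin.last k)) = fun p => p.2 :=
          funext fun p => Fin.snoc_last (α := fun _ => β) _ _
        rw [this]
        fun_prop
      · have : (fun p => g p i.castSucc) = fun p => p.1.2 i :=
          funext fun p => Fin.snoc_castSucc (α := fun _ => β) _ _ _
        rw [this]
        exact Wiring.apply (f := fun p : (α × Vect k β) × β => p.1.2) (by fun_prop) i
    have h3 := Computes.bindFun (Computes.comp (hf (Fin.last k))
      (f := fun p : α × Vect k β => p.1) (by fun_prop)) (Computes.wiring h2)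
    have h4 := (Computes.bindFun h1 h3).mono (s' := (k + 1) * (s + 4) + 2) (by
      rw [Nat.succ_mul]; omega)
    refine (congrArg (Computes orc _) ?_).mp h4
    funext ω a
    exact congrArg PMF.pure (Fin.snoc_init_self (α := fun _ => β) (f a))

theorem bits {s : ℕ} {k : ℕ} {f : α → Bits k} (hf : ∀ i, ComputesFun orc s fun a => f a i) :
    ComputesFun orc (k * (s + 4) + 6) f := by
  have h1 := vect (f := fun a => (f a : Vect k Bool)) hf
  have h2 : Wiring fun v : Vect k Bool => (fun i => v i : Bits k) := fun i =>
    (Wiring.apply Wiring.id i : Wiring fun v : Vect k Bool => v i) 0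
  exact (comp (Computes.wiring h2) h1).mono (by omega)

end ComputesFun

end Computes

/-! ### Conditionals and equality tests -/

namespace ComputesFun

variable {I : OracleInterface} {Ω : Type} {α β γ : Type} [Coded α] [Coded β] [Coded γ]
  {orc : Ω → I.Oracles}

theorem ite {s₁ s₂ s₃ : ℕ} {f g h : α → Bool} (hf : ComputesFun orc s₁ f)
    (hg : ComputesFun orc s₂ g) (hh : ComputesFun orc s₃ h) :
    ComputesFun orc (s₁ + s₂ + s₃ + 50) fun a => if f a then g a else h a :=
  (comp selectBit (prodMk hf (prodMk hg hh))).mono (by omega)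

theorem congr {s : ℕ} {f g : α → β} (hf : ComputesFun orc s f) (h : ∀ a, f a = g a) :
    ComputesFun orc s g :=
  (funext h : f = g) ▸ hf

theorem ofCode {s : ℕ} {f : α → β} (hf : ComputesFun orc s fun a => code (f a)) :
    ComputesFun orc s f := by
  obtain ⟨ι, p, C, hC, hF⟩ := hf
  refine ⟨ι, p, C, hC, fun ω a => (hF ω a).trans ?_⟩
  simp only [PMF.pure_map]
  rfl

theorem decideForall {s n : ℕ} {f : Fin n → α → Bool} (hf : ∀ i, ComputesFun orc s (f i)) :
    ComputesFun orc (n * (s + 16) + 2) fun a => decide (∀ i, f i a = true) := by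
  induction n with
  | zero => simpa using (Computes.wiring (Wiring.const true) : ComputesFun orc 2 fun _ : α => true)
  | succ n ih =>
    have := (and (hf 0) (ih fun i => hf i.succ)).mono (s' := (n + 1) * (s + 16) + 2) (by
      rw [Nat.succ_mul]; omega)
    simpa [Fin.forall_fin_succ] using this

theorem decideEq (n : ℕ) :
    ComputesFun orc (n * 90 + 2) fun p : Bits n × Bits n => decide (p.1 = p.2) := by
  have h (i : Fin n) : ComputesFun orc 65 fun p : Bits n × Bits n => p.1 i == p.2 i := by
    have h1 : ComputesFun orc 2 fun p : Bits n × Bits n => p.1 i :=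
      Computes.wiring (Wiring.getBit Wiring.fst i)
    have h2 : ComputesFun orc 2 fun p : Bits n × Bits n => p.2 i :=
      Computes.wiring (Wiring.getBit Wiring.snd i)
    refine ComputesFun.congr (ite h1 h2 h2.not) fun p => ?_
    cases p.1 i <;> cases p.2 i <;> simp
  have := (decideForall h).mono (s' := n * 90 + 2) (by omega)
  exact ComputesFun.congr this fun p => by simp [funext_iff]

end ComputesFun

/-! ### Lookup in association lists -/

namespace AssocTable

variable {T : ℕ} {X Y : Type} [DecidableEq X]

/-- The value of the entry `e` if its key is `x`, and `y` otherwise. -/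
def entryD (x : X) (e : X × Y) (y : Y) : Y := if e.1 = x then e.2 else y

/-- The value that belongs to the key `x` according to the first `T` entries, or else `y`. -/
def lookD (L : AssocTable T X Y) (x : X) (y : Y) : Y := (List.take T L).foldr (entryD x) y

/-- Below capacity no old entry leaves the window of the first `T`; the new entry stands in front
and so takes precedence. -/
theorem lookD_push (L : AssocTable T X Y) (h : L.length < T) (e : X × Y) (x : X) (y : Y) :
    (L.push e).lookD x y = entryD x e (L.lookD x y) := by
  unfold lookD push
  rw [List.take_of_length_le (show List.length L ≤ T from h.le),
    List.take_of_length_le (show List.length (List.cons e L) ≤ T from Nat.succ_le_of_lt h)]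
  rfl

end AssocTable

section

variable {I : OracleInterface} {Ω : Type} {orc : Ω → I.Oracles} {T n : ℕ} {Y : Type} [Coded Y]

open AssocTable in
-- A missing entry is coded by zeros, which may coincide with the code of a genuine key. Hence the
-- presence bit is tested together with equality of keys, before the value is selected bit by bit.
theorem computesFun_entryD (i : Fin T) :
    ComputesFun orc (90 * n + 60 * len Y + 40)
      fun p : (Bits n × Y) × AssocTable T (Bits n) Y =>
        ((p.2.entries i).elim p.1.2 fun e => entryD p.1.1 e p.1.2) := by
  let opt (p : (Bits n × Y) × AssocTable T (Bits n) Y) : Option (Bits n × Y) := p.2.entries i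
  have ho : Wiring opt :=
    Wiring.entry (f := fun p : (Bits n × Y) × AssocTable T (Bits n) Y => p.2) (by fun_prop) i
  have hp : Wiring fun p => payload (opt p) := Wiring.payload ho
  have h2 : ComputesFun orc (n * 90 + 4) fun p : (Bits n × Y) × AssocTable T (Bits n) Y =>
      decide ((fun j => payload (opt p) (Fin.castAdd (len Y) j) : Bits n) = p.1.1) :=
    Computes.comp (ComputesFun.decideEq n)
      (f := fun p : (Bits n × Y) × AssocTable T (Bits n) Y =>
        ((fun j => payload (opt p) (Fin.castAdd (len Y) j) : Bits n), p.1.1))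
      (Wiring.prodMk (Wiring.select hp _) (by fun_prop))
  have h1 := (Computes.wiring (Wiring.isSome ho) : ComputesFun orc 2 _).and h2
  have h3 := ComputesFun.bits (orc := orc) (s := 56)
    (f := fun q : ((Bits n × Y) × AssocTable T (Bits n) Y) × Bool =>
      (fun j => if q.2 then payload (opt q.1) (Fin.natAdd n j) else code q.1.1.2 j :
        Bits (len Y))) fun j => by
    refine ComputesFun.ite (s₁ := 2) (s₂ := 2) (s₃ := 2) (Computes.wiring (by fun_prop))
      (Computes.wiring ?_) (Computes.wiring ?_)
    · exact Wiring.getBit (Wiring.comp hp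
        (f := fun q : ((Bits n × Y) × AssocTable T (Bits n) Y) × Bool => q.1) (by fun_prop)) _
    · exact Wiring.getBit
        (f := fun q : ((Bits n × Y) × AssocTable T (Bits n) Y) × Bool => code q.1.1.2)
        (by fun_prop) j
  refine ComputesFun.ofCode (ComputesFun.congr (Computes.mono (Computes.bindFun h1 h3)
    (s' := 90 * n + 60 * len Y + 40) (by omega)) fun p => ?_)
  funext j
  change (if ((opt p).isSome && _) = true then _ else _) = code ((opt p).elim _ _) j
  rcases opt p with _ | ⟨k, v⟩
  · rfl
  · have hk : (fun j => payload (some (k, v)) (Fin.castAdd (len Y) j) : Bits n) = k :=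
      funext fun j => Fin.append_left (code k) (code v) j
    have hv : payload (some (k, v)) (Fin.natAdd n j) = code v j :=
      Fin.append_right (code k) (code v) j
    simp only [Option.isSome_some, Bool.true_and, decide_eq_true_eq, hk, hv, Option.elim_some,
      entryD]
    split_ifs <;> rfl

open AssocTable in
-- One pass over all `T` slots, whatever the data. The induction peels off the deepest slot: entry
-- `m` acts on the default value first, and the entries before it override the result.
theorem computesFun_lookD :
    ComputesFun orc (T * (90 * n + 60 * len Y + 50) + 2)
      fun p : (Bits n × Y) × AssocTable T (Bits n) Y => p.2.lookD p.1.1 p.1.2 := by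
  suffices h : ∀ m ≤ T, ComputesFun orc (m * (90 * n + 60 * len Y + 50) + 2)
      fun p : (Bits n × Y) × AssocTable T (Bits n) Y =>
        (List.take m p.2).foldr (entryD p.1.1) p.1.2 from h T le_rfl
  intro m hm
  induction m with
  | zero =>
    exact Computes.mono (Computes.wiring
      (f := fun p : (Bits n × Y) × AssocTable T (Bits n) Y => p.1.2) (by fun_prop)) (by omega)
  | succ m ih =>
    have h1 := computesFun_entryD (orc := orc) (n := n) (Y := Y) ⟨m, hm⟩
    have h2 := Computes.comp (ih (by omega))
      (f := fun q : ((Bits n × Y) × AssocTable T (Bits n) Y) × Y => ((q.1.1.1, q.2), q.1.2))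
      (by fun_prop)
    refine ComputesFun.congr (Computes.mono (Computes.bindFun h1 h2)
      (s' := (m + 1) * (90 * n + 60 * len Y + 50) + 2) (by
        rw [Nat.succ_mul (m := 90 * n + 60 * len Y + 50)]; omega)) fun p => ?_
    have ht (L : List (Bits n × Y)) : (List.take (m + 1) L).foldr (entryD p.1.1) p.1.2 =
        (List.take m L).foldr (entryD p.1.1) (L[m]?.elim p.1.2 fun e => entryD p.1.1 e p.1.2) := by
      rw [List.take_add_one, List.foldr_append]
      cases L[m]? <;> rfl
    exact (ht p.2).symm

end

/-! ### Group operations and the symmetric primitives -/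

namespace ECIESInstance

variable {I : OracleInterface} {Ω : Type} {orc : Ω → I.Oracles} {P : ECIESInstance}

theorem computesFun_add : ComputesFun orc P.addAlg.size fun p : P.G × P.G => p.1 + p.2 := by
  refine ⟨Unit, PMF.pure (), fun _ => Circuit.liftAlg P.addAlg, fun _ => ?_, fun ω p => ?_⟩
  · rw [Circuit.size_liftAlg]
    exact Nat.le_add_right _ _
  · rw [PMF.pure_bind, Circuit.run_liftAlg, PMF.pure_map]
    exact P.addAlg_spec p.1 p.2

/-- Double-and-add, with at most two additions per binary digit. The scalar is hard-wired and only
the point is an input, which suffices because the reductions know all their scalars. -/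
theorem computesFun_nsmul (n : ℕ) :
    ComputesFun orc (n.size * (2 * P.addAlg.size + 20) + 2) fun X : P.G => n • X := by
  induction n using Nat.binaryRec' with
  | zero =>
    simpa using (Computes.wiring (Wiring.const 0) : ComputesFun orc 2 fun _ : P.G => (0 : P.G))
  | bit b n h ih =>
    have h0 : Nat.bit b n ≠ 0 := fun h0 => by
      rw [Nat.bit_eq_zero_iff] at h0
      simp [h h0.1] at h0
    have hid : ComputesFun orc 2 fun X : P.G => X := Computes.wiring (by fun_prop)
    have hd : ComputesFun orc (P.addAlg.size + 8) fun X : P.G => X + X :=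
      Computes.mono (ComputesFun.comp computesFun_add
        (Computes.wiring (f := fun X : P.G => (X, X)) (by fun_prop))) (by omega)
    have h2 := ComputesFun.comp hd ih
    rw [Nat.size_bit h0, Nat.succ_mul]
    cases b with
    | false =>
      refine ComputesFun.congr (Computes.mono h2 (by omega)) fun X => ?_
      rw [Nat.bit_false_apply, two_mul, add_smul]
    | true =>
      refine ComputesFun.congr (Computes.mono (ComputesFun.comp computesFun_add
        (ComputesFun.prodMk h2 hid)) (by omega)) fun X => ?_
      rw [Nat.bit_true_apply, two_mul, add_smul, add_smul, one_smul]

theorem computes_symEnc : Computes orc (P.symEnc.size + 2)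
    fun _ (p : Bits P.encKeyLen × Bits P.msgLen) => P.symEnc.eval (Fin.append p.1 p.2) :=
  Computes.comp (Computes.alg P.symEnc)
    (f := fun p : Bits P.encKeyLen × Bits P.msgLen => (Fin.append p.1 p.2 : Bits _)) (by fun_prop)

theorem computes_mac : Computes orc (P.mac.size + 2)
    fun _ (p : Bits P.macKeyLen × Bits P.ctLen) => P.mac.eval (Fin.append p.1 p.2) :=
  Computes.comp (Computes.alg P.mac)
    (f := fun p : Bits P.macKeyLen × Bits P.ctLen => (Fin.append p.1 p.2 : Bits _)) (by fun_prop)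

end ECIESInstance

/-! ### Stateful simulation of oracles -/

/-- Randomized programs with a state. -/
abbrev St (σ α : Type) : Type := σ → PMF (α × σ)

/-- The output distribution of a circuit whose oracles share a state. -/
noncomputable def Circuit.runSt {I : OracleInterface} {o : ℕ} {σ : Type}
    (O : (q : I.Op) → Bits (I.inLen q) → St σ (Bits (I.outLen q))) :
    {n : ℕ} → Circuit I o n → Bits n → St σ (Bits o)
  | _, .out w, e, s => PMF.pure ((fun i => e (w i)), s)
  | _, .const b rest, e, s => rest.runSt O (Fin.append e (fun _ : Fin 1 => b)) s
  | _, .nand i j rest, e, s => rest.runSt O (Fin.append e (fun _ : Fin 1 => !(e i && e j))) s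
  | _, .sample m rest, e, s =>
      (PMF.uniformOfFintype (Fin (m + 1))).bind fun a =>
        rest.runSt O (Fin.append e (natBits (Nat.size m) a)) s
  | _, .query q w rest, e, s =>
      (O q (fun i => e (w i)) s).bind fun p => rest.runSt O (Fin.append e p.1) p.2

theorem PMF.bind_congr_support {α β : Type} {p : PMF α} {f g : α → PMF β}
    (h : ∀ a ∈ p.support, f a = g a) : p.bind f = p.bind g := by
  ext b
  simp only [PMF.bind_apply]
  refine tsum_congr fun a => ?_
  by_cases ha : p a = 0
  · simp [ha]
  · rw [h a ((PMF.mem_support_iff _ _).2 ha)]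

/-- A program `f` that depends on a hidden value, drawn from a distribution determined by a state,
is simulated by the stateful program `F`. The state grows by at most `n`, and the simulation is
required while it stays below `T`. -/
def Simulates {σ H α : Type} (D : σ → PMF H) (size : σ → ℕ) (T n : ℕ) (f : H → PMF α)
    (F : St σ α) : Prop :=
  ∀ s, size s + n ≤ T →
    (((D s).bind fun h => (f h).map fun a => (a, h)) =
      (F s).bind fun p => (D p.2).map fun h => (p.1, h)) ∧
    ∀ p ∈ (F s).support, size p.2 ≤ size s + n

namespace Simulates

variable {σ H α β : Type} {D : σ → PMF H} {size : σ → ℕ} {T n m : ℕ}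

theorem mono {f : H → PMF α} {F : St σ α} (h : Simulates D size T n f F) (hm : n ≤ m) :
    Simulates D size T m f F := fun s hs =>
  ⟨(h s (by omega)).1, fun p hp => ((h s (by omega)).2 p hp).trans (by omega)⟩

/-- Equality of joint laws says that, given the answer and the new state, the hidden value is again
distributed as `D` prescribes, so the next program can be applied to it. The growth bound on the
support guarantees that the new state leaves room for that program. -/
theorem bind {f : H → PMF α} {F : St σ α} {g : α → H → PMF β} {G : α → St σ β}
    (hf : Simulates D size T n f F) (hg : ∀ a, Simulates D size T m (g a) (G a)) :
    Simulates D size T (n + m) (fun h => (f h).bind fun a => g a h)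
      (fun s => (F s).bind fun p => G p.1 p.2) := fun s hs => by
  obtain ⟨h1, h2⟩ := hf s (by omega)
  constructor
  · have h3 := congrArg (fun r => r.bind fun p => (g p.1 p.2).map fun b => (b, p.2)) h1
    simp only [PMF.bind_bind, PMF.bind_map, Function.comp_def] at h3
    simp only [PMF.map_bind, PMF.bind_bind, h3]
    exact PMF.bind_congr_support fun p hp =>
      (hg p.1 p.2 (by have := h2 p hp; omega)).1
  · intro p hp
    obtain ⟨q, hq, hp⟩ := (PMF.mem_support_bind_iff _ _ _).1 hp
    have := h2 q hq
    have := (hg q.1 q.2 (by omega)).2 p hp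
    omega

theorem const (p : PMF α) : Simulates D size T 0 (fun _ => p) (fun s => p.map fun a => (a, s)) :=
  fun s _ => by
  constructor
  · simp only [← PMF.bind_pure_comp, PMF.bind_bind, Function.comp_def, PMF.pure_bind]
    exact PMF.bind_comm _ _ _
  · intro q hq
    obtain ⟨a, -, rfl⟩ := (PMF.mem_support_map_iff _ _ _).1 hq
    exact le_rfl

theorem map {f : H → PMF α} {F : St σ α} (hf : Simulates D size T n f F) (g : α → β) :
    Simulates D size T n (fun h => (f h).map g) (fun s => (F s).map fun p => (g p.1, p.2)) := by
  have := hf.bind fun a => const (PMF.pure (g a))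
  simpa only [PMF.pure_map, add_zero, Function.comp_def, PMF.map, PMF.pure_bind] using this

theorem run {I : OracleInterface} {o : ℕ} {O : H → I.Oracles}
    {S : (q : I.Op) → Bits (I.inLen q) → St σ (Bits (I.outLen q))}
    (h : ∀ q x, Simulates D size T 1 (fun ω => O ω q x) (S q x)) {n : ℕ} (C : Circuit I o n)
    (e : Bits n) : Simulates D size T C.queries (fun ω => C.run (O ω) e) (C.runSt S e) := by
  induction C with
  | out w =>
    have := const (D := D) (size := size) (T := T) (PMF.pure fun i => e (w i))
    simp only [PMF.pure_map] at this
    exact this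
  | const b rest ih => exact ih _
  | nand i j rest ih => exact ih _
  | sample m rest ih =>
    have := (const (D := D) (size := size) (T := T) (PMF.uniformOfFintype (Fin (m + 1)))).bind
      fun a => ih (Fin.append e (natBits (Nat.size m) a))
    simp only [zero_add, PMF.bind_map, Function.comp_def] at this
    exact this
  | query q w rest ih =>
    have := (h q fun i => e (w i)).bind fun y => ih (Fin.append e y)
    rwa [add_comm] at this

theorem expect_eq {f : H → PMF α} {F : St σ α} (hf : Simulates D size T n f F) (s : σ)
    (hs : size s + n ≤ T) (φ : α → ℝ≥0∞) :
    ((D s).expect fun h => (f h).expect φ) = (F s).expect fun p => φ p.1 := by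
  have := congrArg (fun r => r.expect fun p => φ p.1) (hf s hs).1
  simpa using this

end Simulates

/-! ### Lazy sampling -/

namespace AssocTable

variable {T : ℕ} {X Y : Type} [DecidableEq X]

/-- The function `f`, overridden by the entries of `L`. -/
def override (L : AssocTable T X Y) (f : X → Y) : X → Y := fun x => L.lookD x (f x)

/-- Answer a query to a lazily sampled random function. -/
noncomputable def answer [Fintype Y] [Nonempty Y] (L : AssocTable T X Y) (x : X) :
    PMF (Y × AssocTable T X Y) :=
  (PMF.uniformOfFintype Y).map fun y => (L.lookD x y, L.push (x, L.lookD x y))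

/-- If `x` already has an entry, `y` is ignored on both sides; otherwise both sides assign `y` to
`x`. Fixing the hidden function at a point and recording the answer are thus the same operation. -/
theorem override_update (L : AssocTable T X Y) (h : L.length < T) (x : X) (y : Y)
    (f : X → Y) :
    L.override (Function.update f x y) = (L.push (x, L.lookD x y)).override f := by
  funext x'
  unfold override
  rw [lookD_push _ h]
  by_cases hx : x' = x
  · subst hx
    simp [entryD]
  · simp [entryD, Function.update_of_ne hx, Ne.symm hx]

/-- Resample the hidden function at `x`. The answer then depends on the new value and the table
alone, and by `override_update` a fresh uniform function remains behind the enlarged table. -/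
theorem expect_override [Fintype X] [Fintype Y] [Nonempty Y] (L : AssocTable T X Y)
    (h : L.length < T) (x : X)
    (Φ : (X → Y) → Y → ℝ≥0∞) :
    ((PMF.uniformOfFintype (X → Y)).expect fun f => Φ (L.override f) (L.override f x)) =
      (L.answer x).expect fun p =>
        (PMF.uniformOfFintype (X → Y)).expect fun f => Φ (p.2.override f) p.1 := by
  rw [PMF.expect_uniform_update x]
  unfold answer
  rw [PMF.expect_map]
  refine congrArg _ (funext fun y => congrArg _ (funext fun f => ?_))
  rw [← override_update L h]
  congr 1
  simp [override]

/-- The empty table. -/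
def empty : AssocTable T X Y := ([] : List (X × Y))

theorem lookD_empty (x : X) (y : Y) : (empty : AssocTable T X Y).lookD x y = y := by
  simp [empty, lookD]

theorem override_empty (f : X → Y) : (empty : AssocTable T X Y).override f = f := by
  funext x
  exact lookD_empty _ _

end AssocTable

namespace ECIESInstance

variable (P : ECIESInstance) (T : ℕ)

/-- The tables of two lazily sampled random oracles. -/
abbrev LazyState : Type :=
  AssocTable T (Bits (P.idLen + P.pointLen)) (ZMod P.N) ×
    AssocTable T (Bits P.pointLen) (Bits P.encKeyLen × Bits P.macKeyLen)

variable {P T}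

/-- The number of entries. -/
def LazyState.size (s : P.LazyState T) : ℕ := s.1.length + s.2.length

/-- The random oracles, given the values in the tables. -/
noncomputable def LazyState.oracles (s : P.LazyState T) : PMF (P.Hash × P.Kdf) :=
  (PMF.uniformOfFintype P.Hash).bind fun f =>
    (PMF.uniformOfFintype P.Kdf).map fun g => (s.1.override f, s.2.override g)

/-- Simulation of a hash query. -/
noncomputable def stHash (x : Bits (P.idLen + P.pointLen)) : St (P.LazyState T) (ZMod P.N) :=
  fun s => (s.1.answer x).map fun p => (p.1, (p.2, s.2))

/-- Simulation of a query to the key derivation function. -/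
noncomputable def stKdf (x : Bits P.pointLen) :
    St (P.LazyState T) (Bits P.encKeyLen × Bits P.macKeyLen) :=
  fun s => (s.2.answer x).map fun p => (p.1, (s.1, p.2))

theorem simulates_stHash (x : Bits (P.idLen + P.pointLen)) :
    Simulates (LazyState.oracles (P := P) (T := T)) LazyState.size T 1
      (fun h => PMF.pure (h.1 x)) (stHash x) := fun s hs => by
  constructor
  · refine PMF.ext_expect fun φ => ?_
    simp only [LazyState.oracles, stHash, PMF.expect_bind, PMF.expect_map, PMF.expect_pure]
    rw [AssocTable.expect_override s.1 (by unfold LazyState.size at hs; omega) x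
      (fun f y => (PMF.uniformOfFintype P.Kdf).expect fun g => φ (y, f, s.2.override g))]
  · intro p hp
    simp only [stHash, AssocTable.answer, PMF.map_comp, PMF.mem_support_map_iff] at hp
    obtain ⟨y, -, rfl⟩ := hp
    simp only [LazyState.size, Function.comp_apply, AssocTable.length_push]
    omega

theorem simulates_stKdf (x : Bits P.pointLen) :
    Simulates (LazyState.oracles (P := P) (T := T)) LazyState.size T 1
      (fun h => PMF.pure (h.2 x)) (stKdf x) := fun s hs => by
  constructor
  · refine PMF.ext_expect fun φ => ?_
    simp only [LazyState.oracles, stKdf, PMF.expect_bind, PMF.expect_map, PMF.expect_pure]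
    rw [PMF.expect_comm]
    rw [AssocTable.expect_override s.2 (by unfold LazyState.size at hs; omega) x
      (fun g y => (PMF.uniformOfFintype P.Hash).expect fun f => φ (y, s.1.override f, g))]
    refine congrArg _ (funext fun p => ?_)
    rw [PMF.expect_comm]
  · intro p hp
    simp only [stKdf, AssocTable.answer, PMF.map_comp, PMF.mem_support_map_iff] at hp
    obtain ⟨y, -, rfl⟩ := hp
    simp only [LazyState.size, Function.comp_apply, AssocTable.length_push]
    omega

/-- Ciphertexts as tuples. -/
abbrev CipherTuple (P : ECIESInstance) : Type := (Bits P.ctLen × Bits P.tagLen) × P.G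

/-- Symmetric encryption and authentication under given keys. -/
noncomputable def sealWith (keys : Bits P.encKeyLen × Bits P.macKeyLen) (m : Bits P.msgLen)
    (R : P.G) : PMF P.CipherTuple :=
  (P.symEnc.eval (Fin.append keys.1 m)).bind fun c =>
    (P.mac.eval (Fin.append keys.2 c)).map fun d => ((c, d), R)

/-- Encryption, with the pair `(R, S)` drawn by a given sampler. -/
noncomputable def encWith (samp : PMF (P.G × P.G)) (kdf : P.Kdf) (m : Bits P.msgLen) :
    PMF P.CipherTuple :=
  samp.bind fun p => sealWith (kdf (P.encode p.2)) m p.1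

/-- Simulation of `encWith`. -/
noncomputable def stEnc (samp : PMF (P.G × P.G)) (m : Bits P.msgLen) :
    St (P.LazyState T) P.CipherTuple :=
  fun s => samp.bind fun p => (stKdf (P.encode p.2) s).bind fun k =>
    (sealWith k.1 m p.1).map fun C => (C, k.2)

theorem simulates_stEnc (samp : PMF (P.G × P.G)) (m : Bits P.msgLen) :
    Simulates (LazyState.oracles (P := P) (T := T)) LazyState.size T 1
      (fun h => encWith samp h.2 m) (stEnc samp m) := by
  have := (Simulates.const (D := LazyState.oracles (P := P) (T := T)) (size := LazyState.size)
    (T := T) samp).bind fun p => (simulates_stKdf (P.encode p.2)).bind fun k =>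
      Simulates.const (sealWith k m p.1)
  simp only [PMF.pure_bind, PMF.bind_map, Function.comp_def, zero_add, add_zero] at this
  exact this

/-- The oracles of the adversary, with the pairs `(R, S)` drawn by a given sampler. -/
noncomputable def oraclesWith (samp : PMF (P.G × P.G)) (h : P.Hash × P.Kdf) :
    P.cpaInterface.Oracles
  | .enc, m => (encWith samp h.2 m).map code
  | .hash, e => PMF.pure (P.scalarBits (h.1 e))
  | .kdf, e => PMF.pure (Fin.append (h.2 e).1 (h.2 e).2)

/-- Simulation of `oraclesWith`. -/
noncomputable def stOracles (samp : PMF (P.G × P.G)) :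
    (q : P.cpaInterface.Op) → Bits (P.cpaInterface.inLen q) →
      St (P.LazyState T) (Bits (P.cpaInterface.outLen q))
  | .enc, m => fun s => (stEnc samp m s).map fun p => (code p.1, p.2)
  | .hash, e => fun s => (stHash e s).map fun p => (P.scalarBits p.1, p.2)
  | .kdf, e => fun s => (stKdf e s).map fun p => (Fin.append p.1.1 p.1.2, p.2)

theorem simulates_stOracles (samp : PMF (P.G × P.G)) (q : P.cpaInterface.Op)
    (x : Bits (P.cpaInterface.inLen q)) :
    Simulates (LazyState.oracles (P := P) (T := T)) LazyState.size T 1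
      (fun h => oraclesWith samp h q x) (stOracles samp q x) := by
  cases q with
  | enc => exact (simulates_stEnc samp x).map code
  | hash =>
    have := (simulates_stHash (T := T) x).map P.scalarBits
    simp only [PMF.pure_map] at this
    exact this
  | kdf =>
    have := (simulates_stKdf (T := T) x).map fun k => Fin.append k.1 k.2
    simp only [PMF.pure_map] at this
    exact this

/-! ### The two phases of the experiment -/

/-- The message `m_b` in the output of the first phase. -/
def chosenMsg {st : ℕ} (b : Bool) (y : Bits (P.msgLen + P.msgLen + st)) : Bits P.msgLen :=
  fun i => y (Fin.castAdd st (if b then Fin.natAdd P.msgLen i else Fin.castAdd P.msgLen i))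

/-- The state in the output of the first phase. -/
def chosenState {st : ℕ} (y : Bits (P.msgLen + P.msgLen + st)) : Bits st :=
  fun i => y (Fin.natAdd (P.msgLen + P.msgLen) i)

/-- Run both phases of an adversary, with a given challenger for the message `m_b`. -/
noncomputable def phases {st o : ℕ} (O : P.cpaInterface.Oracles) (pk : Bits P.pkLen)
    (chal : Bits P.msgLen → PMF P.CipherTuple) (b : Bool)
    (A₁ : Circuit P.cpaInterface (P.msgLen + P.msgLen + st) P.pkLen)
    (A₂ : Circuit P.cpaInterface o (P.pkLen + st + P.cipherLen)) : PMF (Bits o) :=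
  (A₁.run O pk).bind fun y => (chal (chosenMsg b y)).bind fun C =>
    A₂.run O (Fin.append (Fin.append pk (chosenState y)) (code C))

/-- Simulation of `phases`. -/
noncomputable def stPhases {st o : ℕ} (samp : PMF (P.G × P.G)) (pk : Bits P.pkLen)
    (chal : Bits P.msgLen → St (P.LazyState T) P.CipherTuple) (b : Bool)
    (A₁ : Circuit P.cpaInterface (P.msgLen + P.msgLen + st) P.pkLen)
    (A₂ : Circuit P.cpaInterface o (P.pkLen + st + P.cipherLen)) : St (P.LazyState T) (Bits o) :=
  fun s => (A₁.runSt (stOracles samp) pk s).bind fun y =>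
    (chal (chosenMsg b y.1) y.2).bind fun C =>
      A₂.runSt (stOracles samp) (Fin.append (Fin.append pk (chosenState y.1)) (code C.1)) C.2

theorem simulates_stPhases {st o n : ℕ} (samp : PMF (P.G × P.G)) (pk : Bits P.pkLen)
    {chal : P.Hash × P.Kdf → Bits P.msgLen → PMF P.CipherTuple}
    {chalSt : Bits P.msgLen → St (P.LazyState T) P.CipherTuple}
    (hc : ∀ m, Simulates LazyState.oracles LazyState.size T n (fun h => chal h m) (chalSt m))
    (b : Bool) (A₁ : Circuit P.cpaInterface (P.msgLen + P.msgLen + st) P.pkLen)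
    (A₂ : Circuit P.cpaInterface o (P.pkLen + st + P.cipherLen)) :
    Simulates LazyState.oracles LazyState.size T (A₁.queries + n + A₂.queries)
      (fun h => phases (oraclesWith samp h) pk (chal h) b A₁ A₂)
      (stPhases samp pk chalSt b A₁ A₂) :=
  ((Simulates.run (simulates_stOracles samp) A₁ pk).bind fun y =>
    (hc (chosenMsg b y)).bind fun C => Simulates.run (simulates_stOracles samp) A₂ _).mono
      (by omega)

end ECIESInstance

/-! ### Circuits for the simulation -/

section

variable {I J : OracleInterface} {Ω : Type} {orc : Ω → I.Oracles} {α σ : Type} [Coded α] [Coded σ]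

/-- Gate by gate: an oracle gate is replaced by the circuit that simulates it, a sampling gate
becomes a mixture over its outcomes, and the 5 covers the gates and rewirings in between. The type
`α` carries data that the simulation needs throughout. -/
theorem Computes.runSt {B o : ℕ}
    {S : Ω → α → (q : J.Op) → Bits (J.inLen q) → St σ (Bits (J.outLen q))}
    (hS : ∀ q, Computes orc B fun ω (p : (α × Bits (J.inLen q)) × σ) => S ω p.1.1 q p.1.2 p.2)
    {n : ℕ} (C : Circuit J o n) :
    Computes orc (C.size * (B + 5)) fun ω (p : (α × Bits n) × σ) =>
      C.runSt (S ω p.1.1) p.1.2 p.2 := by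
  induction C with
  | @out n w =>
    refine Computes.mono (Computes.wiring
      (f := fun p : (α × Bits n) × σ => ((fun i => p.1.2 (w i) : Bits o), p.2))
      (Wiring.prodMk (Wiring.select (by fun_prop) w) (by fun_prop))) ?_
    have : 1 ≤ (Circuit.out w : Circuit J o n).size := by simp [Circuit.size]
    nlinarith
  | @const n b rest ih =>
    have hw : Wiring fun p : (α × Bits n) × σ =>
        ((p.1.1, (Fin.append p.1.2 (fun _ => b) : Bits (n + 1))), p.2) :=
      Wiring.prodMk (Wiring.prodMk (by fun_prop) (Wiring.append (by fun_prop)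
        (Wiring.replicate (Wiring.const b)))) (by fun_prop)
    refine Computes.mono (Computes.comp ih hw) ?_
    simp only [Circuit.size]
    nlinarith
  | @nand n i j rest ih =>
    have h1 : ComputesFun orc 3 fun p : (α × Bits n) × σ => !(p.1.2 i && p.1.2 j) :=
      Computes.comp ComputesFun.nandGate
        (f := fun p : (α × Bits n) × σ => (p.1.2 i, p.1.2 j))
        (Wiring.prodMk (Wiring.getBit (f := fun p : (α × Bits n) × σ => p.1.2) (by fun_prop) i)
          (Wiring.getBit (f := fun p : (α × Bits n) × σ => p.1.2) (by fun_prop) j))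
    have hw : Wiring fun q : ((α × Bits n) × σ) × Bool =>
        ((q.1.1.1, (Fin.append q.1.1.2 (fun _ => q.2) : Bits (n + 1))), q.1.2) :=
      Wiring.prodMk (Wiring.prodMk (by fun_prop) (Wiring.append (by fun_prop)
        (Wiring.replicate (by fun_prop)))) (by fun_prop)
    refine Computes.mono (Computes.bindFun h1 (Computes.comp ih hw)) ?_
    simp only [Circuit.size]
    nlinarith
  | @sample n m rest ih =>
    refine Computes.mono (Computes.mix (PMF.uniformOfFintype (Fin (m + 1))) fun a =>
      Computes.comp ih (f := fun p : (α × Bits n) × σ =>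
        ((p.1.1, (Fin.append p.1.2 (natBits (Nat.size m) a) : Bits _)), p.2))
        (Wiring.prodMk (Wiring.prodMk (by fun_prop) (Wiring.append (by fun_prop)
          (Wiring.const (β := Bits (Nat.size m)) (natBits (Nat.size m) a)))) (by fun_prop))) ?_
    simp only [Circuit.size]
    nlinarith
  | @query n q w rest ih =>
    have h1 := Computes.comp (hS q) (f := fun p : (α × Bits n) × σ =>
      ((p.1.1, (fun i => p.1.2 (w i) : Bits (J.inLen q))), p.2))
      (Wiring.prodMk (Wiring.prodMk (by fun_prop) (Wiring.select (by fun_prop) w)) (by fun_prop))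
    have h2 := Computes.comp ih
      (f := fun r : ((α × Bits n) × σ) × (Bits (J.outLen q) × σ) =>
        ((r.1.1.1, (Fin.append r.1.1.2 r.2.1 : Bits (n + J.outLen q))), r.2.2)) (by fun_prop)
    refine Computes.mono (Computes.bind h1 h2) ?_
    simp only [Circuit.size]
    nlinarith

variable {T n : ℕ} {Y : Type} [Coded Y] [Fintype Y] [Nonempty Y]

/-- A lookup with a fresh random default answers new and repeated queries alike, so no branch on
membership is needed and every query pushes exactly one entry. -/
theorem computes_answer :
    Computes orc (T * (90 * n + 60 * len Y + 50) + 10)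
      fun _ (p : Bits n × AssocTable T (Bits n) Y) => p.2.answer p.1 := by
  have h1 : Computes orc 2 fun _ (_ : Bits n × AssocTable T (Bits n) Y) =>
      PMF.uniformOfFintype Y := Computes.sample _
  have h2 := Computes.comp (computesFun_lookD (orc := orc) (T := T) (n := n) (Y := Y))
    (f := fun p : (Bits n × AssocTable T (Bits n) Y) × Y => ((p.1.1, p.2), p.1.2)) (by fun_prop)
  have h3 := Computes.bindFun h2 (Computes.wiring
    (f := fun q : ((Bits n × AssocTable T (Bits n) Y) × Y) × Y =>
      (q.2, q.1.1.2.push (q.1.1.1, q.2))) (by fun_prop))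
  exact Computes.mono (Computes.bind h1 h3) (by omega)

end

namespace ECIESInstance

variable {I : OracleInterface} {Ω : Type} {orc : Ω → I.Oracles} {α : Type} [Coded α]
  {P : ECIESInstance} {T : ℕ}

theorem computes_stHash :
    Computes orc (T * (90 * (P.idLen + P.pointLen) + 60 * Nat.size P.N + 50) + 14)
      fun _ (p : Bits (P.idLen + P.pointLen) × P.LazyState T) => stHash p.1 p.2 := by
  have h1 := Computes.comp (computes_answer (orc := orc) (T := T) (n := P.idLen + P.pointLen)
    (Y := ZMod P.N)) (f := fun p : Bits (P.idLen + P.pointLen) × P.LazyState T => (p.1, p.2.1))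
    (by fun_prop)
  have h2 := Computes.mapWiring h1 (g := fun q : (Bits (P.idLen + P.pointLen) × P.LazyState T) ×
    (ZMod P.N × AssocTable T (Bits (P.idLen + P.pointLen)) (ZMod P.N)) =>
      (q.2.1, (q.2.2, q.1.2.2))) (by fun_prop)
  exact Computes.mono h2 le_rfl

theorem computes_stKdf :
    Computes orc (T * (90 * P.pointLen + 60 * (P.encKeyLen + P.macKeyLen) + 50) + 14)
      fun _ (p : P.G × P.LazyState T) => stKdf (P.encode p.1) p.2 := by
  have h1 := Computes.comp (computes_answer (orc := orc) (T := T) (n := P.pointLen)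
    (Y := Bits P.encKeyLen × Bits P.macKeyLen))
    (f := fun p : P.G × P.LazyState T => (P.encode p.1, p.2.2))
    (Wiring.prodMk (Wiring.code (f := fun p : P.G × P.LazyState T => p.1) (by fun_prop))
      (by fun_prop))
  have h2 := Computes.mapWiring h1 (g := fun q : (P.G × P.LazyState T) ×
    ((Bits P.encKeyLen × Bits P.macKeyLen) ×
      AssocTable T (Bits P.pointLen) (Bits P.encKeyLen × Bits P.macKeyLen)) =>
      (q.2.1, (q.1.2.1, q.2.2))) (by fun_prop)
  exact Computes.mono h2 le_rfl

theorem computes_sealWith : Computes orc (P.symEnc.size + P.mac.size + 10)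
    fun _ (p : ((Bits P.encKeyLen × Bits P.macKeyLen) × Bits P.msgLen) × P.G) =>
      sealWith p.1.1 p.1.2 p.2 := by
  have h1 := Computes.comp (computes_symEnc (orc := orc) (P := P))
    (f := fun p : ((Bits P.encKeyLen × Bits P.macKeyLen) × Bits P.msgLen) × P.G =>
      (p.1.1.1, p.1.2)) (by fun_prop)
  have h2 := Computes.comp (computes_mac (orc := orc) (P := P))
    (f := fun q : (((Bits P.encKeyLen × Bits P.macKeyLen) × Bits P.msgLen) × P.G) ×
      Bits P.ctLen => (q.1.1.1.2, q.2)) (by fun_prop)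
  have h3 := Computes.mapWiring h2
    (g := fun q : ((((Bits P.encKeyLen × Bits P.macKeyLen) × Bits P.msgLen) × P.G) ×
      Bits P.ctLen) × Bits P.tagLen => ((q.1.2, q.2), q.1.1.2)) (by fun_prop)
  exact Computes.mono (Computes.bind h1 h3) (by omega)

theorem computes_stEnc {s : ℕ} {samp : Ω → α → PMF (P.G × P.G)} (hs : Computes orc s samp) :
    Computes orc (s + T * (90 * P.pointLen + 60 * (P.encKeyLen + P.macKeyLen) + 50) +
        P.symEnc.size + P.mac.size + 40)
      fun ω (p : (α × Bits P.msgLen) × P.LazyState T) => stEnc (samp ω p.1.1) p.1.2 p.2 := by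
  have h1 := Computes.comp hs (f := fun p : (α × Bits P.msgLen) × P.LazyState T => p.1.1)
    (by fun_prop)
  have h2 := Computes.comp (computes_stKdf (orc := orc) (P := P) (T := T))
    (f := fun q : ((α × Bits P.msgLen) × P.LazyState T) × (P.G × P.G) => (q.2.2, q.1.2))
    (by fun_prop)
  have h3 := Computes.comp (computes_sealWith (orc := orc) (P := P))
    (f := fun r : (((α × Bits P.msgLen) × P.LazyState T) × (P.G × P.G)) ×
      ((Bits P.encKeyLen × Bits P.macKeyLen) × P.LazyState T) =>
        ((r.2.1, r.1.1.1.2), r.1.2.1)) (by fun_prop)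
  have h4 := Computes.mapWiring h3
    (g := fun u : ((((α × Bits P.msgLen) × P.LazyState T) × (P.G × P.G)) ×
      ((Bits P.encKeyLen × Bits P.macKeyLen) × P.LazyState T)) × P.CipherTuple =>
        (u.2, u.1.2.2)) (by fun_prop)
  exact Computes.mono (Computes.bind h1 (Computes.bind h2 h4)) (by omega)

/-- A bound for the size of the circuits that answer one query, if `s` bounds the sampler. -/
def querySize (P : ECIESInstance) (T s : ℕ) : ℕ :=
  s + T * (90 * P.idLen + 90 * P.pointLen + 60 * P.encKeyLen + 60 * P.macKeyLen +
    60 * Nat.size P.N + 50) + P.symEnc.size + P.mac.size + 50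

theorem computes_stOracles {s : ℕ} {samp : Ω → α → PMF (P.G × P.G)} (hs : Computes orc s samp)
    (q : P.cpaInterface.Op) :
    Computes orc (P.querySize T s)
      fun ω (p : (α × Bits (P.cpaInterface.inLen q)) × P.LazyState T) =>
        stOracles (samp ω p.1.1) q p.1.2 p.2 := by
  unfold querySize
  have hT : ∀ a b : ℕ, a ≤ b → T * a ≤ T * b := fun a b h => Nat.mul_le_mul_left T h
  cases q with
  | enc =>
    have h1 := Computes.mapWiring (computes_stEnc (T := T) hs)
      (g := fun q : ((α × Bits P.msgLen) × P.LazyState T) × (P.CipherTuple × P.LazyState T) =>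
        (code q.2.1, q.2.2)) (by fun_prop)
    refine Computes.mono h1 ?_
    have := hT (90 * P.pointLen + 60 * (P.encKeyLen + P.macKeyLen) + 50)
      (90 * P.idLen + 90 * P.pointLen + 60 * P.encKeyLen + 60 * P.macKeyLen +
        60 * Nat.size P.N + 50) (by omega)
    omega
  | hash =>
    have h1 := Computes.comp (computes_stHash (orc := orc) (P := P) (T := T))
      (f := fun p : (α × Bits (P.idLen + P.pointLen)) × P.LazyState T => (p.1.2, p.2))
      (by fun_prop)
    have h2 := Computes.mapWiring h1
      (g := fun q : ((α × Bits (P.idLen + P.pointLen)) × P.LazyState T) ×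
        (ZMod P.N × P.LazyState T) => (code q.2.1, q.2.2)) (by fun_prop)
    refine Computes.mono h2 ?_
    have := hT (90 * (P.idLen + P.pointLen) + 60 * Nat.size P.N + 50)
      (90 * P.idLen + 90 * P.pointLen + 60 * P.encKeyLen + 60 * P.macKeyLen +
        60 * Nat.size P.N + 50) (by omega)
    omega
  | kdf =>
    have h1 := Computes.comp (computes_answer (orc := orc) (T := T) (n := P.pointLen)
      (Y := Bits P.encKeyLen × Bits P.macKeyLen))
      (f := fun p : (α × Bits P.pointLen) × P.LazyState T => (p.1.2, p.2.2)) (by fun_prop)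
    have h2 := Computes.mapWiring h1
      (g := fun q : ((α × Bits P.pointLen) × P.LazyState T) ×
        ((Bits P.encKeyLen × Bits P.macKeyLen) ×
          AssocTable T (Bits P.pointLen) (Bits P.encKeyLen × Bits P.macKeyLen)) =>
        ((Fin.append q.2.1.1 q.2.1.2 : Bits _), (q.1.2.1, q.2.2))) (by fun_prop)
    refine (congrArg (Computes orc _) ?_).mp (Computes.mono h2 (s' := s + T * (90 * P.idLen +
      90 * P.pointLen + 60 * P.encKeyLen + 60 * P.macKeyLen + 60 * Nat.size P.N + 50) +
      P.symEnc.size + P.mac.size + 50) ?_)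
    · funext ω p
      simp only [stOracles, stKdf, PMF.map_comp]
      rfl
    · have := hT (90 * P.pointLen + 60 * (P.encKeyLen + P.macKeyLen) + 50)
        (90 * P.idLen + 90 * P.pointLen + 60 * P.encKeyLen + 60 * P.macKeyLen +
          60 * Nat.size P.N + 50) (by omega)
      change T * (90 * P.pointLen + 60 * (P.encKeyLen + P.macKeyLen) + 50) + 10 + 2 + 2 ≤ _
      omega

theorem wiring_chosenMsg {st : ℕ} (b : Bool) :
    Wiring fun y : Bits (P.msgLen + P.msgLen + st) => chosenMsg b y :=
  Wiring.select Wiring.id _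

theorem wiring_chosenState {st : ℕ} :
    Wiring fun y : Bits (P.msgLen + P.msgLen + st) => chosenState (P := P) y :=
  Wiring.select Wiring.id _

theorem computes_stPhases {s s' c o st : ℕ} {samp : Ω → α → PMF (P.G × P.G)}
    (hs : Computes orc s samp) {pk : α → Bits P.pkLen} (hpk : ComputesFun orc s' pk)
    {chal : Ω → α → Bits P.msgLen → St (P.LazyState T) P.CipherTuple}
    (hc : Computes orc c fun ω (p : (α × Bits P.msgLen) × P.LazyState T) =>
      chal ω p.1.1 p.1.2 p.2) (b : Bool)
    (A₁ : Circuit P.cpaInterface (P.msgLen + P.msgLen + st) P.pkLen)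
    (A₂ : Circuit P.cpaInterface o (P.pkLen + st + P.cipherLen)) (s₀ : P.LazyState T) :
    Computes orc (s' + c + (A₁.size + A₂.size) * (P.querySize T s + 5) + 10)
      fun ω a => (stPhases (samp ω a) (pk a) (chal ω a) b A₁ A₂ s₀).map Prod.fst := by
  have h1 := Computes.comp (Computes.runSt (S := fun ω a => stOracles (samp ω a))
    (computes_stOracles (T := T) hs) A₁)
    (f := fun p : α × Bits P.pkLen => ((p.1, p.2), s₀)) (by fun_prop)
  have hm : Wiring fun q : (α × Bits P.pkLen) ×
      (Bits (P.msgLen + P.msgLen + st) × P.LazyState T) =>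
        ((q.1.1, chosenMsg b q.2.1), q.2.2) :=
    Wiring.prodMk (Wiring.prodMk (by fun_prop)
      (Wiring.comp (wiring_chosenMsg b) (by fun_prop))) (by fun_prop)
  have h2 := Computes.comp hc hm
  have hr : Wiring fun r : ((α × Bits P.pkLen) ×
      (Bits (P.msgLen + P.msgLen + st) × P.LazyState T)) × (P.CipherTuple × P.LazyState T) =>
        ((r.1.1.1, (Fin.append (Fin.append r.1.1.2 (chosenState (P := P) r.1.2.1)) (code r.2.1) :
          Bits (P.pkLen + st + P.cipherLen))), r.2.2) := by
    have hst : Wiring fun r : ((α × Bits P.pkLen) ×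
        (Bits (P.msgLen + P.msgLen + st) × P.LazyState T)) × (P.CipherTuple × P.LazyState T) =>
        (chosenState (P := P) r.1.2.1) := Wiring.comp wiring_chosenState (by fun_prop)
    exact Wiring.prodMk (Wiring.prodMk (by fun_prop)
      (Wiring.append (Wiring.append (by fun_prop) hst)
        (Wiring.code (f := fun r : ((α × Bits P.pkLen) ×
          (Bits (P.msgLen + P.msgLen + st) × P.LazyState T)) ×
            (P.CipherTuple × P.LazyState T) => r.2.1) (by fun_prop)))) (by fun_prop)
  have h3 := Computes.mapWiring (Computes.comp (Computes.runSt
    (S := fun ω a => stOracles (samp ω a)) (computes_stOracles (T := T) hs) A₂) hr)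
    (g := fun q => q.2.1) (by fun_prop)
  have h4 := Computes.bindFun hpk (Computes.bind h1 (Computes.bind h2 h3))
  refine (congrArg (Computes orc _) ?_).mp (Computes.mono h4
    (s' := s' + c + (A₁.size + A₂.size) * (P.querySize T s + 5) + 10) ?_)
  · funext ω a
    simp only [stPhases, PMF.map_bind]
  · rw [Nat.add_mul]
    omega

end ECIESInstance

namespace ECIESInstance

variable (P : ECIESInstance)

/-! ### Scalar multiplication -/

/-- The group as a vector space over `ZMod N`. -/
@[reducible]
def zmodModule : Module (ZMod P.N) P.G :=
  AddCommGroup.zmodModule fun x => by rw [← P.card_eq]; exact card_nsmul_eq_zero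

theorem smul_eq (a : ZMod P.N) (X : P.G) :
    P.smul a X = (letI := P.zmodModule; a • X) := by
  let _ := P.zmodModule
  rw [smul, ← Nat.cast_smul_eq_nsmul (ZMod P.N), ZMod.natCast_zmod_val]

theorem add_smul' (a b : ZMod P.N) (X : P.G) : P.smul (a + b) X = P.smul a X + P.smul b X := by
  let _ := P.zmodModule
  simp only [smul_eq, add_smul]

theorem mul_smul' (a b : ZMod P.N) (X : P.G) : P.smul (a * b) X = P.smul a (P.smul b X) := by
  let _ := P.zmodModule
  simp only [smul_eq, mul_smul]

theorem smul_sum' {ι : Type*} (a : ZMod P.N) (s : Finset ι) (X : ι → P.G) :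
    P.smul a (∑ i ∈ s, X i) = ∑ i ∈ s, P.smul a (X i) := by
  let _ := P.zmodModule
  simp only [smul_eq, Finset.smul_sum]

theorem zero_smul' (X : P.G) : P.smul 0 X = 0 := by simp [smul]

theorem smul_injective' {a : ZMod P.N} (ha : a ≠ 0) : Function.Injective (P.smul a) := by
  let _ := P.zmodModule
  simp only [smul_eq, Function.Injective]
  exact fun X Y h => smul_right_injective P.G ha h

theorem smul_left_injective' : Function.Injective fun a => P.smul a P.g := by
  let _ := P.zmodModule
  intro a b h
  simp only [smul_eq] at h
  exact smul_left_injective _ P.g_ne_zero h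

/-- Discrete exponentiation. -/
noncomputable def pointEquiv : ZMod P.N ≃ P.G :=
  Equiv.ofBijective (fun a => P.smul a P.g) <|
    (Fintype.bijective_iff_injective_and_card _).2
      ⟨P.smul_left_injective', by rw [P.card_eq, ZMod.card]⟩

theorem uniform_map_smul :
    ((PMF.uniformOfFintype (ZMod P.N)).map fun a => P.smul a P.g) = PMF.uniformOfFintype P.G :=
  PMF.uniformOfFintype_map_equiv P.pointEquiv

/-- The average over the nonzero residues is at most twice the average over all residues. -/
theorem expect_units_le (Q : ZMod P.N → ℝ≥0∞) (y : ZMod P.N) :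
    ((PMF.uniformOfFintype (ZMod P.N)ˣ).expect fun d => Q d) ≤
      2 * (PMF.uniformOfFintype (ZMod P.N)).expect fun a => Q (a - y) := by
  have hN := P.prime.out.two_le
  have h1 : ∑ d : (ZMod P.N)ˣ, Q d ≤ ∑ a : ZMod P.N, Q a := by
    simpa only [tsum_fintype] using
      ENNReal.tsum_comp_le_tsum_of_injective (Units.val_injective (α := ZMod P.N)) Q
  have h2 : ∑ a : ZMod P.N, Q (a - y) = ∑ a : ZMod P.N, Q a :=
    (Equiv.subRight y).sum_comp Q
  rw [PMF.expect_uniformOfFintype, PMF.expect_uniformOfFintype, h2, ← mul_assoc, ZMod.card,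
    ZMod.card_units]
  gcongr
  rw [← div_eq_mul_inv, ENNReal.le_div_iff_mul_le (by simp) (by simp), mul_comm, ← div_eq_mul_inv,
    ENNReal.div_le_iff (by rw [Nat.cast_ne_zero]; omega) (by simp)]
  -- This is where the factor 2 comes from; it is sharp for `N = 2`.
  exact_mod_cast (by omega : P.N ≤ 2 * (P.N - 1))

theorem expect_ite_eq {α : Type*} [Fintype α] [Nonempty α] [DecidableEq α] (a : α) :
    ((PMF.uniformOfFintype α).expect fun b => if b = a then 1 else 0) =
      (Fintype.card α : ℝ≥0∞)⁻¹ := by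
  rw [← PMF.apply_eq_expect, PMF.uniformOfFintype_apply]

/-! ### The experiment in terms of samplers -/

variable {P}

/-- The keys, from the scalars that are drawn in the key generation and a value of the hash
function. -/
def keysOf (d b h : ZMod P.N) (r : Fin P.k → (ZMod P.N)ˣ) : P.Keys where
  Γ :=
    { r := r
      R := fun i => P.smul (r i) P.g
      S := fun i => P.smul (r i) (P.smul h (P.smul b P.g) + P.smul d P.g) }
  x := h * b + d
  U := P.smul b P.g
  D := P.smul d P.g

/-- `hU + D = (hb + d)G` and scalars commute, so whoever knows the private key obtains the `S`
column of the table from the `R` column. -/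
theorem keysOf_S (d b h : ZMod P.N) (r : Fin P.k → (ZMod P.N)ˣ) (i : Fin P.k) :
    (keysOf d b h r).Γ.S i = P.smul (h * b + d) (P.smul (r i) P.g) := by
  simp only [keysOf]
  rw [← mul_smul', ← add_smul', ← mul_smul', ← mul_smul', mul_comm]

/-- Complete a point `R` to the pair `(R, xR)`. -/
def pairWith (x : ZMod P.N) (R : P.G) : P.G × P.G := (R, P.smul x R)

/-- The pairs `(R, S)` that the encryption draws from the table. -/
noncomputable abbrev realSampler (d b h : ZMod P.N) (r : Fin P.k → (ZMod P.N)ˣ) :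
    PMF (P.G × P.G) :=
  (P.bpvOutput r).map (pairWith (h * b + d))

theorem sampler_keysOf (d b h : ZMod P.N) (r : Fin P.k → (ZMod P.N)ˣ) :
    (P.randomSubset.map fun J =>
      (∑ i ∈ J, (keysOf d b h r).Γ.R i, ∑ i ∈ J, (keysOf d b h r).Γ.S i)) =
      realSampler d b h r := by
  rw [realSampler, bpvOutput, PMF.map_comp]
  congr 1
  funext J
  simp only [keysOf_S, Function.comp_apply, pairWith, smul_sum']
  rfl

/-- A ciphertext as a tuple. -/
def Ciphertext.tuple (C : P.Ciphertext) : P.CipherTuple := ((C.c, C.d), C.R)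

theorem enc_map_tuple (kdf : P.Kdf) (Γ : P.Table) (m : Bits P.msgLen) :
    (P.enc kdf Γ m).map Ciphertext.tuple =
      encWith (P.randomSubset.map fun J => (∑ i ∈ J, Γ.R i, ∑ i ∈ J, Γ.S i)) kdf m := by
  simp only [enc, encWith, sealWith, PMF.map_bind, PMF.bind_map, Function.comp_def, PMF.pure_map]
  rfl

theorem cpaOracles_eq (H : P.Hash) (kdf : P.Kdf) (Γ : P.Table) :
    P.cpaOracles H kdf Γ =
      oraclesWith (P.randomSubset.map fun J => (∑ i ∈ J, Γ.R i, ∑ i ∈ J, Γ.S i)) (H, kdf) := by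
  funext q x
  cases q with
  | enc =>
    simp only [cpaOracles, oraclesWith, ← enc_map_tuple, PMF.map_comp]
    rfl
  | hash => rfl
  | kdf => rfl

/-- The indicator of a correct guess. -/
noncomputable def guessed (b : Bool) (y : Bits 1) : ℝ≥0∞ := if y 0 = b then 1 else 0

theorem guessed_le_one (b : Bool) (y : Bits 1) : guessed b y ≤ 1 := by
  unfold guessed
  split_ifs <;> simp

/-- The tables of the random oracles after key generation. -/
def initialState (T : ℕ) (b h : ZMod P.N) : P.LazyState T :=
  (AssocTable.empty.push (Fin.append P.ID (P.encode (P.smul b P.g)), h), AssocTable.empty)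

/-- The winning probability for fixed keys and challenge bit. -/
noncomputable def phasesValue {st o : ℕ} (T : ℕ) (pub : Bool) (d b h : ZMod P.N)
    (r : Fin P.k → (ZMod P.N)ˣ) (samp : PMF (P.G × P.G))
    (chal : P.Hash × P.Kdf → Bits P.msgLen → PMF P.CipherTuple) (β : Bool)
    (A₁ : Circuit P.cpaInterface (P.msgLen + P.msgLen + st) P.pkLen)
    (A₂ : Circuit P.cpaInterface o (P.pkLen + st + P.cipherLen)) (φ : Bits o → ℝ≥0∞) : ℝ≥0∞ :=
  (initialState T b h).oracles.expect fun hk =>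
    (phases (oraclesWith samp hk) (P.pkBits pub (keysOf d b h r)) (chal hk) β A₁ A₂).expect φ

/-- Key generation evaluates `H` at a single point. One lazy query to an empty table turns this
value into an independent uniform scalar `h`, with the rest of the oracle still uniform. -/
theorem expect_oracles_initialState {T : ℕ} (hT : 1 ≤ T) (b : ZMod P.N)
    (φ : ZMod P.N → P.Hash × P.Kdf → ℝ≥0∞) :
    ((PMF.uniformOfFintype P.Hash).expect fun H => (PMF.uniformOfFintype P.Kdf).expect fun kdf =>
      φ (H (Fin.append P.ID (P.encode (P.smul b P.g)))) (H, kdf)) =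
      (PMF.uniformOfFintype (ZMod P.N)).expect fun h =>
        (initialState T b h).oracles.expect fun hk => φ h hk := by
  simp only [LazyState.oracles, PMF.expect_bind, PMF.expect_map, initialState,
    AssocTable.override_empty]
  have := AssocTable.expect_override (T := T) (AssocTable.empty)
    (by exact hT) (Fin.append P.ID (P.encode (P.smul b P.g)))
    (fun (f : P.Hash) (y : ZMod P.N) => (PMF.uniformOfFintype P.Kdf).expect fun g => φ y (f, g))
  simp only [AssocTable.override_empty, AssocTable.answer, PMF.expect_map,
    AssocTable.lookD_empty] at this
  exact this

/-- The order of the draws is rearranged for the reductions: `d`, `b`, `h` and the challenge bit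
come first, so that they can be fixed and hard-wired. The table scalars come last, because the BPV
assumption averages over them. -/
theorem cpaExperiment_eq {T : ℕ} (hT : 1 ≤ T) (pub : Bool) (A : P.CPAAdversary) :
    P.cpaExperiment pub A true =
      (PMF.uniformOfFintype (ZMod P.N)ˣ).expect fun d =>
      (PMF.uniformOfFintype (ZMod P.N)ˣ).expect fun b =>
      (PMF.uniformOfFintype (ZMod P.N)).expect fun h =>
      (PMF.uniformOfFintype Bool).expect fun β =>
      (PMF.uniformOfFintype (Fin P.k → (ZMod P.N)ˣ)).expect fun r =>
        phasesValue T pub d b h r (realSampler d b h r)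
          (fun hk => encWith (realSampler d b h r) hk.2) β
          A.choose A.guess (guessed β) := by
  have key (H : P.Hash) (kdf : P.Kdf) (d b h : ZMod P.N) (r : Fin P.k → (ZMod P.N)ˣ) :
      ((A.choose.run (P.cpaOracles H kdf (keysOf d b h r).Γ) (P.pkBits pub (keysOf d b h r))).bind
        fun y => (PMF.uniformOfFintype Bool).bind fun β =>
          (P.enc kdf (keysOf d b h r).Γ (if β then
            (fun i => y (Fin.castAdd A.stLen (Fin.natAdd P.msgLen i)))
            else (fun i => y (Fin.castAdd A.stLen (Fin.castAdd P.msgLen i))))).bind fun C =>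
          (A.guess.run (P.cpaOracles H kdf (keysOf d b h r).Γ)
            (Fin.append (Fin.append (P.pkBits pub (keysOf d b h r))
              (fun i => y (Fin.natAdd (P.msgLen + P.msgLen) i))) (P.cipherBits C))).bind fun b' =>
            PMF.pure (b' 0 == β)) true =
      (PMF.uniformOfFintype Bool).expect fun β =>
        (phases (oraclesWith (realSampler d b h r) (H, kdf))
          (P.pkBits pub (keysOf d b h r))
          (encWith (realSampler d b h r) kdf) β
          A.choose A.guess).expect (guessed β) := by
    rw [PMF.apply_eq_expect]
    simp only [PMF.expect_bind, phases, ← sampler_keysOf, ← cpaOracles_eq, ← enc_map_tuple,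
      PMF.expect_pure, PMF.expect_map]
    rw [PMF.expect_comm]
    refine congrArg _ (funext fun β => congrArg _ (funext fun y => ?_))
    have hm : (if β then (fun i => y (Fin.castAdd A.stLen (Fin.natAdd P.msgLen i)) :
        Bits P.msgLen) else (fun i => y (Fin.castAdd A.stLen (Fin.castAdd P.msgLen i)))) =
          chosenMsg β y := by
      cases β <;> rfl
    rw [hm]
    refine congrArg _ (funext fun C => ?_)
    simp only [beq_iff_eq]
    rfl
  have h1 : P.cpaExperiment pub A true =
      (PMF.uniformOfFintype P.Hash).expect fun H =>
      (PMF.uniformOfFintype P.Kdf).expect fun kdf =>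
      (PMF.uniformOfFintype (ZMod P.N)ˣ).expect fun d =>
      (PMF.uniformOfFintype (ZMod P.N)ˣ).expect fun b =>
      (PMF.uniformOfFintype (Fin P.k → (ZMod P.N)ˣ)).expect fun r =>
      (PMF.uniformOfFintype Bool).expect fun β =>
        (phases (oraclesWith (realSampler d b (H (Fin.append P.ID (P.encode (P.smul b P.g)))) r)
            (H, kdf))
          (P.pkBits pub (keysOf d b (H (Fin.append P.ID (P.encode (P.smul b P.g)))) r))
          (encWith (realSampler d b (H (Fin.append P.ID (P.encode (P.smul b P.g)))) r) kdf) β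
          A.choose A.guess).expect (guessed β) := by
    simp only [← key]
    simp only [cpaExperiment, kg, PMF.bind_bind, PMF.pure_bind, PMF.bind_apply, PMF.expect]
    rfl
  rw [h1]
  simp only [phasesValue]
  conv_lhs =>
    enter [2, H]
    rw [PMF.expect_comm]
    enter [2, d]
    rw [PMF.expect_comm]
  rw [PMF.expect_comm]
  refine congrArg _ (funext fun d => ?_)
  rw [PMF.expect_comm]
  refine congrArg _ (funext fun b => ?_)
  rw [expect_oracles_initialState hT b (fun h hk =>
    (PMF.uniformOfFintype (Fin P.k → (ZMod P.N)ˣ)).expect fun r =>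
      (PMF.uniformOfFintype Bool).expect fun β =>
        (phases (oraclesWith (realSampler d b h r) hk)
          (P.pkBits pub (keysOf d b h r))
          (encWith (realSampler d b h r) hk.2) β
          A.choose A.guess).expect (guessed β))]
  refine congrArg _ (funext fun h => ?_)
  rw [PMF.expect_comm]
  conv_rhs => rw [PMF.expect_comm]
  refine congrArg _ (funext fun r => ?_)
  rw [PMF.expect_comm]

end ECIESInstance

namespace ECIESInstance

variable {P : ECIESInstance} {I : OracleInterface} {Ω : Type} {orc : Ω → I.Oracles} {α : Type}
  [Coded α] {T : ℕ}

/-! ### Circuits for the public key and the samplers -/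

@[fun_prop]
theorem wiring_encode : Wiring P.encode := fun i => ⟨.inl i, fun _ => rfl⟩

/-- The public key in terms of the string that describes the table. -/
def pkString (U D : P.G) (tab : Bits (P.k * P.rowLen)) : Bits P.pkLen :=
  Fin.append (Fin.append (Fin.append P.ID (P.encode U)) (P.encode D)) tab

theorem wiring_pkString (U : P.G) :
    Wiring fun p : P.G × Bits (P.k * P.rowLen) => pkString U p.1 p.2 := by
  have h1 : Wiring fun _ : P.G × Bits (P.k * P.rowLen) => P.ID := Wiring.const _
  have h2 : Wiring fun _ : P.G × Bits (P.k * P.rowLen) => P.encode U := Wiring.const _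
  have h3 : Wiring fun p : P.G × Bits (P.k * P.rowLen) => P.encode p.1 := by fun_prop
  have h4 : Wiring fun p : P.G × Bits (P.k * P.rowLen) => p.2 := by fun_prop
  exact ((h1.append h2).append h3).append h4

/-- The rows of the table as a string. -/
def rowString (rows : Vect P.k ((ZMod P.N × P.G) × P.G)) : Bits (P.k * P.rowLen) := code rows

theorem wiring_rowString : Wiring (rowString (P := P)) := fun i => ⟨.inl i, fun _ => rfl⟩

/-- The public key in terms of the rows of the table. -/
def pkData (pub : Bool) (U D : P.G) (rows : Vect P.k ((ZMod P.N × P.G) × P.G)) : Bits P.pkLen :=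
  pkString U D (if pub then rowString rows else fun _ => false)

theorem pkBits_eq (pub : Bool) (K : P.Keys) :
    P.pkBits pub K = pkData pub K.U K.D fun i => (((K.Γ.r i : ZMod P.N), K.Γ.R i), K.Γ.S i) := by
  cases pub <;> rfl

theorem computesFun_pkData {s s' : ℕ} {pub : Bool} {U : P.G} {D : α → P.G}
    {rows : α → Vect P.k ((ZMod P.N × P.G) × P.G)} (hD : ComputesFun orc s D)
    (hrows : pub = true → ComputesFun orc s' rows) :
    ComputesFun orc (s + s' + 20) fun a => pkData pub U (D a) (rows a) := by
  have h : ComputesFun orc (s' + 4) fun a =>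
      (if pub then rowString (rows a) else fun _ => false : Bits (P.k * P.rowLen)) := by
    cases pub with
    | true => exact ComputesFun.comp (g := rowString) (Computes.wiring wiring_rowString) (hrows rfl)
    | false =>
      exact Computes.mono (Computes.wiring
        (f := fun _ : α => (fun _ => false : Bits (P.k * P.rowLen)))
        (Wiring.replicate (Wiring.const false))) (by omega)
  exact Computes.mono (ComputesFun.comp (Computes.wiring (wiring_pkString U))
    (ComputesFun.prodMk hD h)) (by omega)

theorem computesFun_smul (a : ZMod P.N) :
    ComputesFun orc (Nat.size P.N * (2 * P.addAlg.size + 20) + 2) fun X : P.G => P.smul a X :=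
  Computes.mono (computesFun_nsmul a.val) (by
    gcongr
    exact Nat.size_le_size a.val_lt.le)

theorem size_initialState (b h : ZMod P.N) : (initialState T b h : P.LazyState T).size = 1 := rfl

theorem computes_isGuess {s : ℕ} {F : Ω → α → PMF (Bits 1)} (hF : Computes orc s F) (β : Bool) :
    Computes orc (s + 13) fun ω a => (F ω a).map fun y => y 0 == β := by
  have h1 : ComputesFun orc 11 fun y : Bits 1 => y 0 == β := by
    have h2 : ComputesFun orc 2 fun y : Bits 1 => y 0 :=
      Computes.wiring (Wiring.getBit Wiring.id 0)
    cases β with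
    | true => exact ComputesFun.congr (Computes.mono h2 (by omega)) fun y => by simp
    | false => exact ComputesFun.congr h2.not fun y => by simp
  exact Computes.mono (Computes.bind hF (Computes.comp h1 (f := fun p : α × Bits 1 => p.2)
    (by fun_prop))) (by omega)

theorem expect_guessed (p : PMF (Bits 1)) (β : Bool) :
    p.expect (guessed β) = (p.map fun y => y 0 == β) true := by
  rw [PMF.apply_eq_expect, PMF.expect_map]
  simp only [beq_iff_eq]
  rfl

/-! ### The reduction to the randomness of the generator -/

/-- The oracle of a distinguisher that returns points drawn from a given distribution. -/
noncomputable def pointOracle (p : PMF P.G) : P.bpvInterface.Oracles := fun _ _ => p.map P.encode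

theorem computes_point (x : ZMod P.N) :
    Computes (pointOracle (P := P))
      (P.pointLen + Nat.size P.N * (2 * P.addAlg.size + 20) + 20)
      fun p (_ : α) => p.map (pairWith x) := by
  have h1 : Computes (pointOracle (P := P)) (P.pointLen + 1) fun p (_ : Unit) => p :=
    Computes.mono (Computes.query (I := P.bpvInterface) () rfl rfl _ fun _ _ => rfl)
      (by change 0 + P.pointLen + 1 ≤ _; omega)
  have h2 := Computes.comp h1 (f := fun _ : α => ()) (by fun_prop)
  have h3 : ComputesFun (pointOracle (P := P)) (Nat.size P.N * (2 * P.addAlg.size + 20) + 10)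
      fun R : P.G => pairWith x R :=
    Computes.mono (ComputesFun.prodMk (Computes.wiring (f := fun R : P.G => R) (by fun_prop))
      (computesFun_smul x)) (by omega)
  exact Computes.mono (Computes.bind h2 (Computes.comp h3 (f := fun q : α × P.G => q.2)
    (by fun_prop))) (by omega)

/-- A mixture cannot do better than the bound satisfied by each of its members. This is what
justifies the free randomness in `Computes`. -/
theorem BPVRandom.expect_le {pub : Bool} {t : ℕ} {ε : ℝ} (hB : P.BPVRandom pub t ε) {ι : Type}
    (q : PMF ι) (C : ι → P.BPVDistinguisher) (hC : ∀ i, (C i).size ≤ t) :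
    (q.expect fun i => P.bpvExperiment pub true (C i) true) ≤
      (q.expect fun i => P.bpvExperiment pub false (C i) true) + ENNReal.ofReal ε := by
  rw [← PMF.expect_const q (ENNReal.ofReal ε), ← PMF.expect_add]
  refine PMF.expect_mono _ fun i => ?_
  have h1 := (abs_le.1 (hB (C i) (hC i))).2
  have h0 := (abs_nonneg _).trans (hB (C i) (hC i))
  rw [← ENNReal.ofReal_toReal (PMF.apply_ne_top (P.bpvExperiment pub true (C i)) true),
    ← ENNReal.ofReal_toReal (PMF.apply_ne_top (P.bpvExperiment pub false (C i)) true),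
    ← ENNReal.ofReal_add ENNReal.toReal_nonneg h0]
  exact ENNReal.ofReal_le_ofReal (by linarith)

theorem bpvExperiment_eq (pub real : Bool) (A : P.BPVDistinguisher) :
    P.bpvExperiment pub real A true =
      (PMF.uniformOfFintype (Fin P.k → (ZMod P.N)ˣ)).expect fun r =>
        (A.run (pointOracle (if real then P.bpvOutput r else PMF.uniformOfFintype P.G))
          (P.bpvTableBits pub r)).expect (guessed true) := by
  rw [PMF.apply_eq_expect]
  simp only [bpvExperiment, PMF.expect_bind, PMF.expect_map]
  rfl

theorem stEncSize_le (P : ECIESInstance) (T s : ℕ) :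
    s + T * (90 * P.pointLen + 60 * (P.encKeyLen + P.macKeyLen) + 50) + P.symEnc.size +
      P.mac.size + 40 ≤ P.querySize T s := by
  unfold querySize
  have := Nat.mul_le_mul_left T (show 90 * P.pointLen + 60 * (P.encKeyLen + P.macKeyLen) + 50 ≤
    90 * P.idLen + 90 * P.pointLen + 60 * P.encKeyLen + 60 * P.macKeyLen +
      60 * Nat.size P.N + 50 by omega)
  omega

/-- A size bound for the reductions. -/
def reductionCost (P : ECIESInstance) (T t : ℕ) : ℕ :=
  (P.k + t + 2) * (P.querySize T (P.pointLen + Nat.size P.N * (2 * P.addAlg.size + 20) + 20) + 100)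

/-- With `d`, `b`, `h` fixed, a distinguisher knows `x`: it completes each oracle point to `(R,
xR)`, samples `H` and `KDF` lazily, runs the whole attack and reports whether the guess is right.
The 2 in the capacity stands for the entry of `H(ID‖U)` and for the challenge. -/
theorem phasesValue_bpv_le {pub : Bool} {t' : ℕ} {ε : ℝ} (hB : P.BPVRandom pub t' ε)
    (d b h : ZMod P.N) (β : Bool) {st : ℕ}
    (A₁ : Circuit P.cpaInterface (P.msgLen + P.msgLen + st) P.pkLen)
    (A₂ : Circuit P.cpaInterface 1 (P.pkLen + st + P.cipherLen))
    (hT : 2 + A₁.queries + A₂.queries ≤ T) (ht : P.reductionCost T (A₁.size + A₂.size) ≤ t') :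
    ((PMF.uniformOfFintype (Fin P.k → (ZMod P.N)ˣ)).expect fun r =>
      phasesValue T pub d b h r ((P.bpvOutput r).map (pairWith (h * b + d)))
        (fun hk => encWith ((P.bpvOutput r).map (pairWith (h * b + d))) hk.2) β A₁ A₂ (guessed β)) ≤
    ((PMF.uniformOfFintype (Fin P.k → (ZMod P.N)ˣ)).expect fun r =>
      phasesValue T pub d b h r ((PMF.uniformOfFintype P.G).map (pairWith (h * b + d)))
        (fun hk => encWith ((PMF.uniformOfFintype P.G).map (pairWith (h * b + d))) hk.2) β A₁ A₂
        (guessed β)) + ENNReal.ofReal ε := by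
  set x : ZMod P.N := h * b + d with hx
  let D : P.G := P.smul d P.g
  let U : P.G := P.smul b P.g
  let F (pk : Bits P.pkLen) (p : PMF P.G) : PMF Bool :=
    ((stPhases (p.map (pairWith x)) pk (stEnc (p.map (pairWith x))) β A₁ A₂
      (initialState T b h)).map Prod.fst).map fun y => y 0 == β
  have hF (r : Fin P.k → (ZMod P.N)ˣ) (p : PMF P.G) :
      phasesValue T pub d b h r (p.map (pairWith x)) (fun hk => encWith (p.map (pairWith x)) hk.2)
        β A₁ A₂ (guessed β) = F (P.pkBits pub (keysOf d b h r)) p true := by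
    have := (simulates_stPhases (T := T) (p.map (pairWith x)) (P.pkBits pub (keysOf d b h r))
      (fun m => simulates_stEnc (p.map (pairWith x)) m) β A₁ A₂).expect_eq (initialState T b h)
      (by rw [size_initialState]; omega) (guessed β)
    rw [phasesValue, this, ← expect_guessed, PMF.expect_map]
  -- the distinguisher, for either table convention
  have main {α : Type} [Coded α] (enc : (Fin P.k → (ZMod P.N)ˣ) → α)
      (rows : α → Vect P.k ((ZMod P.N × P.G) × P.G))
      (hrows : pub = true → ComputesFun (pointOracle (P := P))
        (P.k * (Nat.size P.N * (2 * P.addAlg.size + 20) + 20) + 2) rows)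
      (hrows' : pub = true → ∀ r, rows (enc r) = fun i =>
        (((r i : ZMod P.N), P.smul (r i) P.g), P.smul x (P.smul (r i) P.g))) :
      ∃ (ι : Type) (q : PMF ι) (C : ι → Circuit P.bpvInterface 1 (len α)),
        (∀ i, (C i).size ≤ t') ∧ ∀ r p,
          (q.expect fun i => ((C i).run (pointOracle p) (code (enc r))).expect (guessed true)) =
            F (P.pkBits pub (keysOf d b h r)) p true := by
    have hs := computes_point (α := α) (P := P) x
    have hpk := computesFun_pkData (U := U) (Computes.wiring (orc := pointOracle (P := P))
      (Wiring.const D)) hrows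
    have h1 := computes_isGuess (computes_stPhases (T := T) hs hpk
      (chal := fun p _ => stEnc (p.map (pairWith x))) (computes_stEnc hs) β A₁ A₂
      (initialState T b h)) β
    have hc : P.reductionCost T (A₁.size + A₂.size) ≤ t' := ht
    have hsize := P.stEncSize_le T (P.pointLen + Nat.size P.N * (2 * P.addAlg.size + 20) + 20)
    have hk : Nat.size P.N * (2 * P.addAlg.size + 20) + 20 ≤
      P.querySize T (P.pointLen + Nat.size P.N * (2 * P.addAlg.size + 20) + 20) := by omega
    unfold reductionCost at hc
    generalize P.querySize T (P.pointLen + Nat.size P.N * (2 * P.addAlg.size + 20) + 20) = Q at *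
    have hk' := Nat.mul_le_mul_left P.k hk
    have hexp : (P.k + (A₁.size + A₂.size) + 2) * (Q + 100) =
      P.k * Q + P.k * 100 + (A₁.size + A₂.size) * (Q + 5) + (A₁.size + A₂.size) * 95 + 2 * Q +
        200 := by ring
    -- A one-bit output gate has size 2.
    have h2 := Computes.mono (s' := t' - 2) h1 (by omega)
    obtain ⟨ι, q, C, hC, hq⟩ := h2
    refine ⟨ι, q, C, fun i => (hC i).trans ?_, fun r p => ?_⟩
    · change t' - 2 + (1 + 1) ≤ t'
      omega
    · have h3 := congrArg (fun ρ => PMF.expect ρ (guessed true)) (hq p (enc r))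
      simp only [PMF.expect_bind, PMF.expect_map] at h3
      refine h3.trans ?_
      have h4 : pkData pub U D (rows (enc r)) = P.pkBits pub (keysOf d b h r) := by
        rw [pkBits_eq]
        cases pub with
        | false => rfl
        | true =>
          rw [hrows' rfl r]
          congr 1
          funext i
          rw [keysOf_S]
          rfl
      simp only [F, ← h4, PMF.apply_eq_expect, PMF.expect_map]
      rfl
  have conclude (q_C : ∃ (ι : Type) (q : PMF ι) (C : ι → P.BPVDistinguisher),
      (∀ i, (C i).size ≤ t') ∧ ∀ r p,
        (q.expect fun i =>
          ((C i).run (pointOracle p) (P.bpvTableBits pub r)).expect (guessed true)) =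
            F (P.pkBits pub (keysOf d b h r)) p true) :
      ((PMF.uniformOfFintype (Fin P.k → (ZMod P.N)ˣ)).expect fun r =>
        F (P.pkBits pub (keysOf d b h r)) (P.bpvOutput r) true) ≤
      ((PMF.uniformOfFintype (Fin P.k → (ZMod P.N)ˣ)).expect fun r =>
        F (P.pkBits pub (keysOf d b h r)) (PMF.uniformOfFintype P.G) true) + ENNReal.ofReal ε := by
    obtain ⟨ι, q, C, hC, hq⟩ := q_C
    have := hB.expect_le q C hC
    simp only [bpvExperiment_eq] at this
    rw [PMF.expect_comm q, PMF.expect_comm q] at this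
    simpa only [hq, if_true, if_false, Bool.false_eq_true] using this
  simp only [hF]
  apply conclude
  cases pub with
  | true =>
    have hrow (i : Fin P.k) : ComputesFun (pointOracle (P := P))
        (Nat.size P.N * (2 * P.addAlg.size + 20) + 16)
        fun a : Vect P.k (ZMod P.N × P.G) => (a i, P.smul x (a i).2) :=
      have hi : Wiring fun a : Vect P.k (ZMod P.N × P.G) => a i := Wiring.apply Wiring.id i
      Computes.mono (ComputesFun.prodMk (Computes.wiring hi)
        (ComputesFun.comp (computesFun_smul x)
          (Computes.wiring (f := fun a : Vect P.k (ZMod P.N × P.G) => (a i).2)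
            (Wiring.comp Wiring.snd hi)))) (by omega)
    -- The code of this type of rows is, by definition, the string shown to the distinguisher;
    -- multiplication by `x` supplies the missing column.
    exact main (α := Vect P.k (ZMod P.N × P.G)) (fun r i => (r i, P.smul (r i) P.g))
      (fun a i => (a i, P.smul x (a i).2)) (fun _ => ComputesFun.vect hrow) fun _ _ => rfl
  | false =>
    -- When the table is hidden, `pkData` ignores the rows, so dummy rows serve.
    exact main (α := Bits (P.k * (Nat.size P.N + P.pointLen))) (P.bpvTableBits false)
      (fun _ _ => ((0, 0), 0)) (fun h => by cases h) fun h => by cases h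

end ECIESInstance

theorem Circuit.queries_rename {I : OracleInterface} {o n m : ℕ} (w : Fin n → Fin m)
    (C : Circuit I o n) : (C.rename w).queries = C.queries := by
  induction C generalizing m with
  | out v => rfl
  | const b rest ih => simp [rename, queries, ih]
  | nand i j rest ih => simp [rename, queries, ih]
  | sample m rest ih => simp [rename, queries, ih]
  | query q v rest ih => simp [rename, queries, ih]

namespace ECIESInstance

variable {P : ECIESInstance} {T : ℕ}

/-! ### A challenge under fresh keys -/

section Phases

variable {st o : ℕ}
  (A₁ : Circuit P.cpaInterface (P.msgLen + P.msgLen + st) P.pkLen)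
  (A₂ : Circuit P.cpaInterface o (P.pkLen + st + P.cipherLen))

/-- The challenger is called exactly once, so its randomness may be drawn before the first phase. -/
theorem expect_phases_bind {ι : Type} (O : P.cpaInterface.Oracles) (pk : Bits P.pkLen) (q : PMF ι)
    (chal : ι → Bits P.msgLen → PMF P.CipherTuple) (b : Bool) (φ : Bits o → ℝ≥0∞) :
    (phases O pk (fun m => q.bind fun i => chal i m) b A₁ A₂).expect φ =
      q.expect fun i => (phases O pk (chal i) b A₁ A₂).expect φ := by
  simp only [phases, PMF.expect_bind]
  rw [PMF.expect_comm]

/-- An adversary that puts out the arguments of the queries to the key derivation function, one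
by one. -/
def kdfPairs : List (Circuit P.cpaInterface (P.msgLen + P.msgLen + st) P.pkLen ×
    Circuit P.cpaInterface P.pointLen (P.pkLen + st + P.cipherLen)) :=
  (kdfQueries A₁).map (fun C => (.const false (.out fun _ => Fin.last _),
    C.rename fun i => Fin.castAdd P.cipherLen (Fin.castAdd st i))) ++
  (kdfQueries A₂).map (fun C => (A₁, C))

theorem length_kdfPairs_le : (kdfPairs A₁ A₂).length ≤ A₁.queries + A₂.queries := by
  have := length_kdfQueries_le A₁
  have := length_kdfQueries_le A₂
  simp only [kdfPairs, List.length_append, List.length_map]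
  omega

theorem queries_of_mem_kdfPairs : ∀ B ∈ kdfPairs A₁ A₂,
    B.1.queries + B.2.queries ≤ A₁.queries + A₂.queries := by
  intro B hB
  simp only [kdfPairs, List.mem_append, List.mem_map] at hB
  rcases hB with ⟨C, hC, rfl⟩ | ⟨C, hC, rfl⟩
  · have := queries_of_mem_kdfQueries A₁ C hC
    simp only [Circuit.queries_rename, Circuit.queries]
    omega
  · have := queries_of_mem_kdfQueries A₂ C hC
    simp only
    omega

theorem size_of_mem_kdfPairs : ∀ B ∈ kdfPairs A₁ A₂,
    B.1.size + B.2.size ≤ 2 * (A₁.size + A₂.size) + P.pointLen + 1 := by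
  intro B hB
  simp only [kdfPairs, List.mem_append, List.mem_map] at hB
  rcases hB with ⟨C, hC, rfl⟩ | ⟨C, hC, rfl⟩
  · have := size_of_mem_kdfQueries A₁ C hC
    have := A₁.outputs_lt_size
    simp only [Circuit.size_rename, Circuit.size]
    omega
  · have := size_of_mem_kdfQueries A₂ C hC
    simp only
    omega

/-- A circuit truncated inside the first phase is run in the second phase instead, after a first
phase that puts out constants. The challenge is still produced but not read, so it integrates out.
-/
theorem phases_trivial (O : P.cpaInterface.Oracles) (pk : Bits P.pkLen)
    (chal : Bits P.msgLen → PMF P.CipherTuple) (b : Bool)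
    (C : Circuit P.cpaInterface P.pointLen P.pkLen) :
    phases (st := st) O pk chal b (.const false (.out fun _ => Fin.last _))
      (C.rename fun i => Fin.castAdd P.cipherLen (Fin.castAdd st i)) = C.run O pk := by
  have h (s : Bits st) (c : Bits P.cipherLen) : Fin.append (Fin.append pk s) c ∘
      (fun i => Fin.castAdd P.cipherLen (Fin.castAdd st i)) = pk := by
    funext i
    simp
  simp only [phases, Circuit.run_rename, h, PMF.bind_const]

/-- The challenger is the same on both sides, so only oracle calls of the two phases contribute. All
probabilities in the bound refer to `O'`. -/
theorem close_phases {O O' : P.cpaInterface.Oracles}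
    {κ : (q : P.cpaInterface.Op) → Bits (P.cpaInterface.inLen q) → ℝ≥0∞}
    (h : ∀ q x, (O q x).Close (O' q x) (κ q x)) (pk : Bits P.pkLen)
    (chal : Bits P.msgLen → PMF P.CipherTuple) (b : Bool) {δ : ℝ≥0∞} {z : Bits P.pointLen}
    (henc : ∀ x, κ CPAOp.enc x ≤ δ) (hhash : ∀ x, κ CPAOp.hash x = 0)
    (hkdf : ∀ x, κ CPAOp.kdf x ≤ if x = z then 1 else 0) :
    (phases O pk chal b A₁ A₂).Close (phases O' pk chal b A₁ A₂)
      ((A₁.queries + A₂.queries : ℕ) * δ +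
        ((kdfPairs A₁ A₂).map fun B => (phases O' pk chal b B.1 B.2) z).sum) := by
  classical
  have h2 (y : Bits (P.msgLen + P.msgLen + st)) := PMF.Close.bind
    (PMF.Close.refl (chal (chosenMsg b y)) 0) fun C => Circuit.close_run h A₂
      (Fin.append (Fin.append pk (chosenState y)) (code C))
  have h3 := PMF.Close.bind (Circuit.close_run h A₁ pk) h2
  intro φ hφ
  refine (h3 φ hφ).trans (add_le_add le_rfl ?_)
  simp only [zero_add]
  have h4 := cost_le_kdfQueries O' henc hhash hkdf A₁ pk
  have h5 : ((A₁.run O' pk).expect fun y => (chal (chosenMsg b y)).expect fun C =>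
      A₂.cost O' κ (Fin.append (Fin.append pk (chosenState y)) (code C))) ≤
      A₂.queries * δ + ((kdfQueries A₂).map fun C => (phases O' pk chal b A₁ C) z).sum := by
    refine (PMF.expect_mono _ fun y => PMF.expect_mono _ fun C =>
      cost_le_kdfQueries O' henc hhash hkdf A₂ _).trans (le_of_eq ?_)
    simp only [PMF.expect_add, PMF.expect_const, PMF.expect_list_sum, phases,
      PMF.bind_apply_eq_expect]
  refine (add_le_add h4 h5).trans (le_of_eq ?_)
  simp only [kdfPairs, List.map_append, List.map_map, List.sum_append, Function.comp_def,
    phases_trivial, Nat.cast_add]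
  ring

/-- The probability that a random multiple of `x` hits a given one, up to the case `x = 0`. -/
noncomputable def hitBound (x : ZMod P.N) : ℝ≥0∞ := (P.N : ℝ≥0∞)⁻¹ + if x = 0 then 1 else 0

/-- For `x ≠ 0`, multiplication by `x` is injective and a uniform `R` hits with probability `1/N`.
For `x = 0` every point hits, which the second term of `hitBound` absorbs. -/
theorem expect_hit_le (x : ZMod P.N) (R' : P.G) :
    (((PMF.uniformOfFintype P.G).map (pairWith x)).expect fun p =>
      if P.encode p.2 = P.encode (P.smul x R') then 1 else 0) ≤ hitBound x := by
  classical
  unfold hitBound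
  by_cases hx : x = 0
  · rw [if_pos hx]
    refine (PMF.expect_le_const _ fun p => ?_).trans le_add_self
    split_ifs <;> simp
  · rw [if_neg hx, add_zero, PMF.expect_map, ← P.card_eq, ← expect_ite_eq R']
    refine le_of_eq (congrArg _ (funext fun R => ?_))
    simp only [pairWith, P.encode_injective.eq_iff, (P.smul_injective' hx).eq_iff]

/-- The samplers of the idealized game: `R` is uniform. -/
noncomputable def idealSampler (x : ZMod P.N) : PMF (P.G × P.G) :=
  (PMF.uniformOfFintype P.G).map (pairWith x)

theorem encWith_close (x : ZMod P.N) (R' : P.G) (kdf : P.Kdf)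
    (K : Bits P.encKeyLen × Bits P.macKeyLen) (m : Bits P.msgLen) :
    (encWith (idealSampler x) (Function.update kdf (P.encode (P.smul x R')) K) m).Close
      (encWith (idealSampler x) kdf m) (hitBound x) := fun φ hφ => by
  have := PMF.close_bind_of_eq_except (idealSampler x)
    (fun p => sealWith (Function.update kdf (P.encode (P.smul x R')) K (P.encode p.2)) m p.1)
    (fun p => sealWith (kdf (P.encode p.2)) m p.1)
    (fun p => if P.encode p.2 = P.encode (P.smul x R') then 1 else 0) fun p => by
      by_cases h : P.encode p.2 = P.encode (P.smul x R')
      · exact .inr (by rw [if_pos h])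
      · exact .inl (by rw [Function.update_of_ne h])
  exact (this φ hφ).trans (add_le_add le_rfl (expect_hit_le x R'))

/-- The oracles change little when the key derivation function is changed at one point. -/
noncomputable def updateCost (δ : ℝ≥0∞) (z : Bits P.pointLen) :
    (q : P.cpaInterface.Op) → Bits (P.cpaInterface.inLen q) → ℝ≥0∞
  | .enc, _ => δ
  | .hash, _ => 0
  | .kdf, x => if (show Bits P.pointLen from x) = z then 1 else 0

theorem oraclesWith_close (x : ZMod P.N) (R' : P.G) (H : P.Hash) (kdf : P.Kdf)
    (K : Bits P.encKeyLen × Bits P.macKeyLen) (q : P.cpaInterface.Op)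
    (e : Bits (P.cpaInterface.inLen q)) :
    (oraclesWith (idealSampler x) (H, Function.update kdf (P.encode (P.smul x R')) K) q e).Close
      (oraclesWith (idealSampler x) (H, kdf) q e)
      (updateCost (hitBound x) (P.encode (P.smul x R')) q e) := by
  cases q with
  | enc => exact (encWith_close x R' kdf K e).map _
  | hash => exact PMF.Close.refl _ _
  | kdf =>
    by_cases h : (show Bits P.pointLen from e) = P.encode (P.smul x R')
    · exact PMF.Close.one _ _ (by simp only [updateCost]; rw [if_pos h])
    · simp only [oraclesWith]
      rw [Function.update_of_ne h]
      exact PMF.Close.refl _ _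

/-- The value of the game in which the challenge is encrypted under fresh keys. -/
noncomputable def freshValue (T : ℕ) (pub : Bool) (d b h : ZMod P.N) (r : Fin P.k → (ZMod P.N)ˣ)
    (β : Bool) (φ : P.G → Bits o → ℝ≥0∞) : ℝ≥0∞ :=
  (PMF.uniformOfFintype P.G).expect fun R =>
    (PMF.uniformOfFintype (Bits P.encKeyLen × Bits P.macKeyLen)).expect fun K =>
      phasesValue T pub d b h r (idealSampler (h * b + d)) (fun _ m => sealWith K m R) β A₁ A₂ (φ R)

/-- Draw the challenge point `R` first and resample `KDF` at `xR`: the value `K` there is a fresh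
key pair, used by the challenge and by the oracles (`h1`). Undoing the update in the oracles, but
not in the challenge, gives the fresh game (`h3`) and costs the chance that some query evaluates
`KDF` at `xR` (`h4`). -/
theorem phasesValue_ideal_le (pub : Bool) (d b h : ZMod P.N) (r : Fin P.k → (ZMod P.N)ˣ)
    (β : Bool) (φ : Bits o → ℝ≥0∞) (hφ : ∀ y, φ y ≤ 1) :
    phasesValue T pub d b h r (idealSampler (h * b + d))
        (fun hk => encWith (idealSampler (h * b + d)) hk.2) β A₁ A₂ φ ≤
      freshValue A₁ A₂ T pub d b h r β (fun _ => φ) +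
        (A₁.queries + A₂.queries : ℕ) * hitBound (h * b + d) +
        ((kdfPairs A₁ A₂).map fun B => freshValue B.1 B.2 T pub d b h r β fun R y =>
          if y = P.encode (P.smul (h * b + d) R) then 1 else 0).sum := by
  set x := h * b + d with hx
  have horacles (ψ : P.Hash × P.Kdf → ℝ≥0∞) : (initialState T b h).oracles.expect ψ =
      (PMF.uniformOfFintype P.Hash).expect fun f => (PMF.uniformOfFintype P.Kdf).expect fun g =>
        ψ ((initialState T b h).1.override f, g) := by
    simp only [LazyState.oracles, PMF.expect_bind, PMF.expect_map]
    simp only [initialState, AssocTable.override_empty]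
  have h1 : phasesValue T pub d b h r (idealSampler x)
        (fun hk => encWith (idealSampler x) hk.2) β A₁ A₂ φ =
      (PMF.uniformOfFintype P.Hash).expect fun f =>
      (PMF.uniformOfFintype P.G).expect fun R =>
      (PMF.uniformOfFintype (Bits P.encKeyLen × Bits P.macKeyLen)).expect fun K =>
      (PMF.uniformOfFintype P.Kdf).expect fun g =>
        (phases (oraclesWith (idealSampler x) ((initialState T b h).1.override f,
          Function.update g (P.encode (P.smul x R)) K)) (P.pkBits pub (keysOf d b h r))
          (fun m => sealWith K m R) β A₁ A₂).expect φ := by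
    rw [phasesValue, horacles]
    refine congrArg _ (funext fun f => ?_)
    have h2 (g : P.Kdf) : (phases (oraclesWith (idealSampler x)
          ((initialState T b h).1.override f, g)) (P.pkBits pub (keysOf d b h r))
          (encWith (idealSampler x) g) β A₁ A₂).expect φ =
        (PMF.uniformOfFintype P.G).expect fun R => (phases (oraclesWith (idealSampler x)
          ((initialState T b h).1.override f, g)) (P.pkBits pub (keysOf d b h r))
          (fun m => sealWith (g (P.encode (P.smul x R))) m R) β A₁ A₂).expect φ := by
      rw [← expect_phases_bind]
      congr 2
      funext m
      rw [encWith, idealSampler, PMF.bind_map]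
      rfl
    simp only [h2]
    rw [PMF.expect_comm]
    refine congrArg _ (funext fun R => ?_)
    rw [PMF.expect_uniform_update (P.encode (P.smul x R))]
    simp only [Function.update_self]
  have h3 (o' : ℕ) (B₁ : Circuit P.cpaInterface (P.msgLen + P.msgLen + st) P.pkLen)
      (B₂ : Circuit P.cpaInterface o' (P.pkLen + st + P.cipherLen)) (ψ : P.G → Bits o' → ℝ≥0∞) :
      freshValue B₁ B₂ T pub d b h r β ψ =
      (PMF.uniformOfFintype P.Hash).expect fun f =>
      (PMF.uniformOfFintype P.G).expect fun R =>
      (PMF.uniformOfFintype (Bits P.encKeyLen × Bits P.macKeyLen)).expect fun K =>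
      (PMF.uniformOfFintype P.Kdf).expect fun g =>
        (phases (oraclesWith (idealSampler x) ((initialState T b h).1.override f, g))
          (P.pkBits pub (keysOf d b h r)) (fun m => sealWith K m R) β B₁ B₂).expect (ψ R) := by
    simp only [freshValue, phasesValue, horacles]
    conv_lhs =>
      enter [2, R]
      rw [PMF.expect_comm]
    rw [PMF.expect_comm]
  rw [h1, h3]
  simp only [h3]
  have h4 (f : P.Hash) (R : P.G) (K : Bits P.encKeyLen × Bits P.macKeyLen) (g : P.Kdf) :=
    close_phases A₁ A₂ (oraclesWith_close x R ((initialState T b h).1.override f) g K)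
      (P.pkBits pub (keysOf d b h r)) (fun m => sealWith K m R) β (δ := hitBound x)
      (z := P.encode (P.smul x R)) (fun _ => le_rfl) (fun _ => rfl) (fun _ => le_rfl) φ hφ
  refine (PMF.expect_mono _ fun f => PMF.expect_mono _ fun R => PMF.expect_mono _ fun K =>
    PMF.expect_mono _ fun g => h4 f R K g).trans (le_of_eq ?_)
  simp only [PMF.apply_eq_expect, PMF.expect_add, PMF.expect_const, PMF.expect_list_sum]
  ring

end Phases

end ECIESInstance

namespace ECIESInstance

variable {P : ECIESInstance} {T : ℕ}

/-- The oracles of a circuit without oracles. -/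
noncomputable def noOracles : Unit → OracleInterface.none.Oracles := fun _ q => Empty.elim q

theorem nat_size_pos (P : ECIESInstance) : 1 ≤ Nat.size P.N :=
  Nat.size_pos.2 P.prime.out.pos

/-! ### The reduction to the Diffie–Hellman problem -/

theorem CDHHard.expect_le {t : ℕ} {ε : ℝ} (hC : P.CDHHard t ε) {ι : Type} (q : PMF ι)
    (C : ι → Alg (P.pointLen + P.pointLen) P.pointLen) (ht : ∀ i, (C i).size ≤ t) :
    (q.expect fun i => P.cdhExperiment (C i) true) ≤ ENNReal.ofReal ε := by
  refine PMF.expect_le_const _ fun i => ?_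
  rw [← ENNReal.ofReal_toReal (PMF.apply_ne_top (P.cdhExperiment (C i)) true)]
  exact ENNReal.ofReal_le_ofReal (hC (C i) (ht i))

/-- Drawing `R = ρG` with known `ρ` yields `aR = ρ(aG)` from the point `aG` alone, so encryption
queries can be answered without the private key. -/
theorem idealSampler_eq (a : ZMod P.N) :
    idealSampler a = (PMF.uniformOfFintype (ZMod P.N)).map
      fun ρ => (P.smul ρ P.g, P.smul ρ (P.smul a P.g)) := by
  rw [idealSampler, ← uniform_map_smul, PMF.map_comp]
  congr 1
  funext ρ
  simp only [Function.comp_apply, pairWith, ← mul_smul', mul_comm]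

/-- The private key is planted as the unknown `a`: `D = aG - hbG`, the table entries are `S'_i =
r_i(aG)`, and the second CDH input is the challenge point `R`. Since the challenge keys are fresh,
`aR` is never needed, and it is what the truncated adversary is tested for. The scalar `d = a - hb`
may vanish here; `expect_units_le` later restricts it to units. -/
theorem expect_freshValue_cdh_le {pub : Bool} {t' : ℕ} {ε : ℝ} (hC : P.CDHHard t' ε)
    (b h : ZMod P.N) (r : Fin P.k → (ZMod P.N)ˣ) (β : Bool) {st : ℕ}
    (A₁ : Circuit P.cpaInterface (P.msgLen + P.msgLen + st) P.pkLen)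
    (A₂ : Circuit P.cpaInterface P.pointLen (P.pkLen + st + P.cipherLen))
    (hT : 1 + A₁.queries + A₂.queries ≤ T)
    (ht : P.reductionCost T (A₁.size + A₂.size) + P.pointLen ≤ t') :
    ((PMF.uniformOfFintype (ZMod P.N)).expect fun a =>
      freshValue A₁ A₂ T pub (a - h * b) b h r β fun R y =>
        if y = P.encode (P.smul (h * b + (a - h * b)) R) then 1 else 0) ≤ ENNReal.ofReal ε := by
  classical
  let samp (p : P.G × P.G) : PMF (P.G × P.G) :=
    (PMF.uniformOfFintype (ZMod P.N)).map fun ρ => (P.smul ρ P.g, P.smul ρ p.1)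
  let rows (p : P.G × P.G) : Vect P.k ((ZMod P.N × P.G) × P.G) := fun i =>
    (((r i : ZMod P.N), P.smul (r i) P.g), P.smul (r i) p.1)
  let pk (p : P.G × P.G) : Bits P.pkLen :=
    pkData pub (P.smul b P.g) (p.1 + P.smul (-(h * b)) P.g) (rows p)
  let chal (K : Bits P.encKeyLen × Bits P.macKeyLen) (p : P.G × P.G) (m : Bits P.msgLen) :
      St (P.LazyState T) P.CipherTuple := fun s => (sealWith K m p.2).map fun C => (C, s)
  let F (p : P.G × P.G) : PMF (Bits P.pointLen) :=
    (PMF.uniformOfFintype (Bits P.encKeyLen × Bits P.macKeyLen)).bind fun K =>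
      (stPhases (samp p) (pk p) (chal K p) β A₁ A₂ (initialState T b h)).map Prod.fst
  have hpk (a : ZMod P.N) (R : P.G) :
      pk (P.smul a P.g, R) = P.pkBits pub (keysOf (a - h * b) b h r) := by
    rw [pkBits_eq]
    have h1 : P.smul a P.g + P.smul (-(h * b)) P.g = P.smul (a - h * b) P.g := by
      rw [← add_smul', sub_eq_add_neg]
    simp only [pk, h1]
    congr 1
    funext i
    rw [keysOf_S, add_sub_cancel, ← mul_smul', mul_comm a, mul_smul']
    rfl
  have hF (a : ZMod P.N) (φ : P.G → Bits P.pointLen → ℝ≥0∞) :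
      freshValue A₁ A₂ T pub (a - h * b) b h r β φ =
        (PMF.uniformOfFintype P.G).expect fun R => (F (P.smul a P.g, R)).expect (φ R) := by
    simp only [freshValue, F, PMF.expect_bind, phasesValue, add_sub_cancel]
    refine congrArg _ (funext fun R => congrArg _ (funext fun K => ?_))
    rw [PMF.expect_map, hpk]
    have h1 : samp (P.smul a P.g, R) = idealSampler a := (idealSampler_eq a).symm
    rw [h1]
    exact (simulates_stPhases (T := T) (idealSampler a) (P.pkBits pub (keysOf (a - h * b) b h r))
      (fun m => Simulates.const (sealWith K m R)) β A₁ A₂).expect_eq (initialState T b h)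
      (by rw [size_initialState]; omega) (φ R)
  -- Leaves room for the constant part of the output gate, of size `pointLen + 1`.
  obtain ⟨n, hn⟩ : ∃ n, P.reductionCost T (A₁.size + A₂.size) = n + 2 :=
    Nat.exists_eq_add_of_le' (by unfold reductionCost; nlinarith)
  have hcomp : Computes noOracles n
      fun _ (p : P.G × P.G) => F p := by
    have hs : Computes noOracles
        (P.pointLen + Nat.size P.N * (2 * P.addAlg.size + 20) + 20)
        fun _ (p : P.G × P.G) => samp p := by
      have hρ (ρ : ZMod P.N) : ComputesFun noOracles
          (P.pointLen + Nat.size P.N * (2 * P.addAlg.size + 20) + 20)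
          fun p : P.G × P.G => (P.smul ρ P.g, P.smul ρ p.1) :=
        Computes.mono (ComputesFun.prodMk (Computes.wiring (Wiring.const (P.smul ρ P.g)))
          (ComputesFun.comp (computesFun_smul ρ) (Computes.wiring
            (f := fun p : P.G × P.G => p.1) (by fun_prop)))) (by omega)
      exact Computes.mix (PMF.uniformOfFintype (ZMod P.N)) hρ
    have hD : ComputesFun noOracles (P.addAlg.size + 10)
        fun p : P.G × P.G => p.1 + P.smul (-(h * b)) P.g :=
      Computes.mono (ComputesFun.comp computesFun_add (Computes.wiring
        (f := fun p : P.G × P.G => (p.1, P.smul (-(h * b)) P.g)) (by fun_prop))) (by omega)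
    have hrow (i : Fin P.k) : ComputesFun noOracles
        (Nat.size P.N * (2 * P.addAlg.size + 20) + 16) fun p : P.G × P.G =>
          (((r i : ZMod P.N), P.smul (r i) P.g), P.smul (r i) p.1) :=
      Computes.mono (ComputesFun.prodMk
        (Computes.wiring (Wiring.const ((r i : ZMod P.N), P.smul (r i) P.g)))
        (ComputesFun.comp (computesFun_smul (P := P) (r i : ZMod P.N)) (Computes.wiring
          (f := fun p : P.G × P.G => p.1) (by fun_prop)))) (by omega)
    have hpk := computesFun_pkData (pub := pub) (U := P.smul b P.g) hD fun _ =>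
      ComputesFun.vect (f := rows) hrow
    have hchal (K : Bits P.encKeyLen × Bits P.macKeyLen) :
        Computes noOracles (P.symEnc.size + P.mac.size + 20)
          fun _ (q : ((P.G × P.G) × Bits P.msgLen) × P.LazyState T) =>
            chal K q.1.1 q.1.2 q.2 := by
      refine Computes.mono (Computes.mapWiring (Computes.comp computes_sealWith
        (f := fun q : ((P.G × P.G) × Bits P.msgLen) × P.LazyState T => ((K, q.1.2), q.1.1.2))
        (by fun_prop)) (g := fun u => (u.2, u.1.2)) (by fun_prop)) (by omega)
    refine Computes.mono (Computes.mix _ fun K => computes_stPhases (T := T) hs hpk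
      (chal := fun _ => chal K) (hchal K) β A₁ A₂ (initialState T b h)) ?_
    have hsize := P.stEncSize_le T (P.pointLen + Nat.size P.N * (2 * P.addAlg.size + 20) + 20)
    have hk : Nat.size P.N * (2 * P.addAlg.size + 20) + 20 ≤
      P.querySize T (P.pointLen + Nat.size P.N * (2 * P.addAlg.size + 20) + 20) := by omega
    have hadd := Nat.mul_le_mul_right (2 * P.addAlg.size + 20) P.nat_size_pos
    unfold reductionCost at hn
    generalize P.querySize T (P.pointLen + Nat.size P.N * (2 * P.addAlg.size + 20) + 20) = Q at *
    have hk' := Nat.mul_le_mul_left P.k hk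
    have hexp : (P.k + (A₁.size + A₂.size) + 2) * (Q + 100) =
      P.k * Q + P.k * 100 + (A₁.size + A₂.size) * (Q + 5) + (A₁.size + A₂.size) * 95 + 2 * Q +
        200 := by ring
    have hrows : P.k * (Nat.size P.N * (2 * P.addAlg.size + 20) + 16 + 4) =
      P.k * (Nat.size P.N * (2 * P.addAlg.size + 20) + 20) := rfl
    omega
  obtain ⟨ι, q, C, hCs, hq⟩ := hcomp
  have hle := hC.expect_le q C fun i => (hCs i).trans (by
    change n + (P.pointLen + 1) ≤ _
    omega)
  refine le_trans (le_of_eq ?_) hle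
  have hexp (i : ι) : P.cdhExperiment (C i) true =
      (PMF.uniformOfFintype (ZMod P.N)).expect fun a =>
      (PMF.uniformOfFintype (ZMod P.N)).expect fun b' =>
        ((C i).run (noOracles ()) (code (P.smul a P.g, P.smul b' P.g))).expect fun y =>
          if y = P.encode (P.smul a (P.smul b' P.g)) then 1 else 0 := by
    rw [PMF.apply_eq_expect]
    simp only [cdhExperiment, PMF.expect_bind, PMF.expect_pure, decide_eq_true_eq, mul_smul']
    rfl
  simp only [hexp]
  rw [PMF.expect_comm]
  refine congrArg _ (funext fun a => ?_)
  rw [hF, ← uniform_map_smul, PMF.expect_map, PMF.expect_comm]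
  refine congrArg _ (funext fun b' => ?_)
  have h1 := congrArg (fun ρ => PMF.expect ρ fun y =>
    if y = P.encode (P.smul a (P.smul b' P.g)) then 1 else 0) (hq () (P.smul a P.g, P.smul b' P.g))
  simp only [PMF.expect_bind, PMF.expect_map] at h1
  rw [add_sub_cancel]
  exact h1.symm

/-! ### The reduction to the symmetric scheme -/

/-- The two mixtures are independent of the key and of each other, so the value is an average over
pairs of circuits. Each pair is an admissible adversary, whose state string is the code of an
element of `σ`. -/
theorem SymIND.expect_le {t' s s' : ℕ} {ε : ℝ} (hS : P.SymIND t' ε) {σ : Type} [Coded σ]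
    {F₁ : PMF ((Bits P.msgLen × Bits P.msgLen) × σ)} {F₂ : σ × Bits P.ctLen → PMF (Bits 1)}
    (h₁ : Computes noOracles s fun _ (_ : Unit) => F₁)
    (h₂ : Computes noOracles s' fun _ p => F₂ p)
    (ht : s + s' + 2 * P.msgLen + len σ + 3 ≤ t') :
    ((PMF.uniformOfFintype (Bits P.encKeyLen)).expect fun ke => F₁.expect fun y =>
      (PMF.uniformOfFintype Bool).expect fun β =>
        (P.symEnc.eval (Fin.append ke (if β then y.1.2 else y.1.1))).expect fun c =>
          (F₂ (y.2, c)).expect (guessed β)) ≤ ENNReal.ofReal (1 / 2 + ε) := by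
  obtain ⟨ι, q, C, hC, hq⟩ := h₁
  obtain ⟨κ, q', C', hC', hq'⟩ := h₂
  let adv (i : ι) (j : κ) : P.SymAdversary :=
    { stLen := len σ, choose := C i, guess := C' j }
  have hadv (i : ι) (j : κ) : P.symExperiment (adv i j) true ≤ ENNReal.ofReal (1 / 2 + ε) := by
    rw [← ENNReal.ofReal_toReal (PMF.apply_ne_top (P.symExperiment (adv i j)) true)]
    refine ENNReal.ofReal_le_ofReal (hS (adv i j) ?_)
    have h1 := hC i
    have h2 := hC' j
    change (C i).size + (C' j).size ≤ t'
    change _ ≤ _ + (P.msgLen + P.msgLen + len σ + 1) at h1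
    change _ ≤ _ + (1 + 1) at h2
    omega
  refine le_trans (le_of_eq ?_) (PMF.expect_le_const q fun i =>
    PMF.expect_le_const q' fun j => hadv i j)
  have hexp (i : ι) (j : κ) : P.symExperiment (adv i j) true =
      (PMF.uniformOfFintype (Bits P.encKeyLen)).expect fun ke =>
      ((C i).run (noOracles ()) (code ())).expect fun y =>
      (PMF.uniformOfFintype Bool).expect fun β =>
      (P.symEnc.eval (Fin.append ke (if β then
        (fun k => y (Fin.castAdd _ (Fin.natAdd P.msgLen k)) : Bits P.msgLen) else
        (fun k => y (Fin.castAdd _ (Fin.castAdd P.msgLen k)))))).expect fun c =>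
      ((C' j).run (noOracles ()) (Fin.append (fun k => y (Fin.natAdd (P.msgLen + P.msgLen) k))
        c)).expect (guessed β) := by
    rw [PMF.apply_eq_expect]
    simp only [symExperiment, PMF.expect_bind, PMF.expect_pure, beq_iff_eq]
    rfl
  have hF₁' (φ : Bits (P.msgLen + P.msgLen + len σ) → ℝ≥0∞) :
      (F₁.expect fun y => φ (code y)) =
        q.expect fun i => ((C i).run (noOracles ()) (code ())).expect φ := by
    have := congrArg (fun ρ => PMF.expect ρ φ) (hq () ())
    simp only [PMF.expect_bind, PMF.expect_map] at this
    exact this.symm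
  have hF₂' (p : σ × Bits P.ctLen) (φ : Bits 1 → ℝ≥0∞) :
      (F₂ p).expect φ =
        q'.expect fun j => ((C' j).run (noOracles ()) (code p)).expect φ := by
    have := congrArg (fun ρ => PMF.expect ρ φ) (hq' () p)
    simp only [PMF.expect_bind, PMF.expect_map] at this
    exact this.symm
  have hmsg (y : (Bits P.msgLen × Bits P.msgLen) × σ) :
      (fun k => (code y : Bits (P.msgLen + P.msgLen + len σ))
        (Fin.castAdd _ (Fin.castAdd P.msgLen k))) = y.1.1 ∧
      (fun k => (code y : Bits (P.msgLen + P.msgLen + len σ))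
        (Fin.castAdd _ (Fin.natAdd P.msgLen k))) = y.1.2 ∧
      (fun k => (code y : Bits (P.msgLen + P.msgLen + len σ))
        (Fin.natAdd (P.msgLen + P.msgLen) k)) = code y.2 := by
    refine ⟨funext fun k => ?_, funext fun k => ?_, funext fun k => ?_⟩
    · exact (Fin.append_left (code y.1) (code y.2) _).trans (Fin.append_left y.1.1 y.1.2 _)
    · exact (Fin.append_left (code y.1) (code y.2) _).trans (Fin.append_right y.1.1 y.1.2 _)
    · exact Fin.append_right (code y.1) (code y.2) _
  simp only [hexp, hF₂']
  symm
  -- The index `j` of the guessing circuit moves inwards and the key outwards, until each mixture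
  -- stands next to the run of its own circuit.
  conv_lhs =>
    enter [2, i]
    rw [PMF.expect_comm]
    enter [2, ke]
    rw [PMF.expect_comm]
    enter [2, y]
    rw [PMF.expect_comm]
    enter [2, β]
    rw [PMF.expect_comm]
  rw [PMF.expect_comm]
  refine congrArg _ (funext fun ke => ?_)
  refine (hF₁' (fun y => (PMF.uniformOfFintype Bool).expect fun β =>
      (P.symEnc.eval (Fin.append ke (if β then
        (fun k => y (Fin.castAdd _ (Fin.natAdd P.msgLen k)) : Bits P.msgLen) else
        (fun k => y (Fin.castAdd _ (Fin.castAdd P.msgLen k)))))).expect fun c =>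
      q'.expect fun j => ((C' j).run (noOracles ())
        (Fin.append (fun k => y (Fin.natAdd (P.msgLen + P.msgLen) k)) c)).expect
          (guessed β))).symm.trans ?_
  refine congrArg _ (funext fun y => ?_)
  obtain ⟨h0, h1, h2⟩ := hmsg y
  have hy (m₀ m₁ : Bits P.msgLen) (u : Bits (len σ)) (h₀ : m₀ = y.1.1)
      (h₁ : m₁ = y.1.2) (hu : u = code y.2) :
      ((PMF.uniformOfFintype Bool).expect fun β =>
        (P.symEnc.eval (Fin.append ke (if β then m₁ else m₀))).expect fun c =>
        q'.expect fun j => ((C' j).run (noOracles ()) (Fin.append u c)).expect (guessed β)) =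
      (PMF.uniformOfFintype Bool).expect fun β =>
        (P.symEnc.eval (Fin.append ke (if β then y.1.2 else y.1.1))).expect fun c =>
        q'.expect fun j => ((C' j).run (noOracles ()) (code (y.2, c))).expect (guessed β) := by
    subst h₀ h₁ hu
    rfl
  exact hy _ _ _ h0 h1 h2

/-- Only the encryption key is unknown to the reduction; the scalars, the table, `R` and the MAC key
are fixed and hard-wired. The lazily filled tables must survive the challenge, so they are part of
the state, whence `len (P.LazyState T)`. The fresh challenge uses no table entry, so the capacity
needs only `1 +` the number of queries. -/
theorem expect_freshValue_guessed_le {pub : Bool} {t' : ℕ} {ε : ℝ} (hS : P.SymIND t' ε)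
    (d b h : ZMod P.N) (r : Fin P.k → (ZMod P.N)ˣ) {st : ℕ}
    (A₁ : Circuit P.cpaInterface (P.msgLen + P.msgLen + st) P.pkLen)
    (A₂ : Circuit P.cpaInterface 1 (P.pkLen + st + P.cipherLen))
    (hT : 1 + A₁.queries + A₂.queries ≤ T)
    (ht : P.reductionCost T (A₁.size + A₂.size) + 2 * P.msgLen + st +
      len (P.LazyState T) ≤ t') :
    ((PMF.uniformOfFintype Bool).expect fun β =>
      freshValue A₁ A₂ T pub d b h r β fun _ => guessed β) ≤ ENNReal.ofReal (1 / 2 + ε) := by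
  let samp : PMF (P.G × P.G) := idealSampler (h * b + d)
  let pk : Bits P.pkLen := P.pkBits pub (keysOf d b h r)
  let F₁ : PMF ((Bits P.msgLen × Bits P.msgLen) × (Bits st × P.LazyState T)) :=
    (A₁.runSt (stOracles samp) pk (initialState T b h)).map fun p =>
      ((chosenMsg false p.1, chosenMsg true p.1), (chosenState (P := P) p.1, p.2))
  let F₂ (km : Bits P.macKeyLen) (R : P.G) (p : (Bits st × P.LazyState T) × Bits P.ctLen) :
      PMF (Bits 1) :=
    (P.mac.eval (Fin.append km p.2)).bind fun d =>
      (A₂.runSt (stOracles samp) (Fin.append (Fin.append pk p.1.1) (code ((p.2, d), R))) p.1.2).map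
        Prod.fst
  -- Here `x` is fixed, so the pairs `(R, xR)` follow a fixed law and are drawn as advice.
  have hsamp : Computes noOracles 2 fun _ (_ : Unit) => samp := Computes.sample samp
  have hF₁ : Computes noOracles (A₁.size * (P.querySize T 2 + 5) + 4) fun _ (_ : Unit) => F₁ := by
    have h1 := Computes.comp (Computes.runSt (S := fun _ (_ : Unit) => stOracles samp)
      (computes_stOracles (T := T) (samp := fun (_ _ : Unit) => samp) hsamp) A₁)
      (f := fun u : Unit => ((u, pk), initialState T b h)) (by fun_prop)
    refine Computes.mono (Computes.mapWiring h1 (g := fun q =>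
      ((chosenMsg false q.2.1, chosenMsg true q.2.1), (chosenState (P := P) q.2.1, q.2.2))) ?_)
      (by omega)
    exact Wiring.prodMk (Wiring.prodMk (Wiring.comp (wiring_chosenMsg _) (by fun_prop))
      (Wiring.comp (wiring_chosenMsg _) (by fun_prop)))
      (Wiring.prodMk (Wiring.comp wiring_chosenState (by fun_prop)) (by fun_prop))
  have hF₂ (km : Bits P.macKeyLen) (R : P.G) : Computes noOracles
      (A₂.size * (P.querySize T 2 + 5) + P.mac.size + 10) fun _ p => F₂ km R p := by
    have h0 := Computes.comp (computes_mac (orc := noOracles) (P := P))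
      (f := fun p : (Bits st × P.LazyState T) × Bits P.ctLen => (km, p.2)) (by fun_prop)
    have h1 := Computes.comp (Computes.runSt (S := fun _ (_ : Unit) => stOracles samp)
      (computes_stOracles (T := T) (samp := fun (_ _ : Unit) => samp) hsamp) A₂)
      (f := fun p : ((Bits st × P.LazyState T) × Bits P.ctLen) × Bits P.tagLen =>
        (((), (Fin.append (Fin.append pk p.1.1.1) (code ((p.1.2, p.2), R)) :
          Bits (P.pkLen + st + P.cipherLen))), p.1.1.2))
      (Wiring.prodMk (Wiring.prodMk (by fun_prop) (Wiring.append (Wiring.append (Wiring.const pk)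
        (by fun_prop)) (Wiring.code (f := fun p : ((Bits st × P.LazyState T) × Bits P.ctLen) ×
          Bits P.tagLen => ((p.1.2, p.2), R)) (by fun_prop)))) (by fun_prop))
    have h2 := Computes.mapWiring h1 (g := fun q => q.2.1) (by fun_prop)
    exact Computes.mono (Computes.bind h0 h2) (by omega)
  have hmono : P.querySize T 2 + P.mac.size ≤ 2 *
      P.querySize T (P.pointLen + Nat.size P.N * (2 * P.addAlg.size + 20) + 20) := by
    unfold querySize
    omega
  have hmono' : P.querySize T 2 ≤
      P.querySize T (P.pointLen + Nat.size P.N * (2 * P.addAlg.size + 20) + 20) := by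
    unfold querySize
    omega
  unfold reductionCost at ht
  generalize P.querySize T (P.pointLen + Nat.size P.N * (2 * P.addAlg.size + 20) + 20) = Q at *
  have hexp : (P.k + (A₁.size + A₂.size) + 2) * (Q + 100) =
    P.k * (Q + 100) + A₁.size * (Q + 5) + A₂.size * (Q + 5) + (A₁.size + A₂.size) * 95 + 2 * Q +
      200 := by ring
  have h3 := Nat.mul_le_mul_left A₁.size (Nat.add_le_add_right hmono' 5)
  have h4 := Nat.mul_le_mul_left A₂.size (Nat.add_le_add_right hmono' 5)
  have hval : ((PMF.uniformOfFintype Bool).expect fun β =>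
      freshValue A₁ A₂ T pub d b h r β fun _ => guessed β) =
    (PMF.uniformOfFintype P.G).expect fun R => (PMF.uniformOfFintype (Bits P.macKeyLen)).expect
      fun km => (PMF.uniformOfFintype (Bits P.encKeyLen)).expect fun ke => F₁.expect fun y =>
        (PMF.uniformOfFintype Bool).expect fun β =>
          (P.symEnc.eval (Fin.append ke (if β then y.1.2 else y.1.1))).expect fun c =>
            (F₂ km R (y.2, c)).expect (guessed β) := by
    have hβ (β : Bool) : freshValue A₁ A₂ T pub d b h r β (fun _ => guessed β) =
        (PMF.uniformOfFintype P.G).expect fun R =>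
        (PMF.uniformOfFintype (Bits P.macKeyLen)).expect fun km =>
        (PMF.uniformOfFintype (Bits P.encKeyLen)).expect fun ke => F₁.expect fun y =>
          (P.symEnc.eval (Fin.append ke (if β then y.1.2 else y.1.1))).expect fun c =>
            (F₂ km R (y.2, c)).expect (guessed β) := by
      simp only [freshValue, phasesValue]
      refine congrArg _ (funext fun R => ?_)
      rw [PMF.expect_uniformOfFintype_prod, PMF.expect_comm]
      refine congrArg _ (funext fun km => congrArg _ (funext fun ke => ?_))
      refine ((simulates_stPhases (T := T) samp pk
        (fun m => Simulates.const (sealWith (ke, km) m R)) β A₁ A₂).expect_eq (initialState T b h)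
        (by rw [size_initialState]; omega) (guessed β)).trans ?_
      simp only [stPhases, sealWith, F₁, F₂, PMF.expect_bind, PMF.expect_map]
      refine congrArg _ (funext fun y => ?_)
      cases β <;> rfl
    simp only [hβ]
    rw [PMF.expect_comm]
    refine congrArg _ (funext fun R => ?_)
    rw [PMF.expect_comm]
    refine congrArg _ (funext fun km => ?_)
    rw [PMF.expect_comm]
    refine congrArg _ (funext fun ke => ?_)
    rw [PMF.expect_comm]
  rw [hval]
  exact PMF.expect_le_const _ fun R => PMF.expect_le_const _ fun km =>
    hS.expect_le hF₁ (hF₂ km R) (by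
      change _ + _ + _ + (st + len (P.LazyState T)) + 3 ≤ t'
      omega)

end ECIESInstance

namespace ECIESInstance

variable {P : ECIESInstance} {T : ℕ}

/-! ### Lower bounds on the error terms -/

/-- The constant answer `0` is correct whenever `a = 0`. This makes `ε₁` positive and lets CDH
hardness control the `1/N` terms. -/
theorem CDHHard.inv_le {t : ℕ} {ε : ℝ} (hC : P.CDHHard t ε) (ht : P.pointLen + 3 ≤ t) :
    (1 : ℝ) / P.N ≤ ε := by
  classical
  obtain ⟨ι, q, C, hCs, hq⟩ := Computes.wiring (orc := noOracles)
    (Wiring.const (α := P.G × P.G) (0 : P.G))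
  have hle := hC.expect_le q C fun i => (hCs i).trans (by
    change 2 + (P.pointLen + 1) ≤ _
    omega)
  have hexp (i : ι) : P.cdhExperiment (C i) true =
      (PMF.uniformOfFintype (ZMod P.N)).expect fun a =>
      (PMF.uniformOfFintype (ZMod P.N)).expect fun b' =>
        ((C i).run (noOracles ()) (code (P.smul a P.g, P.smul b' P.g))).expect fun y =>
          if y = P.encode (P.smul a (P.smul b' P.g)) then 1 else 0 := by
    rw [PMF.apply_eq_expect]
    simp only [cdhExperiment, PMF.expect_bind, PMF.expect_pure, decide_eq_true_eq, mul_smul']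
    rfl
  have h1 : ((P.N : ℝ≥0∞))⁻¹ ≤ ENNReal.ofReal ε := by
    refine le_trans ?_ hle
    simp only [hexp]
    rw [PMF.expect_comm]
    refine le_of_eq_of_le ((expect_ite_eq (0 : ZMod P.N)).trans (by rw [ZMod.card])).symm ?_
    refine PMF.expect_mono _ fun a => ?_
    rw [PMF.expect_comm]
    rw [← PMF.expect_const (PMF.uniformOfFintype (ZMod P.N)) (if a = 0 then 1 else 0)]
    refine PMF.expect_mono _ fun b' => ?_
    have h1 := congrArg (fun ρ => PMF.expect ρ fun y =>
      if y = P.encode (P.smul a (P.smul b' P.g)) then 1 else 0)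
      (hq () (P.smul a P.g, P.smul b' P.g))
    simp only [PMF.expect_bind, PMF.expect_map, PMF.expect_pure] at h1
    refine le_of_le_of_eq ?_ h1.symm
    by_cases ha : a = 0
    · subst ha
      rw [if_pos rfl, if_pos]
      rw [zero_smul']
      rfl
    · rw [if_neg ha]
      exact zero_le
  have hN := P.prime.out.pos
  rw [one_div]
  by_contra! hlt
  have h2 : ENNReal.ofReal ε < ENNReal.ofReal ((P.N : ℝ)⁻¹) :=
    (ENNReal.ofReal_lt_ofReal_iff (by positivity)).2 hlt
  rw [ENNReal.ofReal_inv_of_pos (by positivity), ENNReal.ofReal_natCast] at h2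
  exact absurd h1 (not_le.2 h2)

theorem BPVRandom.nonneg {pub : Bool} {t : ℕ} {ε : ℝ} (hB : P.BPVRandom pub t ε) (ht : 3 ≤ t) :
    0 ≤ ε :=
  (abs_nonneg _).trans (hB (.const false (.out fun _ => Fin.last _)) ht)

/-- A constant guess wins with probability exactly `1/2`. Nonnegativity is needed to enlarge the
coefficients of the error terms. -/
theorem SymIND.nonneg {t : ℕ} {ε : ℝ} (hS : P.SymIND t ε) (ht : 2 * P.msgLen + 5 ≤ t) :
    0 ≤ ε := by
  let A : P.SymAdversary :=
    { stLen := 0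
      choose := .const false (.out fun _ => Fin.last _)
      guess := .const false (.out fun _ => Fin.last _) }
  have h1 := hS A (by
    change P.msgLen + P.msgLen + 0 + 1 + 1 + (1 + 1 + 1) ≤ t
    omega)
  have h2 : P.symExperiment A true = 2⁻¹ := by
    rw [PMF.apply_eq_expect]
    simp only [symExperiment, A, PMF.expect_bind, PMF.expect_pure, beq_iff_eq, Alg.eval,
      Circuit.run]
    have h3 : ((PMF.uniformOfFintype Bool).expect fun a => if a = false then 1 else 0) = 2⁻¹ := by
      rw [PMF.expect_uniformOfFintype]
      simp
    simpa [Fin.append, Fin.addCases, eq_comm] using h3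
  rw [h2] at h1
  norm_num at h1
  linarith

/-! ### The winning probability of a chosen-plaintext adversary -/

/-- One `1/N` is the chance of a hit, and `2/N` bounds the chance that `x = hb + d` vanishes for a
random unit `d`. -/
theorem expect_hitBound_le (b h : ZMod P.N) :
    ((PMF.uniformOfFintype (ZMod P.N)ˣ).expect fun d => hitBound (h * b + (d : ZMod P.N))) ≤
      3 * (P.N : ℝ≥0∞)⁻¹ := by
  unfold hitBound
  rw [PMF.expect_add, PMF.expect_const]
  have h1 := P.expect_units_le (fun d => if h * b + d = 0 then 1 else 0) (h * b)
  simp only [add_sub_cancel] at h1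
  rw [expect_ite_eq, ZMod.card] at h1
  calc _ ≤ (P.N : ℝ≥0∞)⁻¹ + 2 * (P.N : ℝ≥0∞)⁻¹ := add_le_add le_rfl h1
    _ = _ := by ring

/-- The game steps are added up. The size `2 * A.size + P.pointLen + 1` is that of the truncated
adversaries in `kdfPairs`, the largest that have to be simulated. -/
theorem cpaExperiment_le {pub : Bool} {t' : ℕ} {ε₁ ε₂ ε₃ : ℝ} (hC : P.CDHHard t' ε₁)
    (hS : P.SymIND t' ε₂) (hB : P.BPVRandom pub t' ε₃) (A : P.CPAAdversary)
    (hT : 2 + A.choose.queries + A.guess.queries ≤ T)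
    (ht : P.reductionCost T (2 * A.size + P.pointLen + 1) + P.pointLen + 2 * P.msgLen + A.stLen +
      len (P.LazyState T) ≤ t') :
    P.cpaExperiment pub A true ≤ ENNReal.ofReal (1 / 2 + ε₂) + ENNReal.ofReal ε₃ +
      (A.choose.queries + A.guess.queries : ℕ) * (3 * (P.N : ℝ≥0∞)⁻¹) +
      (A.choose.queries + A.guess.queries : ℕ) * (2 * ENNReal.ofReal ε₁) := by
  have hmono {a : ℕ} (ha : a ≤ 2 * A.size + P.pointLen + 1) :
      P.reductionCost T a ≤ P.reductionCost T (2 * A.size + P.pointLen + 1) := by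
    unfold reductionCost
    gcongr
  have hA := hmono (a := A.choose.size + A.guess.size) (by unfold CPAAdversary.size; omega)
  rw [cpaExperiment_eq (T := T) (by omega)]
  have h1 (d b : (ZMod P.N)ˣ) (h : ZMod P.N) (β : Bool) :=
    (phasesValue_bpv_le hB d b h β A.choose A.guess hT (by omega)).trans
      (add_le_add (PMF.expect_mono _ fun r =>
        phasesValue_ideal_le A.choose A.guess (T := T) pub d b h r β
          (guessed β) (guessed_le_one β)) le_rfl)
  refine (PMF.expect_mono _ fun d => PMF.expect_mono _ fun b => PMF.expect_mono _ fun h =>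
    PMF.expect_mono _ fun β => h1 d b h β).trans ?_
  simp only [PMF.expect_add, PMF.expect_const, PMF.expect_mul_left, PMF.expect_list_sum]
  have hfresh : ((PMF.uniformOfFintype (ZMod P.N)ˣ).expect fun d =>
      (PMF.uniformOfFintype (ZMod P.N)ˣ).expect fun b =>
      (PMF.uniformOfFintype (ZMod P.N)).expect fun h =>
      (PMF.uniformOfFintype Bool).expect fun β =>
      (PMF.uniformOfFintype (Fin P.k → (ZMod P.N)ˣ)).expect fun r =>
        freshValue A.choose A.guess T pub d b h r β fun _ => guessed β) ≤
      ENNReal.ofReal (1 / 2 + ε₂) := by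
    refine PMF.expect_le_const _ fun d => PMF.expect_le_const _ fun b =>
      PMF.expect_le_const _ fun h => ?_
    rw [PMF.expect_comm]
    exact PMF.expect_le_const _ fun r =>
      expect_freshValue_guessed_le hS d b h r A.choose A.guess (by omega) (by omega)
  have hhit : ((PMF.uniformOfFintype (ZMod P.N)ˣ).expect fun d =>
      (PMF.uniformOfFintype (ZMod P.N)ˣ).expect fun b =>
      (PMF.uniformOfFintype (ZMod P.N)).expect fun h =>
        hitBound (h * (b : ZMod P.N) + (d : ZMod P.N))) ≤
      3 * (P.N : ℝ≥0∞)⁻¹ := by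
    rw [PMF.expect_comm]
    refine PMF.expect_le_const _ fun b => ?_
    rw [PMF.expect_comm]
    exact PMF.expect_le_const _ fun h => expect_hitBound_le b h
  have hpair (B : Circuit P.cpaInterface (P.msgLen + P.msgLen + A.stLen) P.pkLen ×
      Circuit P.cpaInterface P.pointLen (P.pkLen + A.stLen + P.cipherLen))
      (hB : B ∈ kdfPairs A.choose A.guess) : ((PMF.uniformOfFintype (ZMod P.N)ˣ).expect fun d =>
      (PMF.uniformOfFintype (ZMod P.N)ˣ).expect fun b =>
      (PMF.uniformOfFintype (ZMod P.N)).expect fun h =>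
      (PMF.uniformOfFintype Bool).expect fun β =>
      (PMF.uniformOfFintype (Fin P.k → (ZMod P.N)ˣ)).expect fun r =>
        freshValue B.1 B.2 T pub d b h r β fun R y =>
          if y = P.encode (P.smul (h * (b : ZMod P.N) + (d : ZMod P.N)) R) then 1 else 0) ≤
      2 * ENNReal.ofReal ε₁ := by
    have hq := queries_of_mem_kdfPairs A.choose A.guess B hB
    have hs := hmono (size_of_mem_kdfPairs A.choose A.guess B hB)
    rw [PMF.expect_comm]
    refine PMF.expect_le_const _ fun b => ?_
    rw [PMF.expect_comm]
    refine PMF.expect_le_const _ fun h => ?_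
    rw [PMF.expect_comm]
    refine PMF.expect_le_const _ fun β => ?_
    rw [PMF.expect_comm]
    refine PMF.expect_le_const _ fun r => ?_
    -- Passes from a unit `d` to `d = a - hb` with `a` uniform, the form in which the private key is
    -- a CDH input; this doubles `ε₁`.
    refine (P.expect_units_le (fun d => freshValue B.1 B.2 T pub d b h r β fun R y =>
      if y = P.encode (P.smul (h * (b : ZMod P.N) + d) R) then 1 else 0) (h * b)).trans ?_
    gcongr
    exact expect_freshValue_cdh_le hC b h r β B.1 B.2 (by omega) (by omega)
  have hsum := List.sum_le_card_nsmul ((kdfPairs A.choose A.guess).map fun B =>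
      (PMF.uniformOfFintype (ZMod P.N)ˣ).expect fun d =>
      (PMF.uniformOfFintype (ZMod P.N)ˣ).expect fun b =>
      (PMF.uniformOfFintype (ZMod P.N)).expect fun h =>
      (PMF.uniformOfFintype Bool).expect fun β =>
      (PMF.uniformOfFintype (Fin P.k → (ZMod P.N)ˣ)).expect fun r =>
        freshValue B.1 B.2 T pub d b h r β fun R y =>
          if y = P.encode (P.smul (h * (b : ZMod P.N) + (d : ZMod P.N)) R) then 1 else 0)
    (2 * ENNReal.ofReal ε₁) fun x hx => by
      obtain ⟨B, hB, rfl⟩ := List.mem_map.1 hx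
      exact hpair B hB
  rw [List.length_map, nsmul_eq_mul] at hsum
  have hlen : (((kdfPairs A.choose A.guess).length : ℕ) : ℝ≥0∞) * (2 * ENNReal.ofReal ε₁) ≤
      (A.choose.queries + A.guess.queries : ℕ) * (2 * ENNReal.ofReal ε₁) := by
    gcongr
    exact length_kdfPairs_le _ _
  have := add_le_add (add_le_add (add_le_add hfresh (mul_le_mul_right hhit
    ((A.choose.queries + A.guess.queries : ℕ) : ℝ≥0∞))) (hsum.trans hlen))
    (le_refl (ENNReal.ofReal ε₃))
  refine this.trans (le_of_eq ?_)
  ring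

/-! ### Concrete security -/

theorem reductionCost_le {M t : ℕ} (hs : P.size ≤ M) (ht : t ≤ 4 * M) :
    P.reductionCost M t ≤ 5000 * M ^ 3 := by
  have hN := P.nat_size_pos
  unfold size at hs
  have hq : P.querySize M (P.pointLen + Nat.size P.N * (2 * P.addAlg.size + 20) + 20) ≤
      400 * M ^ 2 := by
    have h1 : Nat.size P.N * (2 * P.addAlg.size + 20) ≤ M * (22 * M) := by
      gcongr <;> omega
    have h2 : M * (90 * P.idLen + 90 * P.pointLen + 60 * P.encKeyLen + 60 * P.macKeyLen +
        60 * Nat.size P.N + 50) ≤ M * (140 * M) := by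
      gcongr
      omega
    have h3 : M ≤ M ^ 2 := Nat.le_self_pow two_ne_zero M
    have h4 : P.querySize M (P.pointLen + Nat.size P.N * (2 * P.addAlg.size + 20) + 20) =
      P.pointLen + Nat.size P.N * (2 * P.addAlg.size + 20) + 20 +
      M * (90 * P.idLen + 90 * P.pointLen + 60 * P.encKeyLen + 60 * P.macKeyLen +
        60 * Nat.size P.N + 50) + P.symEnc.size + P.mac.size + 50 := by
      unfold querySize
      ring
    have h5 : M * (22 * M) = 22 * M ^ 2 := by ring
    have h6 : M * (140 * M) = 140 * M ^ 2 := by ring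
    omega
  unfold reductionCost
  calc _ ≤ (7 * M) * (500 * M ^ 2) := by
        gcongr
        · omega
        · have h3 : M ≤ M ^ 2 := Nat.le_self_pow two_ne_zero M
          omega
    _ ≤ _ := by ring_nf; omega

theorem len_lazyState_le {M : ℕ} (hs : P.size ≤ M) : len (P.LazyState M) ≤ 4 * M ^ 2 := by
  have hN := P.nat_size_pos
  unfold size at hs
  change M * (1 + ((P.idLen + P.pointLen) + Nat.size P.N)) +
    M * (1 + (P.pointLen + (P.encKeyLen + P.macKeyLen))) ≤ _
  calc _ ≤ M * (2 * M) + M * (2 * M) := by gcongr <;> omega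
    _ = _ := by ring

theorem indcpa_of_hard {pub : Bool} {t : ℕ} {ε₁ ε₂ ε₃ : ℝ}
    (hC : P.CDHHard ((10 * (t + P.size)) ^ 10) ε₁) (hS : P.SymIND ((10 * (t + P.size)) ^ 10) ε₂)
    (hB : P.BPVRandom pub ((10 * (t + P.size)) ^ 10) ε₃) :
    P.INDCPA pub t (10 * (t + P.size) * (ε₁ + ε₂ + ε₃ + 1 / P.N)) := fun A hA => by
  have hN := P.nat_size_pos
  have hM : P.size ≤ t + P.size := by omega
  have hpos : 1 ≤ t + P.size := by
    unfold size
    omega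
  have hk : P.pointLen + 2 * P.msgLen + 5 ≤ 7 * (t + P.size) := by
    unfold size
    omega
  have hpt : P.pointLen + 1 ≤ t + P.size := by
    unfold size
    omega
  -- The reductions cost at most `5000 M ^ 3` with `M = t + P.size`; the remaining `1000 M ^ 3`
  -- covers strings, states and lazy tables.
  have hlarge : 6000 * (t + P.size) ^ 3 ≤ (10 * (t + P.size)) ^ 10 := by
    rw [mul_pow]
    gcongr <;> norm_num
  have hlen := len_lazyState_le hM
  have hq₁ := A.choose.queries_lt_size
  have hq₂ := A.guess.queries_lt_size
  unfold CPAAdversary.size at hA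
  have hcost := reductionCost_le (t := 2 * A.size + P.pointLen + 1) hM (by
    unfold CPAAdversary.size
    omega)
  have hpow1 : t + P.size ≤ (t + P.size) ^ 3 := Nat.le_self_pow three_ne_zero _
  have hpow2 : (t + P.size) ^ 2 ≤ (t + P.size) ^ 3 := Nat.pow_le_pow_right hpos (by norm_num)
  have hε₁ := hC.inv_le (by omega)
  have hε₂ := hS.nonneg (by omega)
  have hε₃ := hB.nonneg (by omega)
  -- Each query costs at least one unit of size, so a capacity of `t + P.size` suffices for all
  -- queries and the two additional entries.
  have hle := cpaExperiment_le hC hS hB A (T := t + P.size) (by omega) (by omega)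
  have hNpos : (0 : ℝ) < P.N := by exact_mod_cast P.prime.out.pos
  have hNinv : (0 : ℝ) < 1 / P.N := by positivity
  set q : ℕ := A.choose.queries + A.guess.queries with hq
  have hqt : (q : ℝ) ≤ t := by
    exact_mod_cast (by omega : q ≤ t)
  have hreal : ENNReal.ofReal (1 / 2 + ε₂) + ENNReal.ofReal ε₃ + (q : ℝ≥0∞) * (3 * (P.N : ℝ≥0∞)⁻¹) +
      q * (2 * ENNReal.ofReal ε₁) =
      ENNReal.ofReal (1 / 2 + ε₂ + ε₃ + q * (3 * (1 / P.N)) + q * (2 * ε₁)) := by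
    have hε₁' : 0 ≤ ε₁ := hNinv.le.trans hε₁
    rw [ENNReal.ofReal_add (p := 1 / 2 + ε₂ + ε₃ + q * (3 * (1 / P.N))) (by positivity)
        (by positivity),
      ENNReal.ofReal_add (p := 1 / 2 + ε₂ + ε₃) (by positivity) (by positivity),
      ENNReal.ofReal_add (p := 1 / 2 + ε₂) (by positivity) hε₃, ENNReal.ofReal_mul (by positivity),
      ENNReal.ofReal_mul (by positivity), ENNReal.ofReal_mul (by positivity),
      ENNReal.ofReal_mul (by positivity), ENNReal.ofReal_natCast, one_div (P.N : ℝ),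
      ENNReal.ofReal_inv_of_pos hNpos, ENNReal.ofReal_natCast]
    norm_num
  rw [hreal] at hle
  have hε₁' : 0 ≤ ε₁ := hNinv.le.trans hε₁
  have h1 := ENNReal.toReal_mono ENNReal.ofReal_ne_top hle
  rw [ENNReal.toReal_ofReal (by positivity)] at h1
  refine h1.trans ?_
  have hone : (1 : ℝ) ≤ t + P.size := by exact_mod_cast hpos
  have hts : (t : ℝ) ≤ t + P.size := by simp
  have e2 := mul_le_mul_of_nonneg_right hone hε₂
  have e3 := mul_le_mul_of_nonneg_right hone hε₃
  have e1 := mul_le_mul_of_nonneg_right (hqt.trans hts) hε₁'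
  have e4 := mul_le_mul_of_nonneg_right (hqt.trans hts) hNinv.le
  nlinarith [mul_nonneg (zero_le_one.trans hone) hε₂, mul_nonneg (zero_le_one.trans hone) hε₃,
    mul_nonneg (zero_le_one.trans hone) hε₁', mul_nonneg (zero_le_one.trans hone) hNinv.le]

end ECIESInstance

/-! ### Collision probability and distance from uniform -/

namespace PMF

variable {α : Type*}

/-- The total variation of the difference of two distributions. -/
noncomputable def variation [Fintype α] (p q : PMF α) : ℝ≥0∞ :=
  ∑ a, ENNReal.ofReal |(p a).toReal - (q a).toReal|

theorem variation_comm [Fintype α] (p q : PMF α) : p.variation q = q.variation p := by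
  simp only [variation, abs_sub_comm]

theorem close_variation [Fintype α] (p q : PMF α) : p.Close q (p.variation q) := fun f hf => by
  simp only [expect, tsum_fintype, variation]
  rw [← Finset.sum_add_distrib]
  refine Finset.sum_le_sum fun a _ => ?_
  have h : p a ≤ q a + ENNReal.ofReal |(p a).toReal - (q a).toReal| := by
    rw [← ENNReal.ofReal_toReal (p.apply_ne_top a), ← ENNReal.ofReal_toReal (q.apply_ne_top a),
      ENNReal.toReal_ofReal ENNReal.toReal_nonneg, ENNReal.toReal_ofReal ENNReal.toReal_nonneg,
      ← ENNReal.ofReal_add ENNReal.toReal_nonneg (abs_nonneg _)]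
    refine ENNReal.ofReal_le_ofReal ?_
    linarith [le_abs_self ((p a).toReal - (q a).toReal)]
  calc p a * f a ≤ (q a + ENNReal.ofReal |(p a).toReal - (q a).toReal|) * f a := by gcongr
    _ = q a * f a + ENNReal.ofReal |(p a).toReal - (q a).toReal| * f a := add_mul _ _ _
    _ ≤ _ := add_le_add le_rfl (mul_le_of_le_one_right' (hf a))

theorem expect_uniform_ofReal {ι : Type*} [Fintype ι] [Nonempty ι] {f : ι → ℝ} (hf : ∀ i, 0 ≤ f i) :
    ((uniformOfFintype ι).expect fun i => ENNReal.ofReal (f i)) =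
      ENNReal.ofReal ((Fintype.card ι : ℝ)⁻¹ * ∑ i, f i) := by
  have hι : (0 : ℝ) < Fintype.card ι := by exact_mod_cast Fintype.card_pos
  rw [expect_uniformOfFintype, ENNReal.ofReal_mul (by positivity),
    ENNReal.ofReal_inv_of_pos hι, ENNReal.ofReal_natCast,
    ENNReal.ofReal_sum_of_nonneg fun i _ => hf i]

/-- Distributions with a small collision probability, on average, are close to uniform. -/
theorem expect_variation_uniform_le {ι : Type*} [Fintype ι] [Nonempty ι] [Fintype α] [Nonempty α]
    (P : ι → PMF α) {κ : ℝ} (hκ : 0 ≤ κ)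
    (h : ((uniformOfFintype ι).expect fun i => (P i).expect (P i)) ≤ ENNReal.ofReal κ) :
    ((uniformOfFintype ι).expect fun i => (P i).variation (uniformOfFintype α)) ≤
      ENNReal.ofReal (√(Fintype.card α * κ - 1)) := by
  set n : ℝ := (Fintype.card α : ℝ) with hn
  set m : ℝ := (Fintype.card ι : ℝ) with hm
  have hn0 : 0 < n := by
    rw [hn]
    exact_mod_cast Fintype.card_pos
  have hm0 : 0 < m := by
    rw [hm]
    exact_mod_cast Fintype.card_pos
  let x (i : ι) (a : α) : ℝ := (P i a).toReal
  have hx (i : ι) : ∑ a, x i a = 1 := by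
    have h1 : ∑ a, P i a = 1 := (tsum_fintype (P i)).symm.trans (P i).tsum_coe
    rw [← ENNReal.toReal_sum fun a _ => (P i).apply_ne_top a, h1, ENNReal.toReal_one]
  have hu (a : α) : (uniformOfFintype α a).toReal = n⁻¹ := by simp [hn]
  have hvar (i : ι) : (P i).variation (uniformOfFintype α) =
      ENNReal.ofReal (∑ a, |x i a - n⁻¹|) := by
    simp only [variation, hu]
    rw [ENNReal.ofReal_sum_of_nonneg fun a _ => abs_nonneg _]
  have hcoll (i : ι) : (P i).expect (P i) = ENNReal.ofReal (∑ a, x i a ^ 2) := by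
    rw [ENNReal.ofReal_sum_of_nonneg fun a _ => sq_nonneg _, expect, tsum_fintype]
    refine Finset.sum_congr rfl fun a _ => ?_
    rw [ENNReal.ofReal_pow ENNReal.toReal_nonneg, ENNReal.ofReal_toReal ((P i).apply_ne_top a), sq]
  simp only [hcoll] at h
  rw [expect_uniform_ofReal fun i => Finset.sum_nonneg fun a _ => sq_nonneg _,
    ENNReal.ofReal_le_ofReal_iff hκ] at h
  simp only [hvar]
  rw [expect_uniform_ofReal fun i => Finset.sum_nonneg fun a _ => abs_nonneg _]
  refine ENNReal.ofReal_le_ofReal (Real.le_sqrt_of_sq_le ?_)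
  -- The cross term simplifies because the probabilities sum to 1.
  have hsq (i : ι) : ∑ a, |x i a - n⁻¹| ^ 2 = ∑ a, x i a ^ 2 - n⁻¹ := by
    simp only [sq_abs, sub_sq, Finset.sum_add_distrib, Finset.sum_sub_distrib, ← Finset.sum_mul,
      ← Finset.mul_sum, hx, Finset.sum_const, Finset.card_univ, nsmul_eq_mul, ← hn]
    field_simp
    ring
  -- A single Cauchy–Schwarz over all pairs replaces one for each `i` followed by Jensen for the
  -- average.
  have hcs := sq_sum_le_card_mul_sum_sq (s := (Finset.univ : Finset (ι × α)))
    (f := fun p => |x p.1 p.2 - n⁻¹|)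
  simp only [Fintype.sum_prod_type, hsq, Finset.card_univ, Fintype.card_prod, Nat.cast_mul,
    Finset.sum_sub_distrib, Finset.sum_const, nsmul_eq_mul, ← hn, ← hm] at hcs
  calc (m⁻¹ * ∑ i, ∑ a, |x i a - n⁻¹|) ^ 2 = m⁻¹ ^ 2 * (∑ i, ∑ a, |x i a - n⁻¹|) ^ 2 := by ring
    _ ≤ m⁻¹ ^ 2 * (m * n * (∑ i, ∑ a, x i a ^ 2 - m * n⁻¹)) := by gcongr
    _ = n * (m⁻¹ * ∑ i, ∑ a, x i a ^ 2) - 1 := by field_simp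
    _ ≤ _ := by gcongr

theorem expect_ite_le_of_subsingleton [Fintype α] [Nonempty α] {s : α → Prop} [DecidablePred s]
    (hs : ∀ a b, s a → s b → a = b) :
    ((uniformOfFintype α).expect fun a => if s a then 1 else 0) ≤ (Fintype.card α : ℝ≥0∞)⁻¹ := by
  classical
  by_cases h : ∃ a, s a
  · obtain ⟨a, ha⟩ := h
    rw [← ECIESInstance.expect_ite_eq a]
    refine expect_mono _ fun b => ?_
    split_ifs with h1 h2
    · exact le_rfl
    · exact absurd (hs b a h1 ha) h2
    · exact zero_le
    · exact le_rfl
  · push Not at h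
    simp [h]

end PMF

/-! ### Collisions of subset sums and statistical randomness -/

namespace ECIESInstance

variable (P : ECIESInstance)

/-- Resample `r_i`, which occurs in only one of the two sums: for fixed other scalars at most one of
the `N - 1` values makes them equal. -/
theorem expect_collision_of_mem {J J' : Finset (Fin P.k)} {i : Fin P.k} (hi : i ∈ J)
    (hi' : i ∉ J') [DecidableEq P.G] :
    ((PMF.uniformOfFintype (Fin P.k → (ZMod P.N)ˣ)).expect fun r =>
      if ∑ j ∈ J, P.smul (r j) P.g = ∑ j ∈ J', P.smul (r j) P.g then 1 else 0) ≤
      (Fintype.card (ZMod P.N)ˣ : ℝ≥0∞)⁻¹ := by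
  rw [PMF.expect_uniform_update i, PMF.expect_comm]
  refine PMF.expect_le_const _ fun r => PMF.expect_ite_le_of_subsingleton fun y z hy hz => ?_
  have h1 (y : (ZMod P.N)ˣ) : ∑ j ∈ J, P.smul (Function.update r i y j) P.g =
      P.smul y P.g + ∑ j ∈ J.erase i, P.smul (r j) P.g := by
    rw [← Finset.add_sum_erase _ _ hi, Function.update_self]
    congr 1
    refine Finset.sum_congr rfl fun j hj => ?_
    rw [Function.update_of_ne (Finset.ne_of_mem_erase hj)]
  have h2 (y : (ZMod P.N)ˣ) : ∑ j ∈ J', P.smul (Function.update r i y j) P.g =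
      ∑ j ∈ J', P.smul (r j) P.g := by
    refine Finset.sum_congr rfl fun j hj => ?_
    rw [Function.update_of_ne]
    rintro rfl
    exact hi' hj
  rw [h1, h2] at hy hz
  exact Units.ext (P.smul_left_injective' (add_right_cancel (hy.trans hz.symm)))

theorem expect_collision_le {J J' : Finset (Fin P.k)} (h : J ≠ J') [DecidableEq P.G] :
    ((PMF.uniformOfFintype (Fin P.k → (ZMod P.N)ˣ)).expect fun r =>
      if ∑ j ∈ J, P.smul (r j) P.g = ∑ j ∈ J', P.smul (r j) P.g then 1 else 0) ≤
      (Fintype.card (ZMod P.N)ˣ : ℝ≥0∞)⁻¹ := by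
  by_cases hsub : J ⊆ J'
  · obtain ⟨i, hi, hi'⟩ := Finset.exists_of_ssubset (hsub.ssubset_of_ne h)
    simpa only [eq_comm] using P.expect_collision_of_mem hi hi'
  · obtain ⟨i, hi, hi'⟩ := Finset.not_subset.1 hsub
    exact P.expect_collision_of_mem hi hi'

theorem two_le_N : 2 ≤ P.N := P.prime.out.two_le

/-- Two independent subsets either coincide, with probability `1/binom(k,v)`, or differ at an index
to which `expect_collision_le` applies. -/
theorem expect_bpvOutput_collision_le :
    ((PMF.uniformOfFintype (Fin P.k → (ZMod P.N)ˣ)).expect fun r =>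
      (P.bpvOutput r).expect (P.bpvOutput r)) ≤
      ENNReal.ofReal (1 / (P.k.choose P.v : ℝ) + 1 / ((P.N : ℝ) - 1)) := by
  classical
  have h1 (r : Fin P.k → (ZMod P.N)ˣ) : (P.bpvOutput r).expect (P.bpvOutput r) =
      P.randomSubset.expect fun J => P.randomSubset.expect fun J' =>
        if ∑ j ∈ J', P.smul (r j) P.g = ∑ j ∈ J, P.smul (r j) P.g then 1 else 0 := by
    conv_lhs => enter [2, a]; rw [PMF.apply_eq_expect]
    simp only [bpvOutput, PMF.expect_map]
  have hC : (0 : ℝ) < P.k.choose P.v := by exact_mod_cast Nat.choose_pos P.v_lt_k.le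
  have hN : (2 : ℝ) ≤ P.N := by exact_mod_cast P.two_le_N
  simp only [h1]
  rw [PMF.expect_comm]
  refine PMF.expect_le_const _ fun J => ?_
  rw [PMF.expect_comm]
  have h2 (J' : Finset (Fin P.k)) : ((PMF.uniformOfFintype (Fin P.k → (ZMod P.N)ˣ)).expect fun r =>
      if ∑ j ∈ J', P.smul (r j) P.g = ∑ j ∈ J, P.smul (r j) P.g then 1 else 0) ≤
      (if J' = J then 1 else 0) + (Fintype.card (ZMod P.N)ˣ : ℝ≥0∞)⁻¹ := by
    by_cases h : J' = J
    · rw [if_pos h]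
      exact (PMF.expect_le_const _ fun r => by split_ifs <;> simp).trans le_self_add
    · rw [if_neg h, zero_add]
      exact P.expect_collision_le h
  refine (PMF.expect_mono _ h2).trans ?_
  rw [PMF.expect_add, PMF.expect_const, ← PMF.apply_eq_expect, ENNReal.ofReal_add (by positivity)
    (by rw [one_div, inv_nonneg]; linarith)]
  refine add_le_add ?_ (le_of_eq ?_)
  · rw [one_div, ENNReal.ofReal_inv_of_pos hC, ENNReal.ofReal_natCast, randomSubset,
      PMF.uniformOfFinset_apply]
    split_ifs
    · simp
    · exact zero_le
  · rw [one_div, ENNReal.ofReal_inv_of_pos (by linarith), ZMod.card_units,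
      ← ENNReal.ofReal_natCast, Nat.cast_sub (by have := P.two_le_N; omega), Nat.cast_one]

theorem expect_bpvOutput_variation_le :
    ((PMF.uniformOfFintype (Fin P.k → (ZMod P.N)ˣ)).expect fun r =>
      (P.bpvOutput r).variation (PMF.uniformOfFintype P.G)) ≤
      ENNReal.ofReal √((P.N : ℝ) / (P.k.choose P.v : ℝ) + 1 / ((P.N : ℝ) - 1)) := by
  have hN : (2 : ℝ) ≤ P.N := by exact_mod_cast P.two_le_N
  have hN' : (0 : ℝ) < P.N - 1 := by linarith
  have hC : (0 : ℝ) < P.k.choose P.v := by exact_mod_cast Nat.choose_pos P.v_lt_k.le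
  refine (PMF.expect_variation_uniform_le _ (by positivity) P.expect_bpvOutput_collision_le).trans
    (le_of_eq ?_)
  rw [P.card_eq]
  -- What remains is `N/(N-1) - 1 = 1/(N-1)`.
  congr 2
  field_simp
  ring

/-- Statistical randomness of the output of the generator. -/
theorem bpvRandom_statistical (pub : Bool) (t : ℕ) :
    P.BPVRandom pub t (t * √((P.N : ℝ) / (P.k.choose P.v : ℝ) + 1 / ((P.N : ℝ) - 1))) := by
  intro A hA
  set s := √((P.N : ℝ) / (P.k.choose P.v : ℝ) + 1 / ((P.N : ℝ) - 1)) with hs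
  have hs0 : 0 ≤ s := Real.sqrt_nonneg _
  have hq := A.queries_lt_size
  have key (p q : (Fin P.k → (ZMod P.N)ˣ) → PMF P.G)
      (hpq : ((PMF.uniformOfFintype (Fin P.k → (ZMod P.N)ˣ)).expect fun r =>
        (p r).variation (q r)) ≤ ENNReal.ofReal s) :
      ((PMF.uniformOfFintype (Fin P.k → (ZMod P.N)ˣ)).expect fun r =>
        (A.run (pointOracle (p r)) (P.bpvTableBits pub r)).expect (guessed true)) ≤
      ((PMF.uniformOfFintype (Fin P.k → (ZMod P.N)ˣ)).expect fun r =>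
        (A.run (pointOracle (q r)) (P.bpvTableBits pub r)).expect (guessed true)) +
        ENNReal.ofReal (t * s) := by
    -- The comparison is made for each table separately, with the same table string on both sides,
    -- so its visibility plays no role. Every query costs one variation, and there are at most `t`.
    have h1 (r : Fin P.k → (ZMod P.N)ˣ) :
        ((A.run (pointOracle (p r)) (P.bpvTableBits pub r)).expect (guessed true)) ≤
        ((A.run (pointOracle (q r)) (P.bpvTableBits pub r)).expect (guessed true)) +
          t * (p r).variation (q r) := by
      have h2 := Circuit.close_run (O := pointOracle (p r)) (O' := pointOracle (q r))
        (κ := fun _ _ => (p r).variation (q r))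
        (fun _ _ => (PMF.close_variation (p r) (q r)).map P.encode) A (P.bpvTableBits pub r)
        (guessed true) (guessed_le_one true)
      refine h2.trans (add_le_add le_rfl
        ((Circuit.cost_const_le _ (fun _ _ => le_rfl) _ _).trans ?_))
      gcongr
      omega
    refine (PMF.expect_mono _ h1).trans ?_
    rw [PMF.expect_add, PMF.expect_mul_left, ENNReal.ofReal_mul (by positivity),
      ENNReal.ofReal_natCast]
    gcongr
  have h1 := key P.bpvOutput (fun _ => PMF.uniformOfFintype P.G) P.expect_bpvOutput_variation_le
  -- `Close` is one-sided; the absolute value needs the other direction as well.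
  have h2 := key (fun _ => PMF.uniformOfFintype P.G) P.bpvOutput (by
    simpa only [PMF.variation_comm (PMF.uniformOfFintype P.G)] using
      P.expect_bpvOutput_variation_le)
  have e1 := P.bpvExperiment_eq pub true A
  have e2 := P.bpvExperiment_eq pub false A
  simp only [if_true, Bool.false_eq_true, if_false] at e1 e2
  rw [← e1, ← e2] at h1 h2
  have hts : 0 ≤ (t : ℝ) * s := by positivity
  have t1 := ENNReal.toReal_mono (ENNReal.add_ne_top.2 ⟨PMF.apply_ne_top _ _,
    ENNReal.ofReal_ne_top⟩) h1
  have t2 := ENNReal.toReal_mono (ENNReal.add_ne_top.2 ⟨PMF.apply_ne_top _ _,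
    ENNReal.ofReal_ne_top⟩) h2
  rw [ENNReal.toReal_add (PMF.apply_ne_top _ _) ENNReal.ofReal_ne_top,
    ENNReal.toReal_ofReal hts] at t1 t2
  rw [abs_le]
  constructor <;> linarith

end ECIESInstance

end

/-! ### Negligible functions -/

namespace Negligible

open Filter Asymptotics

variable {f g : ℕ → ℝ}

theorem add (hf : Negligible f) (hg : Negligible g) : Negligible fun κ => f κ + g κ :=
  SuperpolynomialDecay.add hf hg

theorem const_mul (hf : Negligible f) (c : ℝ) : Negligible fun κ => c * f κ :=
  SuperpolynomialDecay.const_mul hf c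

theorem of_le (hg : Negligible g) (h0 : ∀ κ, 0 ≤ f κ) (h : ∀ κ, f κ ≤ g κ) : Negligible f :=
  SuperpolynomialDecay.trans_abs_le hg fun κ => by
    rw [abs_of_nonneg (h0 κ)]
    exact (h κ).trans (le_abs_self _)

theorem poly_mul (hf : Negligible f) (p : Polynomial ℕ) :
    Negligible fun κ : ℕ => ((p.eval κ : ℕ) : ℝ) * f κ := by
  have h := SuperpolynomialDecay.polynomial_mul hf (p.map (Nat.castRingHom ℝ))
  refine h.congr fun κ => ?_
  simp [Polynomial.eval_map, Polynomial.eval₂_at_natCast]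

/-- `κ ^ n √f = √(κ ^ (2n) f)`, and the square root is continuous at 0. -/
theorem sqrt (hf : Negligible f) : Negligible fun κ => √(f κ) := fun n => by
  have h := (Real.continuous_sqrt.tendsto 0).comp (hf (2 * n))
  rw [Real.sqrt_zero] at h
  refine h.congr fun κ => ?_
  rw [Function.comp_apply, Real.sqrt_mul (by positivity), mul_comm 2 n, pow_mul,
    Real.sqrt_sq (by positivity)]

end Negligible

/-! ### Passage to asymptotic security -/

namespace ECIESInstance

variable {P : ECIESInstance}

theorem CDHHard.mono {s t : ℕ} {ε : ℝ} (h : P.CDHHard t ε) (hst : s ≤ t) : P.CDHHard s ε :=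
  fun B hB => h B (hB.trans hst)

theorem SymIND.mono {s t : ℕ} {ε : ℝ} (h : P.SymIND t ε) (hst : s ≤ t) : P.SymIND s ε :=
  fun A hA => h A (hA.trans hst)

theorem BPVRandom.mono {pub : Bool} {s t : ℕ} {ε : ℝ} (h : P.BPVRandom pub t ε) (hst : s ≤ t) :
    P.BPVRandom pub s ε :=
  fun A hA => h A (hA.trans hst)

theorem one_div_pred_le (P : ECIESInstance) : 1 / ((P.N : ℝ) - 1) ≤ 2 * (1 / P.N) := by
  have hN : (2 : ℝ) ≤ P.N := by exact_mod_cast P.two_le_N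
  rw [mul_one_div, div_le_div_iff₀ (by linarith) (by linarith)]
  linarith

/-- The assumptions are used at the single polynomial size `Q`, which dominates the concrete bound.
In the statistical case `1/(N-1) ≤ 2/N ≤ 2ε₁` makes the whole radicand negligible, so growth of `N`
need not be assumed. -/
theorem asymptoticallySecure_indcpa {P : ℕ → ECIESInstance} {pub : Bool}
    (hsize : ∃ p : Polynomial ℕ, ∀ κ : ℕ, (P κ).size ≤ p.eval κ)
    (hC : AsymptoticallySecure fun κ => (P κ).CDHHard)
    (hS : AsymptoticallySecure fun κ => (P κ).SymIND)
    (hB : Negligible (fun κ => ((P κ).N : ℝ) / ((P κ).k.choose (P κ).v : ℝ)) ∨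
      AsymptoticallySecure fun κ => (P κ).BPVRandom pub) :
    AsymptoticallySecure fun κ => (P κ).INDCPA pub := fun p => by
  obtain ⟨ps, hps⟩ := hsize
  let q : Polynomial ℕ := 10 * (p + ps)
  let Q : Polynomial ℕ := q ^ 10
  have hq (κ : ℕ) : 10 * (p.eval κ + (P κ).size) ≤ q.eval κ := by
    have := hps κ
    simp only [q, Polynomial.eval_mul, Polynomial.eval_add, Polynomial.eval_ofNat]
    omega
  have hQ (κ : ℕ) : (10 * (p.eval κ + (P κ).size)) ^ 10 ≤ Q.eval κ := by
    simp only [Q, Polynomial.eval_pow]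
    exact Nat.pow_le_pow_left (hq κ) 10
  have hlarge (κ : ℕ) : (P κ).pointLen + 2 * (P κ).msgLen + 5 ≤ Q.eval κ := by
    have h1 := (P κ).nat_size_pos
    have h2 : (P κ).pointLen + 2 * (P κ).msgLen + 5 ≤ 10 * (p.eval κ + (P κ).size) := by
      unfold size
      omega
    exact (h2.trans (Nat.le_self_pow (by norm_num) _)).trans (hQ κ)
  obtain ⟨ε₁, hε₁, h₁⟩ := hC Q
  obtain ⟨ε₂, hε₂, h₂⟩ := hS Q
  have hinv (κ : ℕ) : (1 : ℝ) / (P κ).N ≤ ε₁ κ := (h₁ κ).inv_le (by have := hlarge κ; omega)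
  obtain ⟨ε₃, hε₃, h₃⟩ : ∃ ε₃, Negligible ε₃ ∧ ∀ κ, (P κ).BPVRandom pub (Q.eval κ) (ε₃ κ) := by
    rcases hB with hB | hB
    · refine ⟨_, Negligible.poly_mul (Negligible.sqrt ?_) Q, fun κ =>
        (P κ).bpvRandom_statistical pub (Q.eval κ)⟩
      refine (hB.add (hε₁.const_mul 2)).of_le (fun κ => ?_) (fun κ => ?_)
      · have hN : (2 : ℝ) ≤ (P κ).N := by exact_mod_cast (P κ).two_le_N
        have hN' : (0 : ℝ) < (P κ).N - 1 := by linarith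
        positivity
      · gcongr
        exact (P κ).one_div_pred_le.trans (by gcongr; exact hinv κ)
    · exact hB Q
  -- The second `ε₁` stands for the term `1/N` of the concrete bound.
  refine ⟨_, (((hε₁.add hε₂).add hε₃).add hε₁).poly_mul q, fun κ A hA => ?_⟩
  have h := indcpa_of_hard ((h₁ κ).mono (hQ κ)) ((h₂ κ).mono (hQ κ)) ((h₃ κ).mono (hQ κ)) A hA
  have hl := hlarge κ
  have n₁ : 0 ≤ ε₁ κ := le_trans (by positivity) (hinv κ)
  have n₂ := (h₂ κ).nonneg (by omega)
  have n₃ := (h₃ κ).nonneg (by omega)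
  have hqr : 10 * (((p.eval κ : ℕ) : ℝ) + (P κ).size) ≤ (q.eval κ : ℕ) := by exact_mod_cast hq κ
  refine h.trans ?_
  gcongr
  exact hinv κ

end ECIESInstance

theorem theorem3 :
    -- concrete security of the scheme, for every instance and every table convention
    (∃ c : ℕ, ∀ (P : ECIESInstance) (pub : Bool) (t : ℕ) (ε₁ ε₂ ε₃ : ℝ),
      P.CDHHard ((c * (t + P.size)) ^ c) ε₁ →
      P.SymIND ((c * (t + P.size)) ^ c) ε₂ →
      P.BPVRandom pub ((c * (t + P.size)) ^ c) ε₃ →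
      P.INDCPA pub t (c * (t + P.size) * (ε₁ + ε₂ + ε₃ + 1 / P.N))) ∧
    -- statistical randomness of the output of the BPV generator
    (∀ (P : ECIESInstance) (pub : Bool) (t : ℕ),
      P.BPVRandom pub t (t * √((P.N : ℝ) / (P.k.choose P.v : ℝ) + 1 / ((P.N : ℝ) - 1)))) ∧
    -- asymptotic IND-CPA security
    (∀ (P : ℕ → ECIESInstance) (pub : Bool),
      (∃ p : Polynomial ℕ, ∀ κ : ℕ, (P κ).size ≤ p.eval κ) →
      AsymptoticallySecure (fun κ => (P κ).CDHHard) →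
      AsymptoticallySecure (fun κ => (P κ).SymIND) →
      (Negligible (fun κ => ((P κ).N : ℝ) / ((P κ).k.choose (P κ).v : ℝ)) ∨
        AsymptoticallySecure (fun κ => (P κ).BPVRandom pub)) →
      AsymptoticallySecure (fun κ => (P κ).INDCPA pub)) := by
  refine ⟨⟨10, fun P pub t ε₁ ε₂ ε₃ hC hS hB => ?_⟩, fun P pub t => P.bpvRandom_statistical pub t,
    fun P pub hsize hC hS hB => ECIESInstance.asymptoticallySecure_indcpa hsize hC hS hB⟩
  exact ECIESInstance.indcpa_of_hard hC hS hB
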